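/- Let $k$ be a number field. **Curves with modulus.** A curve with modulus is a triple $(X,Y,Z)$ of a smooth proper (not necessarily connected) $k$-curve $X$ and two effective divisors $Y,Z$ on $X$ with disjoint supports. A morphism $(X,Y,Z)\to(X',Y',Z')$ is a $k$-morphism $f:X\to X'$ with $Y\le f^*Y'$, $Z-Z_{\mathrm{red}}\ge f^*(Z'-Z'_{\mathrm{red}})$ and $f(X\setminus|Z|)\subseteq X'\setminus|Z'|$. Put $$T(X,Y,Z)=\mathbf H^1_{\mathrm{dR}}(X,Y,Z)=\mathbf H^1\bigl(X,[\mathcal I_Y\xrightarrow{d}\mathcal I_Z^{-1}\Omega^1_X]\bigr),$$ which is contravariant in $(X,Y,Z)$, and $$\mathrm{fil}^2T(X,Y,Z)=\mathrm{Im}\bigl(\ker[T(X,Y,Z_{\mathrm{red}})\to T(X,Y_{\mathrm{red}},Z_{\mathrm{red}})]\to T(X,Y,Z)\bigr).$$ **The category $\mathrm{ECMM}_1$.** $\mathrm{ECMM}_1$ is Nori's $\mathbb Q$-linear abelian category of the representation $T$ with values in finite dimensional $\mathbb Q$-vector spaces: the filtered colimit, over the finite full subquivers $E$ of the quiver of curves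 with modulus, of the categories of finite dimensional $\mathrm{End}_{\mathbb Q}(T|_E)$-modules. The functor $\mathrm{fil}^2$ extends to an exact subfunctor of the identity of $\mathrm{ECMM}_1$, and $\mathrm{ECMM}_1^{\mathrm{uni}}$ is the full subcategory of the objects $A$ with $\mathrm{fil}^2A=A$. It contains the objects $\mathrm{fil}^2T(X,Y,Z)$. **Unipotent 1-isomotives.** $\mathscr M_{1,\mathbb Q}^{\mathrm{uni}}$ is the category of unipotent commutative algebraic $k$-groups (the Laumon 1-isomotives $[0\to G]$ with $G$ unipotent), with groups of morphisms $\mathrm{Hom}\otimes_{\mathbb Z}\mathbb Q$. For a curve with modulus let $J(X,Y)_{\mathrm{uni}}=\ker(J(X,Y)\to J(X,Y_{\mathrm{red}}))$ be the unipotent part of the generalized Jacobian, that is, the group $R\mapsto\ker\bigl(\Gamma(Y_R,\mathcal O)^\times\to\Gamma((Y_{\mathrm{red}})_R,\mathcal O)^\times\bigr)$. It is contravariant in $(X,Y,Z)$, and its Lie algebra is $H^0(X,\mathcal I_{Y_{\mathrm{red}}}/\mathcal I_Y)$ through $r\mapsto 1+\varepsilon r$. **The functor $\mathsf{LM}$.**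 $\mathsf{LM}:\mathrm{ECMM}_1^{\mathrm{uni}}\to\mathscr M_{1,\mathbb Q}^{\mathrm{uni}}$ is the additive functor, characterized up to isomorphism, for which there are * isomorphisms $\alpha:\mathsf{LM}(\mathrm{fil}^2T(X,Y,Z))\cong J(X,Y)_{\mathrm{uni}}$, natural in the curve with modulus $(X,Y,Z)$, and * an isomorphism $\beta$ from the forgetful functor $\mathrm{ECMM}_1^{\mathrm{uni}}\to\mathrm{mod}(\mathbb Q)$ to the de Rham realization $\mathrm{Lie}\circ\mathsf{LM}$, such that, for every $r\in H^0(X,\mathcal I_{Y_{\mathrm{red}}}/\mathcal I_Y)$, the composite $\mathrm{Lie}(\alpha)\circ\beta$ takes the image of $r$ under the canonical map $H^0(X,\mathcal I_{Y_{\mathrm{red}}}/\mathcal I_Y)\to\mathrm{fil}^2T(X,Y,Z)$ to $1+\varepsilon r\in\mathrm{Lie}\,J(X,Y)_{\mathrm{uni}}$. **Proposition.** The functor $\mathsf{LM}$ exists, and it (that is, every functor with these properties) is an equivalence of categories $$\mathsf{LM}:\mathrm{ECMM}_1^{\mathrm{uni}}\xrightarrow{\ \sim\ }\mathscr M_{1,\mathbb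 Q}^{\mathrm{uni}}.$$ Moreover $\mathscr M_{1,\mathbb Q}^{\mathrm{uni}}$ is equivalent to the category $\mathrm{mod}(k)$ of finite dimensional $k$-vector spaces: the functor which takes $V$ to the vector group $R\mapsto R\otimes_kV$ takes unipotent values, is fully faithful, and every unipotent commutative algebraic $k$-group is isomorphic, in $\mathscr M_{1,\mathbb Q}^{\mathrm{uni}}$, to a vector group. -/

import Mathlib

open CategoryTheory AlgebraicGeometry TensorProduct

universe v w u

noncomputable section

namespace ModulusCurve

/-- A smooth proper curve over `k` (not necessarily connected). -/
structure Curve (k : Type u) [Field k] where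
  X : Scheme.{u}
  str : X ⟶ Spec (.of k)
  smooth : SmoothOfRelativeDimension 1 str
  proper : IsProper str

section Local
variable {k : Type u} [Field k] (C : Curve k)

/-- The local ring `𝒪_{X,x}`. -/
abbrev Curve.stalk (x : C.X) : Type u := C.X.presheaf.stalk x

/-- The structure map `k → 𝒪_{X,x}`. -/
def Curve.toStalk (x : C.X) : CommRingCat.of k ⟶ C.X.presheaf.stalk x :=
  (Scheme.ΓSpecIso (.of k)).inv ≫ C.str.appTop ≫ C.X.presheaf.germ ⊤ x trivial

instance (x : C.X) : Algebra k (C.stalk x) := (C.toStalk x).hom.toAlgebra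

lemma Curve.algebraMap_stalk (x : C.X) (a : k) :
    algebraMap k (C.stalk x) a = (C.toStalk x).hom a := rfl

/-- The localisation map `𝒪_{X,x} → 𝒪_{X,η}` for `x` in the closure of `η`. -/
def Curve.spec {η x : C.X} (h : η ⤳ x) : C.stalk x →ₐ[k] C.stalk η where
  __ := (C.X.presheaf.stalkSpecializes h).hom
  commutes' a := by
    have : C.toStalk x ≫ C.X.presheaf.stalkSpecializes h = C.toStalk η := by
      have e := C.X.presheaf.germ_stalkSpecializes (U := ⊤) trivial h
      simp only [Curve.toStalk, Category.assoc]
      exact congr(_ ≫ _ ≫ $e)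
    exact congr($(this).hom a)

/-- A `k`-morphism of curves. -/
structure CurveHom (C C' : Curve k) where
  f : C.X ⟶ C'.X
  comm : f ≫ C'.str = C.str

variable {C} {C' : Curve k}

/-- Pull-back of germs of functions. -/
def CurveHom.stalkMap (f : CurveHom C C') (x : C.X) : C'.stalk (f.f x) →ₐ[k] C.stalk x where
  __ := (f.f.stalkMap x).hom
  commutes' a := by
    have : C'.toStalk (f.f x) ≫ f.f.stalkMap x = C.toStalk x := by
      have h : C'.str.appTop ≫ f.f.appTop = C.str.appTop := by
        rw [← f.comm]; rfl
      have e := f.f.germ_stalkMap ⊤ x trivial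
      simp only [Curve.toStalk, Category.assoc, ← h]
      exact congr(_ ≫ _ ≫ $e)
    exact congr($(this).hom a)

lemma CurveHom.spec_stalkMap (f : CurveHom C C') {η x : C.X} (h : η ⤳ x)
    (a : C'.stalk (f.f x)) :
    f.stalkMap η (C'.spec (f.f.base.hom.map_specializes h) a) = C.spec h (f.stalkMap x a) :=
  Scheme.Hom.stalkSpecializes_stalkMap_apply f.f _ _ h a

variable (C) in
/-- The identity morphism. -/
def CurveHom.id : CurveHom C C := ⟨𝟙 C.X, by simp⟩

lemma CurveHom.stalkMap_id (x : C.X) (a : C.stalk x) : (CurveHom.id C).stalkMap x a = a := by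
  change ((𝟙 C.X : C.X ⟶ C.X).stalkMap x).hom a = a
  rw [Scheme.Hom.stalkMap_id]; rfl

lemma CurveHom.map_id (x : C.X) (I : Ideal (C.stalk x)) :
    Ideal.map ((CurveHom.id C).stalkMap x) I = I := by
  refine le_antisymm (Ideal.map_le_of_le_comap fun a ha => ?_) fun a ha => ?_
  · exact (congrArg (· ∈ I) (CurveHom.stalkMap_id x a)).mpr ha
  · have h := Ideal.mem_map_of_mem ((CurveHom.id C).stalkMap x) ha
    exact (congrArg (· ∈ Ideal.map ((CurveHom.id C).stalkMap x) I)
      (CurveHom.stalkMap_id x a)).mp h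
end Local

section Kaehler
/-- The map `Ω_{A/k} → Ω_{B/k}` induced by a homomorphism of `k`-algebras. -/
def formMap {k A B : Type u} [CommRing k] [CommRing A] [CommRing B] [Algebra k A] [Algebra k B]
    (φ : A →ₐ[k] B) : Ω[A⁄k] →ₗ[k] Ω[B⁄k] :=
  letI := φ.toRingHom.toAlgebra
  haveI : IsScalarTower k A B := .of_algebraMap_eq' φ.comp_algebraMap.symm
  (KaehlerDifferential.map k k A B).restrictScalars k

variable {k A B : Type u} [CommRing k] [CommRing A] [CommRing B] [Algebra k A] [Algebra k B]
    (φ : A →ₐ[k] B)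
lemma formMap_D (a : A) :
    formMap φ (KaehlerDifferential.D k A a) = KaehlerDifferential.D k B (φ a) := by
  let _ := φ.toRingHom.toAlgebra
  have : IsScalarTower k A B := .of_algebraMap_eq' φ.comp_algebraMap.symm
  exact KaehlerDifferential.map_D k k A B a

lemma formMap_smul (a : A) (ω : Ω[A⁄k]) : formMap φ (a • ω) = φ a • formMap φ ω := by
  let _ := φ.toRingHom.toAlgebra
  have : IsScalarTower k A B := .of_algebraMap_eq' φ.comp_algebraMap.symm
  change KaehlerDifferential.map k k A B (a • ω) = φ a • KaehlerDifferential.map k k A B ω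
  rw [map_smul]
  rw [← algebraMap_smul B a]; rfl

lemma formMap_id (ω : Ω[A⁄k]) : formMap (AlgHom.id k A) ω = ω := by
  have h : ω ∈ Submodule.span A (Set.range (KaehlerDifferential.D k A)) := by
    rw [KaehlerDifferential.span_range_derivation]; trivial
  induction h using Submodule.span_induction with
  | mem x hx => obtain ⟨a, rfl⟩ := hx; rw [formMap_D, AlgHom.id_apply]
  | zero => rw [map_zero]
  | add x y _ _ hx hy => rw [map_add, hx, hy]
  | smul a x _ hx => rw [formMap_smul, hx, AlgHom.id_apply]
end Kaehler

/-- An effective divisor: a finite formal sum of closed points with multiplicities in `ℕ`. -/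
structure EffDiv {k : Type u} [Field k] (C : Curve k) where
  mult : C.X → ℕ
  finite : {x | mult x ≠ 0}.Finite
  closed : ∀ x, mult x ≠ 0 → IsClosed {x}

namespace EffDiv
variable {k : Type u} [Field k] {C : Curve k}

/-- The reduced divisor `D_red`. -/
def red (D : EffDiv C) : EffDiv C where
  mult x := min (D.mult x) 1
  finite := D.finite.subset fun x hx => by simp only [Set.mem_ofPred_eq] at hx ⊢; omega
  closed x hx := D.closed x (by omega)

/-- The stalk at `x` of the ideal sheaf `𝓘_D`. -/
def ideal (D : EffDiv C) (x : C.X) : Ideal (C.stalk x) :=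
  IsLocalRing.maximalIdeal (C.stalk x) ^ D.mult x

/-- The stalk at `x` of the ideal sheaf of `D - D_red`. -/
def idealSub (D : EffDiv C) (x : C.X) : Ideal (C.stalk x) :=
  IsLocalRing.maximalIdeal (C.stalk x) ^ (D.mult x - 1)

lemma ideal_le_red (D : EffDiv C) (x : C.X) : D.ideal x ≤ D.red.ideal x :=
  Ideal.pow_le_pow_right (min_le_left _ _)

lemma idealSub_red (D : EffDiv C) (x : C.X) : D.red.idealSub x = ⊤ := by
  have : min (D.mult x) 1 - 1 = 0 := by omega
  simp only [idealSub, red, this]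
  exact (pow_zero (IsLocalRing.maximalIdeal (C.stalk x))).trans Ideal.one_eq_top

lemma ideal_red_of_pos (D : EffDiv C) (x : C.X) (h : 0 < D.mult x) :
    D.red.ideal x = IsLocalRing.maximalIdeal (C.stalk x) := by
  have : min (D.mult x) 1 = 1 := by omega
  simp only [ideal, red, this]
  exact pow_one _

lemma ideal_of_eq_zero (D : EffDiv C) (x : C.X) (h : D.mult x = 0) : D.ideal x = ⊤ := by
  simp only [ideal, h]
  exact (pow_zero (IsLocalRing.maximalIdeal (C.stalk x))).trans Ideal.one_eq_top

lemma ideal_red_of_eq_zero (D : EffDiv C) (x : C.X) (h : D.mult x = 0) : D.red.ideal x = ⊤ :=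
  D.red.ideal_of_eq_zero x (by simp [red, h])

lemma mem_red_of_pos {D : EffDiv C} {x : C.X} : 0 < D.red.mult x ↔ 0 < D.mult x := by
  simp only [red]; omega
end EffDiv

/-- A curve with modulus `(X, Y, Z)`: a smooth proper curve with two effective divisors
with disjoint supports. -/
structure MCrv (k : Type u) [Field k] where
  C : Curve k
  Y : EffDiv C
  Z : EffDiv C
  disj : ∀ x, Y.mult x = 0 ∨ Z.mult x = 0

namespace MCrv
variable {k : Type u} [Field k]

/-- A morphism `(X,Y,Z) → (X',Y',Z')`: a `k`-morphism `f` with `Y ≤ f^*Y'`,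
`Z - Z_red ≥ f^*(Z' - Z'_red)` and `f(X \ |Z|) ⊆ X' \ |Z'|`. The inequalities of divisors are
expressed by the inclusions of the ideals which define them, so that they make sense also when `f`
is constant on some component. -/
structure Hom (p q : MCrv k) extends CurveHom p.C q.C where
  hY : ∀ x, (q.Y.ideal (f x)).map (toCurveHom.stalkMap x) ≤ p.Y.ideal x
  hZ : ∀ x, p.Z.idealSub x ≤ (q.Z.idealSub (f x)).map (toCurveHom.stalkMap x)
  hZred : ∀ x, 0 < q.Z.mult (f x) → 0 < p.Z.mult x

/-- `(X, Y, Z_red)` -/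
abbrev redZ (p : MCrv k) : MCrv k where
  C := p.C
  Y := p.Y
  Z := p.Z.red
  disj x := (p.disj x).imp id fun h => by simp [EffDiv.red, h]

/-- `(X, Y_red, Z)` -/
abbrev redY (p : MCrv k) : MCrv k where
  C := p.C
  Y := p.Y.red
  Z := p.Z
  disj x := (p.disj x).imp (fun h => by simp [EffDiv.red, h]) id

/-- The identity of `X` as a morphism `(X, Y, Z) → (X, Y, Z_red)`. -/
def toRedZ (p : MCrv k) : Hom p p.redZ where
  toCurveHom := CurveHom.id p.C
  hY x := (CurveHom.map_id x (p.Y.ideal x)).le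
  hZ x := by
    refine le_trans ?_ (CurveHom.map_id x (p.Z.red.idealSub x)).ge
    exact Ideal.pow_le_pow_right (by simp only [EffDiv.red]; omega)
  hZred x h := EffDiv.mem_red_of_pos.1 h

/-- The identity of `X` as a morphism `(X, Y_red, Z) → (X, Y, Z)`. -/
def fromRedY (p : MCrv k) : Hom p.redY p where
  toCurveHom := CurveHom.id p.C
  hY x := (CurveHom.map_id x (p.Y.ideal x)).le.trans (p.Y.ideal_le_red x)
  hZ x := (CurveHom.map_id x (p.Z.idealSub x)).ge
  hZred _ h := h
end MCrv

section Cohomology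
variable {k : Type u} [Field k]

/-- `η` is the generic point of an irreducible component. -/
def IsGeneric (C : Curve k) (η : C.X) : Prop := ∀ y : C.X, y ⤳ η → y = η

/-- The generic points of the components of `X`. -/
abbrev GenPt (C : Curve k) := {η : C.X // IsGeneric C η}

/-- A point `x` of `X` together with the generic point `η` of a component through `x`
(the component is unique as `X` is smooth). -/
structure Place (C : Curve k) where
  η : GenPt C
  x : C.X
  h : η.1 ⤳ x

variable {C : Curve k}

/-- The function field of the component `η` (the local ring at its generic point). -/
abbrev FunField (η : GenPt C) : Type u := C.stalk η.1

/-- The map from the local ring at `x` to the function field. -/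
abbrev Place.loc (i : Place C) : C.stalk i.x →ₐ[k] FunField i.η := C.spec i.h

/-- The stalk of `𝓘_Y` at `x`, as a subspace of the function field. -/
def EffDiv.functions (Y : EffDiv C) (i : Place C) : Submodule k (FunField i.η) :=
  ((Y.ideal i.x).restrictScalars k).map i.loc.toLinearMap

/-- The stalk at `x` of the inverse of the ideal sheaf of `Z - Z_red`. -/
def EffDiv.polar (Z : EffDiv C) (i : Place C) : Set (FunField i.η) :=
  {g | ∀ a ∈ Z.idealSub i.x, ∃ b, g * i.loc a = i.loc b}

/-- The stalk of `𝓘_Z⁻¹ Ω¹_X` at `x`, as a subspace of the Kähler differentials of the function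
field. It is written as `𝓘_{Z - Z_red}⁻¹ Ω¹_X(log Z_red)`: it is spanned by the forms `g da` and,
if `x` lies on `Z`, `g da / a`, where `a` is a local function and `g` a local section
of `𝓘_{Z - Z_red}⁻¹`. -/
def EffDiv.forms (Z : EffDiv C) (i : Place C) : Submodule k (Ω[FunField i.η⁄k]) :=
  Submodule.span k ({ω | ∃ g ∈ Z.polar i, ∃ a, ω = g • KaehlerDifferential.D k _ (i.loc a)} ∪
    {ω | 0 < Z.mult i.x ∧ ∃ g ∈ Z.polar i, ∃ a v, v * i.loc a = 1 ∧
      ω = (g * v) • KaehlerDifferential.D k _ (i.loc a)})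

variable (C) in
/-- The 1-cochains `(ω, r)`: a rational differential form and a rational function at
every point. -/
abbrev Cochain : Type u := (∀ η : GenPt C, Ω[FunField η⁄k]) × (∀ i : Place C, FunField i.η)

/-- The 1-cocycles `(ω, r)`: the form `ω - d r_x` lies in `(𝓘_Z⁻¹ Ω¹)_x` for all `x`. Together with
the coboundaries they compute the first cohomology of the total complex of the flasque resolutions
`K → ⨁ₓ K/(𝓘_Y)_x` and `Ω_K → ⨁ₓ Ω_K/(𝓘_Z⁻¹ Ω¹)_x` of the two terms of
`[𝓘_Y → 𝓘_Z⁻¹ Ω¹_X]`. That `r_x` is regular for almost all `x` is automatic in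
characteristic `0`, since `d r_x` is. -/
def cocycles (p : MCrv k) : Submodule k (Cochain p.C) where
  carrier := {c | ∀ i, c.1 i.η - KaehlerDifferential.D k _ (c.2 i) ∈ p.Z.forms i}
  add_mem' {c d} hc hd i := by
    have := add_mem (hc i) (hd i)
    rw [sub_add_sub_comm] at this
    simpa using this
  zero_mem' i := by simp
  smul_mem' a c hc i := by
    have := (p.Z.forms i).smul_mem a (hc i)
    simpa [smul_sub] using this

/-- The 1-coboundaries: `(dh, h)`, up to local sections of `𝓘_Y` in the second component. -/
def coboundaries (p : MCrv k) : Submodule k (Cochain p.C) where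
  carrier := {c | ∃ h : ∀ η, FunField η, (∀ η, c.1 η = KaehlerDifferential.D k _ (h η)) ∧
    ∀ i, c.2 i - h i.η ∈ p.Y.functions i}
  add_mem' := by
    rintro c d ⟨h, h1, h2⟩ ⟨h', h1', h2'⟩
    refine ⟨h + h', fun η => by simp [h1, h1'], fun i => ?_⟩
    have := add_mem (h2 i) (h2' i)
    rw [sub_add_sub_comm] at this
    simpa using this
  zero_mem' := ⟨0, fun η => by simp, fun i => by simp⟩
  smul_mem' := by
    rintro a c ⟨h, h1, h2⟩
    refine ⟨a • h, fun η => by simp [h1], fun i => ?_⟩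
    have := (p.Y.functions i).smul_mem a (h2 i)
    simpa [smul_sub] using this

/-- `𝐇¹_dR(X,Y,Z)`, the first hypercohomology of `[𝓘_Y → 𝓘_Z⁻¹ Ω¹_X]`. -/
def H1 (p : MCrv k) : Type u := cocycles p ⧸ (coboundaries p).submoduleOf (cocycles p)

instance (p : MCrv k) : AddCommGroup (H1 p) :=
  inferInstanceAs (AddCommGroup (cocycles p ⧸ (coboundaries p).submoduleOf (cocycles p)))
instance (p : MCrv k) : Module k (H1 p) :=
  inferInstanceAs (Module k (cocycles p ⧸ (coboundaries p).submoduleOf (cocycles p)))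

/-- The class of a cocycle. -/
def H1.mk (p : MCrv k) : cocycles p →ₗ[k] H1 p := Submodule.mkQ _

variable {p q : MCrv k}

/-- The image of a place on a component on which `f` is not constant. -/
abbrev Place.map (f : MCrv.Hom p q) (i : Place p.C) (h : IsGeneric q.C (f.f i.η.1)) : Place q.C :=
  ⟨⟨_, h⟩, f.f i.x, f.f.base.hom.map_specializes i.h⟩

open Classical in
/-- Pull-back of cochains: the usual one on the components of `X` which dominate a
component of `X'`, and `0` on those on which `f` is constant (there `f` factors through a closed
point, which has no first cohomology). -/
def pullCochain (f : MCrv.Hom p q) : Cochain q.C →ₗ[k] Cochain p.C where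
  toFun c := (fun η => if h : IsGeneric q.C (f.f η.1) then
      formMap (f.stalkMap η.1) (c.1 ⟨_, h⟩) else 0,
    fun i => if h : IsGeneric q.C (f.f i.η.1) then f.stalkMap i.η.1 (c.2 (i.map f h)) else 0)
  map_add' c d := by
    ext i
    · by_cases h : IsGeneric q.C (f.f i.1) <;> simp [h]
    · by_cases h : IsGeneric q.C (f.f i.η.1)
      · simp only [h, dite_true, Prod.snd_add, Pi.add_apply]
        exact map_add (f.stalkMap i.η.1) _ _
      · simp [h]
  map_smul' a c := by
    ext i
    · by_cases h : IsGeneric q.C (f.f i.1) <;> simp [h]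
    · by_cases h : IsGeneric q.C (f.f i.η.1)
      · simp only [h, dite_true, Prod.smul_snd, Pi.smul_apply]
        exact map_smul (f.stalkMap i.η.1) a _
      · simp [h]

lemma pull_loc (f : MCrv.Hom p q) (i : Place p.C) (h : IsGeneric q.C (f.f i.η.1))
    (a : q.C.stalk (f.f i.x)) :
    f.stalkMap i.η.1 ((i.map f h).loc a) = i.loc (f.stalkMap i.x a) :=
  f.spec_stalkMap i.h a

lemma pull_functions (f : MCrv.Hom p q) (i : Place p.C) (h : IsGeneric q.C (f.f i.η.1))
    (r : FunField (i.map f h).η) (hr : r ∈ q.Y.functions (i.map f h)) :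
    f.stalkMap i.η.1 r ∈ p.Y.functions i := by
  obtain ⟨a, ha, rfl⟩ := hr
  exact ⟨f.stalkMap i.x a, f.hY i.x (Ideal.mem_map_of_mem _ ha), (pull_loc f i h a).symm⟩

lemma pull_polar (f : MCrv.Hom p q) (i : Place p.C) (h : IsGeneric q.C (f.f i.η.1))
    (g : FunField (i.map f h).η) (hg : g ∈ q.Z.polar (i.map f h)) :
    f.stalkMap i.η.1 g ∈ p.Z.polar i := by
  intro a ha
  refine Submodule.span_induction (p := fun a _ => ∃ b, f.stalkMap i.η.1 g * i.loc a = i.loc b)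
    ?_ ⟨0, by simp⟩ ?_ ?_ (f.hZ i.x ha)
  · rintro _ ⟨b, hb, rfl⟩
    obtain ⟨c, hc⟩ := hg b hb
    refine ⟨f.stalkMap i.x c, ?_⟩
    have := congrArg (f.stalkMap i.η.1) hc
    rw [← pull_loc f i h c, ← this, map_mul, pull_loc f i h b]
  · rintro a b _ _ ⟨a', ha⟩ ⟨b', hb⟩
    exact ⟨a' + b', by rw [map_add, mul_add, ha, hb, map_add]⟩
  · rintro c a _ ⟨a', ha⟩
    exact ⟨c * a', by rw [smul_eq_mul, map_mul, mul_left_comm, ha, map_mul]⟩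

lemma pull_forms (f : MCrv.Hom p q) (i : Place p.C) (h : IsGeneric q.C (f.f i.η.1))
    (ω : Ω[FunField (i.map f h).η⁄k]) (hω : ω ∈ q.Z.forms (i.map f h)) :
    formMap (f.stalkMap i.η.1) ω ∈ p.Z.forms i := by
  refine Submodule.span_le (p := (p.Z.forms i).comap (formMap (f.stalkMap i.η.1))).2 ?_ hω
  rintro _ (⟨g, hg, a, rfl⟩ | ⟨hx, g, hg, a, v, hv, rfl⟩)
  · refine Submodule.subset_span (Or.inl ⟨_, pull_polar f i h g hg, f.stalkMap i.x a, ?_⟩)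
    rw [formMap_smul, formMap_D, pull_loc f i h]
  · refine Submodule.subset_span (Or.inr ⟨f.hZred _ hx, _, pull_polar f i h g hg,
      f.stalkMap i.x a, f.stalkMap i.η.1 v, ?_, ?_⟩)
    · have := congrArg (f.stalkMap i.η.1) hv
      rwa [map_mul, pull_loc f i h, map_one] at this
    · rw [formMap_smul, formMap_D, pull_loc f i h, map_mul]

lemma pull_cocycles (f : MCrv.Hom p q) : cocycles q ≤ (cocycles p).comap (pullCochain f) := by
  intro c hc i
  by_cases h : IsGeneric q.C (f.f i.η.1)
  · have := pull_forms f i h _ (hc (i.map f h))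
    rw [map_sub, formMap_D] at this
    simpa [pullCochain, h] using this
  · simp [pullCochain, h]

open Classical in
lemma pull_coboundaries (f : MCrv.Hom p q) :
    coboundaries q ≤ (coboundaries p).comap (pullCochain f) := by
  rintro c ⟨u, h1, h2⟩
  refine ⟨fun η => if h : IsGeneric q.C (f.f η.1) then f.stalkMap η.1 (u ⟨_, h⟩) else 0,
    fun η => ?_, fun i => ?_⟩
  · by_cases h : IsGeneric q.C (f.f η.1)
    · simp [pullCochain, h, h1, formMap_D]
    · simp [pullCochain, h]
  · by_cases h : IsGeneric q.C (f.f i.η.1)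
    · have := pull_functions f i h _ (h2 (i.map f h))
      rw [map_sub] at this
      simpa [pullCochain, h] using this
    · simp [pullCochain, h]

/-- The pull-back `f^* : 𝐇¹_dR(X',Y',Z') → 𝐇¹_dR(X,Y,Z)`. -/
def pull (f : MCrv.Hom p q) : H1 q →ₗ[k] H1 p :=
  Submodule.mapQ _ _ ((pullCochain f).restrict (pull_cocycles f))
    fun _ hc => pull_coboundaries f hc

/-- The subspace `fil² 𝐇¹_dR(X,Y,Z)`: the image in `𝐇¹_dR(X,Y,Z)` of the kernel of
`𝐇¹_dR(X,Y,Z_red) → 𝐇¹_dR(X,Y_red,Z_red)`. -/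
def fil2 (p : MCrv k) : Submodule k (H1 p) :=
  (LinearMap.ker (pull p.redZ.fromRedY)).map (pull p.toRedZ)

end Cohomology

section Functoriality
variable {k : Type u} [Field k] {p q : MCrv k}

/-- A morphism `(X,Y,Z) → (X',Y',Z')` is a morphism `(X,Y,Z_red) → (X',Y',Z'_red)`. -/
def MCrv.Hom.redZ (f : MCrv.Hom p q) : MCrv.Hom p.redZ q.redZ where
  toCurveHom := f.toCurveHom
  hY := f.hY
  hZ x := by
    change _ ≤ Ideal.map (f.stalkMap x) (q.Z.red.idealSub (f.f x))
    rw [EffDiv.idealSub_red q.Z, Ideal.map_top]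
    exact le_top
  hZred x h := EffDiv.mem_red_of_pos.2 (f.hZred x (EffDiv.mem_red_of_pos.1 h))

/-- A morphism `(X,Y,Z) → (X',Y',Z')` is a morphism `(X,Y_red,Z) → (X',Y'_red,Z')`. -/
def MCrv.Hom.redY (f : MCrv.Hom p q) : MCrv.Hom p.redY q.redY where
  toCurveHom := f.toCurveHom
  hY x := by
    have h := f.hY x
    change Ideal.map (f.stalkMap x) (q.Y.red.ideal (f.f x)) ≤ p.Y.red.ideal x
    rcases Nat.eq_zero_or_pos (p.Y.mult x) with hx | hx
    · rw [EffDiv.ideal_red_of_eq_zero _ x hx]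
      exact le_top
    rw [EffDiv.ideal_red_of_pos _ x hx]
    rcases Nat.eq_zero_or_pos (q.Y.mult (f.f x)) with hy | hy
    · rw [EffDiv.ideal_of_eq_zero _ _ hy] at h
      rw [EffDiv.ideal_red_of_eq_zero _ _ hy]
      exact h.trans (Ideal.pow_le_self hx.ne')
    · rw [EffDiv.ideal_red_of_pos _ _ hy]
      have hl : IsLocalHom (f.f.stalkMap x).hom := inferInstance
      exact ((IsLocalRing.local_hom_TFAE (f.f.stalkMap x).hom).out 0 2).1 hl
  hZ := f.hZ
  hZred := f.hZred

lemma pullCochain_id (f : MCrv.Hom p q) (hC : q.C = p.C)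
    (hf : HEq f.toCurveHom (CurveHom.id p.C)) (c : Cochain q.C) : HEq (pullCochain f c) c := by
  obtain ⟨C, Y, Z, d⟩ := p
  obtain ⟨C', Y', Z', d'⟩ := q
  obtain ⟨f, h1, h2, h3⟩ := f
  dsimp only at hC
  subst hC
  cases eq_of_heq hf
  refine heq_of_eq (Prod.ext (funext fun η => ?_) (funext fun i => ?_))
  · have h : IsGeneric C' ((CurveHom.id C').f η.1) := η.2
    have e : (CurveHom.id C').stalkMap η.1 = AlgHom.id k _ :=
      AlgHom.ext (CurveHom.stalkMap_id η.1)
    refine (dif_pos h).trans ((congrArg (fun φ => formMap φ (c.1 η)) e).trans ?_)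
    exact formMap_id (c.1 η)
  · have h : IsGeneric C' ((CurveHom.id C').f i.η.1) := i.η.2
    exact (dif_pos h).trans (CurveHom.stalkMap_id i.η.1 (c.2 i))

lemma pullCochain_toRedZ (c : Cochain p.C) : pullCochain p.toRedZ c = c :=
  eq_of_heq (pullCochain_id p.toRedZ rfl HEq.rfl c)

lemma pullCochain_fromRedY (c : Cochain p.C) : pullCochain p.fromRedY c = c :=
  eq_of_heq (pullCochain_id p.fromRedY rfl HEq.rfl c)

lemma H1.mk_surjective (x : H1 p) : ∃ c, H1.mk p c = x := Submodule.mkQ_surjective _ x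

lemma H1.mk_eq_zero (c : cocycles p) : H1.mk p c = 0 ↔ c.1 ∈ coboundaries p :=
  Submodule.Quotient.mk_eq_zero _

lemma pull_mk (f : MCrv.Hom p q) (c : cocycles q) :
    pull f (H1.mk q c) = H1.mk p ⟨pullCochain f c.1, pull_cocycles f c.2⟩ := rfl

lemma pull_fil2 (f : MCrv.Hom p q) {x : H1 q} (hx : x ∈ fil2 q) : pull f x ∈ fil2 p := by
  obtain ⟨y, hy, rfl⟩ := hx
  refine ⟨pull f.redZ y, ?_, ?_⟩
  · have e : ∀ y, pull p.redZ.fromRedY (pull f.redZ y) =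
        pull f.redZ.redY (pull q.redZ.fromRedY y) := by
      intro y
      obtain ⟨c, rfl⟩ := H1.mk_surjective y
      refine congrArg (H1.mk _) (Subtype.ext ?_)
      exact (pullCochain_fromRedY (p := p.redZ) _).trans
        (congrArg (pullCochain f) (pullCochain_fromRedY (p := q.redZ) c.1)).symm
    change pull p.redZ.fromRedY (pull f.redZ y) = 0
    rw [e, LinearMap.mem_ker.1 hy, map_zero]
  · obtain ⟨c, rfl⟩ := H1.mk_surjective y
    refine congrArg (H1.mk _) (Subtype.ext ?_)
    exact (pullCochain_toRedZ (p := p) _).trans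
        (congrArg (pullCochain f) (pullCochain_toRedZ (p := q) c.1)).symm

/-- A local section of `𝓘_{Y_red}` at every point; only its residue class modulo `𝓘_Y` will
matter. -/
abbrev Nilp (p : MCrv k) : Type u := ∀ x : p.C.X, p.Y.red.ideal x

/-- The cochain `(0, r)`. -/
def Nilp.cochain (r : Nilp p) : Cochain p.C := (0, fun i => i.loc (r i.x))

lemma Nilp.mem_cocycles (r : Nilp p) : r.cochain ∈ cocycles p := by
  intro i
  have : KaehlerDifferential.D k _ (i.loc (r i.x).1) ∈ p.Z.forms i := by
    refine Submodule.subset_span (Or.inl ⟨1, fun a _ => ⟨a, one_mul _⟩, (r i.x).1, ?_⟩)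
    rw [one_smul]
  simpa [cochain] using this

/-- The class of `(0, r)`: the image of `r` under the canonical map
`H⁰(X, 𝓘_{Y_red}/𝓘_Y) → 𝐇¹_dR(X,Y,Z)`. -/
def Nilp.toH1 (r : Nilp p) : H1 p := H1.mk p ⟨r.cochain, r.mem_cocycles⟩

lemma Nilp.toH1_mem (r : Nilp p) : r.toH1 ∈ fil2 p := by
  refine ⟨Nilp.toH1 (p := p.redZ) r, ?_, ?_⟩
  · refine (H1.mk_eq_zero _).2 ⟨0, fun η => ?_, fun i => ?_⟩
    · exact congrFun (congrArg Prod.fst (pullCochain_fromRedY (p := p.redZ)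
        (Nilp.cochain (p := p.redZ) r))) η |>.trans (map_zero _).symm
    · have e := congrFun (congrArg Prod.snd (pullCochain_fromRedY (p := p.redZ)
        (Nilp.cochain (p := p.redZ) r))) i
      refine (congrArg (· ∈ p.redZ.redY.Y.functions i) ?_).mpr
        (⟨(r i.x).1, (r i.x).2, rfl⟩ : i.loc (r i.x).1 ∈ p.redZ.redY.Y.functions i)
      exact (sub_zero _).trans e
  · exact congrArg (H1.mk _) (Subtype.ext (pullCochain_toRedZ (p := p) _))

end Functoriality

section Finiteness

lemma finite_of_pow_smul {k A : Type u} [Field k] [CommRing A] [IsLocalRing A]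
    [IsNoetherianRing A] [Algebra k A] [Module.Finite k (IsLocalRing.ResidueField A)] (n : ℕ) :
    ∀ (M : Type u) [AddCommGroup M] [Module A M] [Module k M] [IsScalarTower k A M]
      [Module.Finite A M],
      IsLocalRing.maximalIdeal A ^ n • (⊤ : Submodule A M) = ⊥ → Module.Finite k M := by
  induction n with
  | zero =>
    intro M _ _ _ _ _ h
    rw [pow_zero, Submodule.one_smul] at h
    have : Subsingleton M := (Submodule.subsingleton_iff A).1 (subsingleton_of_bot_eq_top h.symm)
    infer_instance
  | succ n ih =>
    intro M _ _ _ _ _ h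
    let N : Submodule A M := IsLocalRing.maximalIdeal A • ⊤
    have : Module.Finite k N := by
      refine ih N ?_
      apply Submodule.map_injective_of_injective N.subtype_injective
      rw [Submodule.map_smul'', Submodule.map_bot, Submodule.map_subtype_top, ← h, pow_succ,
        mul_smul]
    have : Module.Finite k (N.restrictScalars k) := this
    have : Module.Finite k (M ⧸ N) := by
      have : Module.Finite (A ⧸ IsLocalRing.maximalIdeal A) (M ⧸ N) :=
        Module.Finite.of_restrictScalars_finite A _ _
      have : IsScalarTower k (A ⧸ IsLocalRing.maximalIdeal A) (M ⧸ N) :=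
        ⟨fun a b c => by
          obtain ⟨b, rfl⟩ := Ideal.Quotient.mk_surjective b
          obtain ⟨c, rfl⟩ := Submodule.mkQ_surjective _ c
          change Submodule.Quotient.mk ((a • b) • c) = a • Submodule.Quotient.mk (b • c)
          rw [smul_assoc]; rfl⟩
      have : Module.Finite k (A ⧸ IsLocalRing.maximalIdeal A) :=
        inferInstanceAs (Module.Finite k (IsLocalRing.ResidueField A))
      exact Module.Finite.trans (A ⧸ IsLocalRing.maximalIdeal A) _
    have : Module.Finite k (M ⧸ N.restrictScalars k) := this
    exact Module.Finite.of_submodule_quotient (N.restrictScalars k)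

variable {k : Type u} [Field k] (C : Curve k)

lemma Curve.fromSpecStalk_str (x : C.X) :
    C.X.fromSpecStalk x ≫ C.str = Spec.map (C.toStalk x) := by
  have h := Scheme.toSpecΓ_naturality C.str
  have h2 : (Spec (CommRingCat.of k)).toSpecΓ = Spec.map (Scheme.ΓSpecIso (.of k)).hom := by
    rw [← Scheme.isoSpec_Spec_hom, Scheme.isoSpec_hom]
  have h3 : C.str = C.X.toSpecΓ ≫ Spec.map ((Scheme.ΓSpecIso (.of k)).inv ≫ C.str.appTop) := by
    rw [Spec.map_comp, ← reassoc_of% h, h2, ← Spec.map_comp, Iso.inv_hom_id, Spec.map_id,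
      Category.comp_id]
  rw [h3, Scheme.fromSpecStalk_toSpecΓ_assoc, ← Spec.map_comp, Category.assoc]
  rfl

instance (x : C.X) : IsNoetherianRing (C.stalk x) := by
  have := C.proper
  have := LocallyOfFiniteType.isLocallyNoetherian C.str
  infer_instance

lemma Curve.finite_residueField (x : C.X) (hx : IsClosed {x}) :
    Module.Finite k (IsLocalRing.ResidueField (C.stalk x)) := by
  have := C.proper
  have h : IsFinite (C.X.fromSpecResidueField x ≫ C.str) := by
    rw [isClosed_singleton_iff_isClosedImmersion] at hx
    rw [isFinite_iff_locallyOfFiniteType_of_jacobsonSpace]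
    infer_instance
  have e : C.X.fromSpecResidueField x ≫ C.str = Spec.map (C.toStalk x ≫ C.X.residue x) := by
    rw [Spec.map_comp, ← C.fromSpecStalk_str]
    rfl
  rw [e, IsFinite.SpecMap_iff] at h
  exact h

lemma Curve.finite_quotient (x : C.X) (hx : IsClosed {x}) (n : ℕ) :
    Module.Finite k (C.stalk x ⧸ IsLocalRing.maximalIdeal (C.stalk x) ^ n) := by
  have := C.finite_residueField x hx
  refine finite_of_pow_smul (A := C.stalk x) n _ ?_
  rw [eq_bot_iff, Submodule.smul_le]
  rintro a ha b -
  obtain ⟨b, rfl⟩ := Ideal.Quotient.mk_surjective b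
  exact Ideal.Quotient.eq_zero_iff_mem.2 (Ideal.mul_mem_right b _ ha)

instance : Finite (GenPt C) := by
  have := C.proper
  have := LocallyOfFiniteType.isLocallyNoetherian C.str
  have : CompactSpace C.X := (quasiCompact_iff_compactSpace C.str).1 inferInstance
  have : IsNoetherian C.X := {}
  have := genericPoints.finite
    (TopologicalSpace.NoetherianSpace.finite_irreducibleComponents (α := C.X))
  refine (this.subset fun η (hη : IsGeneric C η) => ?_).to_subtype
  refine ⟨isIrreducible_singleton.closure, fun S hS hle => ?_⟩
  have hS' := hS.isGenericPoint_genericPoint_closure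
  have : hS.genericPoint = η := hη _ (hS'.specializes
    (subset_closure (hle (subset_closure rfl))))
  rw [← this]
  exact subset_closure.trans hS'.symm.le

variable {C}

lemma finite_range_of_ker_le {M N P : Type u} [AddCommGroup M] [Module k M] [AddCommGroup N]
    [Module k N] [AddCommGroup P] [Module k P] [Module.Finite k P] (Φ : M →ₗ[k] N)
    (Ψ : M →ₗ[k] P) (h : LinearMap.ker Ψ ≤ LinearMap.ker Φ) :
    Module.Finite k (LinearMap.range Φ) := by
  have h1 : Module.Finite k (M ⧸ LinearMap.ker Ψ) := .equiv Ψ.quotKerEquivRange.symm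
  rw [← Submodule.range_liftQ (LinearMap.ker Ψ) Φ h]
  infer_instance

lemma EffDiv.functions_finite (Y : EffDiv C) (i : Place C) (h : Y.mult i.x ≠ 0) :
    Module.Finite k (LinearMap.range ((Y.functions i).mkQ ∘ₗ i.loc.toLinearMap)) := by
  have : Module.Finite k (C.stalk i.x ⧸ Y.ideal i.x) :=
    C.finite_quotient i.x (Y.closed _ h) (Y.mult i.x)
  refine finite_range_of_ker_le _ ((Ideal.Quotient.mkₐ k (Y.ideal i.x)).toLinearMap :
    C.stalk i.x →ₗ[k] (C.stalk i.x ⧸ Y.ideal i.x)) fun a ha => ?_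
  rw [LinearMap.mem_ker, LinearMap.comp_apply, Submodule.mkQ_apply, Submodule.Quotient.mk_eq_zero]
  exact ⟨a, Ideal.Quotient.eq_zero_iff_mem.1 ha, rfl⟩

lemma cochain_mem_cocycles (p : MCrv k) (s : ∀ i, p.Y.red.functions i) :
    ((0, fun i => (s i).1) : Cochain p.C) ∈ cocycles p := by
  intro i
  obtain ⟨a, -, ha⟩ := (s i).2
  have : KaehlerDifferential.D k _ (s i).1 ∈ p.Z.forms i := by
    refine Submodule.subset_span (Or.inl ⟨1, fun a _ => ⟨a, one_mul _⟩, a, ?_⟩)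
    rw [one_smul, ← ha]
    rfl
  simpa using this

/-- The map which takes a family `s` to the class of `(0, s)`. -/
def familyMap (p : MCrv k) : (∀ i, p.Y.red.functions i) →ₗ[k] H1 p where
  toFun s := H1.mk p ⟨(0, fun i => (s i).1), cochain_mem_cocycles p s⟩
  map_add' s t := by
    rw [← map_add]
    refine congrArg (H1.mk p) (Subtype.ext (Prod.ext (add_zero _).symm rfl))
  map_smul' a s := by
    rw [← map_smul]
    refine congrArg (H1.mk p) (Subtype.ext (Prod.ext (smul_zero a).symm rfl))

lemma fil2_le_range (p : MCrv k) : fil2 p ≤ LinearMap.range (familyMap p) := by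
  rintro _ ⟨y, hy, rfl⟩
  obtain ⟨c, rfl⟩ := H1.mk_surjective y
  have hc : pullCochain p.redZ.fromRedY c.1 ∈ coboundaries p.redZ.redY :=
    (H1.mk_eq_zero (p := p.redZ.redY) _).1 hy
  rw [pullCochain_fromRedY (p := p.redZ)] at hc
  obtain ⟨h, h1, h2⟩ := hc
  refine ⟨fun i => ⟨c.1.2 i - h i.η, h2 i⟩, ?_⟩
  rw [pull_mk, ← sub_eq_zero]
  refine (map_sub (H1.mk p) _ _).symm.trans ((H1.mk_eq_zero (p := p) _).2 ?_)
  refine ⟨-h, fun η => ?_, fun i => ?_⟩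
  · have e := congrFun (congrArg Prod.fst (pullCochain_toRedZ (p := p) c.1)) η
    refine (zero_sub _).trans ?_
    rw [Pi.neg_apply, Derivation.map_neg, neg_inj]
    exact e.trans (h1 η)
  · have e := congrFun (congrArg Prod.snd (pullCochain_toRedZ (p := p) c.1)) i
    refine (congrArg (· ∈ p.Y.functions i) ?_).mpr (zero_mem _)
    change c.1.2 i - h i.η - (pullCochain p.toRedZ c.1).2 i - (-h i.η) = 0
    rw [e]
    ring

instance fil2_finite (p : MCrv k) : Module.Finite k (fil2 p) := by
  have h : Module.Finite k (LinearMap.range (familyMap p)) := by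
    let I := {i : Place p.C // p.Y.mult i.x ≠ 0}
    have hI : Finite I := by
      have := p.Y.finite.to_subtype
      refine Finite.of_injective
        (fun i : I => ((⟨i.1.x, i.2⟩ : {x | p.Y.mult x ≠ 0}), i.1.η)) ?_
      rintro ⟨⟨η, x, h⟩, h'⟩ ⟨⟨η2, x2, h2⟩, h2'⟩ e
      simp only [Prod.mk.injEq, Subtype.mk.injEq] at e
      obtain ⟨rfl, rfl⟩ := e
      rfl
    have := fun i : I => p.Y.functions_finite i.1 i.2
    let P := ∀ i : I, LinearMap.range ((p.Y.functions i.1).mkQ ∘ₗ i.1.loc.toLinearMap)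
    have hP : Module.Finite k P := inferInstanceAs (Module.Finite k (∀ i : I, _))
    let Ψ : (∀ i, p.Y.red.functions i) →ₗ[k] P :=
      LinearMap.pi fun i => LinearMap.codRestrict _
        ((p.Y.functions i.1).mkQ ∘ₗ (p.Y.red.functions i.1).subtype ∘ₗ LinearMap.proj i.1)
        fun s => by
          obtain ⟨a, -, ha⟩ := (s i.1).2
          exact ⟨a, congrArg (p.Y.functions i.1).mkQ ha⟩
    refine finite_range_of_ker_le (P := P) _ Ψ fun s hs => ?_
    refine (H1.mk_eq_zero (p := p) _).2 ⟨0, fun η => (map_zero _).symm, fun i => ?_⟩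
    rw [Pi.zero_apply, sub_zero]
    by_cases hi : p.Y.mult i.x = 0
    · obtain ⟨a, -, ha⟩ := (s i).2
      refine ⟨a, ?_, ha⟩
      rw [EffDiv.ideal_of_eq_zero _ _ hi]
      trivial
    · have := congrArg Subtype.val (congrFun hs (⟨i, hi⟩ : I))
      exact (Submodule.Quotient.mk_eq_zero _).1 this
  exact Module.Finite.of_injective (Submodule.inclusion (fil2_le_range p))
    (Submodule.inclusion_injective _)

end Finiteness

section Nori
variable {k : Type u} [Field k] [NumberField k]

instance (p : MCrv k) : Module ℚ (H1 p) := Module.compHom _ (algebraMap ℚ k)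

instance (p : MCrv k) : IsScalarTower ℚ k (H1 p) :=
  ⟨fun a b x => by rw [Algebra.smul_def, mul_smul]; rfl⟩

/-- `End_ℚ(T|_E)`: the `ℚ`-algebra of endomorphisms of the representation
`T = 𝐇¹_dR : MCrvᵒᵖ → mod(ℚ)` restricted to the full subquiver with vertices `E`. -/
def EndT (E : Set (MCrv k)) : Subalgebra ℚ (∀ p : E, Module.End ℚ (H1 p.1)) where
  carrier := {a | ∀ (p q : E) (f : MCrv.Hom p.1 q.1) (x : H1 q.1),
    a p (pull f x) = pull f (a q x)}
  mul_mem' {a b} ha hb p q f x := by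
    simp only [Pi.mul_apply, Module.End.mul_apply, hb p q f, ha p q f]
  add_mem' {a b} ha hb p q f x := by
    simp only [Pi.add_apply, LinearMap.add_apply, hb p q f, ha p q f, map_add]
  algebraMap_mem' c p q f x := by
    simp only [Pi.algebraMap_apply, Module.algebraMap_end_apply]
    exact ((pull f).restrictScalars ℚ).map_smul c x |>.symm

/-- Restriction to a smaller subquiver. -/
def EndT.res {E E' : Set (MCrv k)} (h : E ⊆ E') : EndT E' →ₐ[ℚ] EndT E where
  toFun a := ⟨fun p => a.1 ⟨p.1, h p.2⟩, fun p q f x => a.2 ⟨p.1, h p.2⟩ ⟨q.1, h q.2⟩ f x⟩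
  map_one' := rfl
  map_mul' _ _ := rfl
  map_zero' := rfl
  map_add' _ _ := rfl
  commutes' _ := rfl

variable (k) in
/-- The objects of Nori's category of `T`: finite dimensional `ℚ`-vector spaces with an action of
`End_ℚ(T|_E)` for some finite full subquiver `E`. -/
structure NoriObj where
  V : Type u
  [addCommGroup : AddCommGroup V]
  [module : Module ℚ V]
  [finite : Module.Finite ℚ V]
  E : Set (MCrv k)
  finite_E : E.Finite
  act : EndT E →ₐ[ℚ] Module.End ℚ V

namespace NoriObj

attribute [instance] addCommGroup module finite

variable (A B D : NoriObj k)

/-- The morphisms of Nori's category (the colimit of the categories of finite dimensional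
`End_ℚ(T|_E)`-modules): the `ℚ`-linear maps which are `End_ℚ(T|_E)`-linear for some finite `E`. -/
def homs : Submodule ℚ (A.V →ₗ[ℚ] B.V) where
  carrier := {φ | ∃ (E : Set (MCrv k)) (_ : E.Finite) (hA : A.E ⊆ E) (hB : B.E ⊆ E),
    ∀ (a : EndT E) (v : A.V), φ (A.act (EndT.res hA a) v) = B.act (EndT.res hB a) (φ v)}
  add_mem' := by
    rintro φ ψ ⟨E, hE, hA, hB, h⟩ ⟨E', hE', hA', hB', h'⟩
    refine ⟨E ∪ E', hE.union hE', hA.trans Set.subset_union_left,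
      hB.trans Set.subset_union_left, fun a v => ?_⟩
    have e1 := h (EndT.res Set.subset_union_left a) v
    have e2 := h' (EndT.res Set.subset_union_right a) v
    rw [LinearMap.add_apply, LinearMap.add_apply, map_add]
    exact congrArg₂ (· + ·) e1 e2
  zero_mem' := ⟨A.E ∪ B.E, A.finite_E.union B.finite_E, Set.subset_union_left,
    Set.subset_union_right, fun a v => by simp⟩
  smul_mem' := by
    rintro c φ ⟨E, hE, hA, hB, h⟩
    exact ⟨E, hE, hA, hB, fun a v => by simp [h]⟩

variable {A B D} in
lemma homs_comp {φ : A.V →ₗ[ℚ] B.V} {ψ : B.V →ₗ[ℚ] D.V} (hφ : φ ∈ homs A B)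
    (hψ : ψ ∈ homs B D) : ψ ∘ₗ φ ∈ homs A D := by
  obtain ⟨E, hE, hA, hB, h⟩ := hφ
  obtain ⟨E', hE', hB', hD', h'⟩ := hψ
  refine ⟨E ∪ E', hE.union hE', hA.trans Set.subset_union_left,
    hD'.trans Set.subset_union_right, fun a v => ?_⟩
  have e1 := h (EndT.res Set.subset_union_left a) v
  have e2 := h' (EndT.res Set.subset_union_right a) (φ v)
  exact (congrArg ψ e1).trans e2

instance : Category (NoriObj k) where
  Hom A B := homs A B
  id A := ⟨LinearMap.id, A.E, A.finite_E, subset_rfl, subset_rfl, fun _ _ => rfl⟩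
  comp φ ψ := ⟨ψ.1 ∘ₗ φ.1, homs_comp φ.2 ψ.2⟩

instance : Preadditive (NoriObj k) where
  homGroup A B := inferInstanceAs (AddCommGroup (homs A B))
  add_comp _ _ _ φ φ' ψ := Subtype.ext (LinearMap.comp_add φ.1 φ'.1 ψ.1)
  comp_add _ _ _ φ ψ ψ' := Subtype.ext (LinearMap.add_comp φ.1 ψ'.1 ψ.1)

variable (k) in
/-- The forgetful functor to `ℚ`-vector spaces. -/
def forgetful : NoriObj k ⥤ ModuleCat.{u} ℚ where
  obj A := ModuleCat.of ℚ A.V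
  map φ := ModuleCat.ofHom φ.1

/-- The subobject `fil² A`. As `fil²` is an exact functor whose value on the object attached to
`(X,Y,Z)` is `fil² 𝐇¹_dR(X,Y,Z)`, and as every object is a quotient of a subobject `W` of a finite
direct sum of such objects, `fil² A` is spanned by the images `π w` of the elements `w` of such
subobjects `W` all of whose components lie in `fil²`, under morphisms `π : W → A`. -/
def fil2 : Submodule ℚ A.V :=
  Submodule.span ℚ {v | ∃ (E : Set (MCrv k)) (_ : E.Finite) (hA : A.E ⊆ E) (n : ℕ)
    (p : Fin n → E) (W : Submodule ℚ (∀ i, H1 (p i).1))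
    (hW : ∀ a : EndT E, ∀ w ∈ W, (fun i => a.1 (p i) (w i)) ∈ W) (π : W →ₗ[ℚ] A.V)
    (_ : ∀ (a : EndT E) (w : W),
      π ⟨fun i => a.1 (p i) (w.1 i), hW a w.1 w.2⟩ = A.act (EndT.res hA a) (π w))
    (w : W) (_ : ∀ i, w.1 i ∈ ModulusCurve.fil2 (p i).1), v = π w}

end NoriObj

variable (k) in
/-- The full subcategory of the unipotent objects, that is those with `fil² A = A`. -/
abbrev ECMMuni := ObjectProperty.FullSubcategory fun A : NoriObj k => A.fil2 = ⊤

lemma EndT.fil2_stable {E : Set (MCrv k)} (a : EndT E) (p : MCrv k) (h1 : p ∈ E)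
    (h2 : p.redZ ∈ E) (h3 : p.redZ.redY ∈ E) {x : H1 p} (hx : x ∈ fil2 p) :
    a.1 ⟨p, h1⟩ x ∈ fil2 p := by
  obtain ⟨y, hy, rfl⟩ := hx
  refine ⟨a.1 ⟨p.redZ, h2⟩ y, ?_, (a.2 ⟨p, h1⟩ ⟨p.redZ, h2⟩ p.toRedZ y).symm⟩
  refine (a.2 ⟨p.redZ.redY, h3⟩ ⟨p.redZ, h2⟩ p.redZ.fromRedY y).symm.trans ?_
  rw [LinearMap.mem_ker.1 hy, map_zero]

instance (p : MCrv k) : Module.Finite ℚ (fil2 p) := Module.Finite.trans k (fil2 p)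

/-- The action of `End_ℚ(T|_E)` on `fil² 𝐇¹_dR(X,Y,Z)`. -/
def fil2Act (p : MCrv k) : EndT {p, p.redZ, p.redZ.redY} →ₐ[ℚ] Module.End ℚ (fil2 p) where
  toFun a :=
    { toFun := fun x => ⟨a.1 ⟨p, by simp⟩ x.1,
        EndT.fil2_stable a p (by simp) (by simp) (by simp) x.2⟩
      map_add' := fun x y => Subtype.ext (map_add (a.1 ⟨p, by simp⟩) x.1 y.1)
      map_smul' := fun c x => Subtype.ext (map_smul (a.1 ⟨p, by simp⟩) c x.1) }
  map_one' := LinearMap.ext fun _ => Subtype.ext rfl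
  map_mul' _ _ := LinearMap.ext fun _ => Subtype.ext rfl
  map_zero' := LinearMap.ext fun _ => Subtype.ext rfl
  map_add' _ _ := LinearMap.ext fun _ => Subtype.ext rfl
  commutes' _ := LinearMap.ext fun _ => Subtype.ext rfl

/-- `fil² 𝐇¹_dR(X,Y,Z)` as an object of Nori's category. -/
def fil2Nori (p : MCrv k) : NoriObj k where
  V := fil2 p
  E := {p, p.redZ, p.redZ.redY}
  finite_E := Set.toFinite _
  act := fil2Act p

lemma fil2Nori_uni (p : MCrv k) : (fil2Nori p).fil2 = ⊤ := by
  rw [eq_top_iff]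
  rintro v -
  refine Submodule.subset_span ⟨(fil2Nori p).E, (fil2Nori p).finite_E, subset_rfl, 1,
    fun _ => ⟨p, by simp [fil2Nori]⟩,
    { carrier := {w | ∀ i, w i ∈ fil2 p}
      add_mem' := fun h h' i => add_mem (h i) (h' i)
      zero_mem' := fun i => zero_mem _
      smul_mem' := fun c w h i => ((fil2 p).restrictScalars ℚ).smul_mem c (h i) },
    fun a w hw i => EndT.fil2_stable a p (by simp [fil2Nori]) (by simp [fil2Nori])
      (by simp [fil2Nori]) (hw i),
    { toFun := fun w => (⟨w.1 0, w.2 0⟩ : fil2 p)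
      map_add' := fun _ _ => rfl
      map_smul' := fun _ _ => rfl }, fun _ _ => rfl, ⟨fun _ => v.1, fun _ => v.2⟩,
    fun _ => v.2, rfl⟩

/-- `fil² 𝐇¹_dR(X,Y,Z)` as a unipotent object. -/
def fil2Obj (p : MCrv k) : ECMMuni k := ⟨fil2Nori p, fil2Nori_uni p⟩

/-- The restriction of `f^*` to `fil²`. -/
def fil2Lin {p q : MCrv k} (f : MCrv.Hom p q) : (fil2Nori q).V →ₗ[ℚ] (fil2Nori p).V :=
  ((pull f).restrictScalars ℚ).restrict (p := (fil2 q).restrictScalars ℚ)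
    (q := (fil2 p).restrictScalars ℚ) fun _ hx => pull_fil2 f hx

lemma fil2Lin_mem {p q : MCrv k} (f : MCrv.Hom p q) :
    fil2Lin f ∈ NoriObj.homs (fil2Nori q) (fil2Nori p) := by
  refine ⟨(fil2Nori q).E ∪ (fil2Nori p).E, (fil2Nori q).finite_E.union (fil2Nori p).finite_E,
    Set.subset_union_left, Set.subset_union_right, fun a v => Subtype.ext ?_⟩
  exact (a.2 ⟨p, by simp [fil2Nori]⟩ ⟨q, by simp [fil2Nori]⟩ f v.1).symm

/-- The functoriality of `fil² 𝐇¹_dR` in morphisms of curves with modulus. -/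
def fil2Map {p q : MCrv k} (f : MCrv.Hom p q) : fil2Obj q ⟶ fil2Obj p :=
  ObjectProperty.homMk (⟨fil2Lin f, fil2Lin_mem f⟩ : fil2Nori q ⟶ fil2Nori p)

/-- The class of `(0, r)` as an element of `fil² 𝐇¹_dR(X,Y,Z)`. -/
def Nilp.toFil2 {p : MCrv k} (r : Nilp p) : (fil2Obj p).obj.V := (⟨r.toH1, r.toH1_mem⟩ : fil2 p)

end Nori

section Isogeny

/-- The category `C ⊗ ℚ` of a preadditive category `C`: the same objects, and `Hom ⊗ ℚ` as groups
of morphisms. -/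
structure RatCat (C : Type w) where
  of : C

namespace RatCat
variable {C : Type w} [Category.{v} C] [Preadditive C]

/-- Composition in `C` as a `ℤ`-bilinear map. -/
def compInt (X Y Z : C) : (X ⟶ Y) →ₗ[ℤ] (Y ⟶ Z) →ₗ[ℤ] (X ⟶ Z) :=
  LinearMap.mk₂ ℤ (fun f g => f ≫ g) (by simp) (by simp) (by simp) (by simp)

/-- Composition in `C ⊗ ℚ`: `(a ⊗ f) ≫ (b ⊗ g) = ab ⊗ (f ≫ g)`. -/
def compRat (X Y Z : C) : ℚ ⊗[ℤ] (X ⟶ Y) →ₗ[ℤ] ℚ ⊗[ℤ] (Y ⟶ Z) →ₗ[ℤ] ℚ ⊗[ℤ] (X ⟶ Z) :=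
  TensorProduct.map₂ (LinearMap.mul ℤ ℚ) (compInt X Y Z)

lemma compRat_tmul {X Y Z : C} (a b : ℚ) (f : X ⟶ Y) (g : Y ⟶ Z) :
    compRat X Y Z (a ⊗ₜ f) (b ⊗ₜ g) = (a * b) ⊗ₜ (f ≫ g) := rfl

lemma compRat_one_left {X Y : C} (g : ℚ ⊗[ℤ] (X ⟶ Y)) : compRat X X Y (1 ⊗ₜ 𝟙 X) g = g := by
  induction g with
  | zero => rw [map_zero]
  | tmul b g => rw [compRat_tmul, one_mul, Category.id_comp]
  | add x y hx hy => rw [map_add, hx, hy]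

lemma compRat_one_right {X Y : C} (g : ℚ ⊗[ℤ] (X ⟶ Y)) : compRat X Y Y g (1 ⊗ₜ 𝟙 Y) = g := by
  induction g with
  | zero => rw [LinearMap.map_zero₂]
  | tmul b g => rw [compRat_tmul, mul_one, Category.comp_id]
  | add x y hx hy => rw [LinearMap.map_add₂, hx, hy]

lemma compRat_assoc {X Y Z W : C} (f : ℚ ⊗[ℤ] (X ⟶ Y)) (g : ℚ ⊗[ℤ] (Y ⟶ Z))
    (h : ℚ ⊗[ℤ] (Z ⟶ W)) :
    compRat X Z W (compRat X Y Z f g) h = compRat X Y W f (compRat Y Z W g h) := by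
  induction f with
  | zero => simp only [map_zero, LinearMap.zero_apply]
  | add x y hx hy => simp only [map_add, LinearMap.add_apply, hx, hy]
  | tmul a f =>
    induction g with
    | zero => simp only [map_zero, LinearMap.zero_apply]
    | add x y hx hy => simp only [map_add, LinearMap.add_apply, hx, hy]
    | tmul b g =>
      induction h with
      | zero => simp only [map_zero]
      | add x y hx hy => simp only [map_add, hx, hy]
      | tmul c h => simp only [compRat_tmul, mul_assoc, Category.assoc]

instance : Category (RatCat C) where
  Hom X Y := ℚ ⊗[ℤ] (X.of ⟶ Y.of)
  id X := 1 ⊗ₜ 𝟙 X.of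
  comp f g := compRat _ _ _ f g
  id_comp := compRat_one_left
  comp_id := compRat_one_right
  assoc := compRat_assoc

instance (X Y : RatCat C) : AddCommGroup (X ⟶ Y) :=
  inferInstanceAs (AddCommGroup (ℚ ⊗[ℤ] (X.of ⟶ Y.of)))

instance : Preadditive (RatCat C) where
  homGroup _ _ := inferInstance
  add_comp X Y Z f f' g := LinearMap.map_add₂ (compRat X.of Y.of Z.of) f f' g
  comp_add X Y Z f g g' := map_add (compRat X.of Y.of Z.of f) g g'

variable (C) in
/-- The functor `C → C ⊗ ℚ`. -/
def incl : C ⥤ RatCat C where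
  obj X := ⟨X⟩
  map f := (1 : ℚ) ⊗ₜ[ℤ] f
  map_id _ := rfl
  map_comp f g := by
    change _ = compRat _ _ _ _ _
    rw [compRat_tmul, one_mul]

section Lift
variable (F : C ⥤ AddCommGrpCat.{u}) [F.Additive]

/-- The action of `F` on morphisms as a bilinear map. -/
def mapInt (X Y : C) : (X ⟶ Y) →ₗ[ℤ] F.obj X →ₗ[ℤ] F.obj Y :=
  LinearMap.mk₂ ℤ (fun f x => (F.map f).hom x) (fun f g x => by simp [F.map_add])
    (fun c f x => by simp [F.map_zsmul]) (by simp) (by simp)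

/-- `(a ⊗ f) (b ⊗ x) = ab ⊗ F(f)(x)` -/
def mapRat (X Y : C) : ℚ ⊗[ℤ] (X ⟶ Y) →ₗ[ℤ] ℚ ⊗[ℤ] F.obj X →ₗ[ℤ] ℚ ⊗[ℤ] F.obj Y :=
  TensorProduct.map₂ (LinearMap.mul ℤ ℚ) (mapInt F X Y)

lemma mapRat_tmul {X Y : C} (a b : ℚ) (f : X ⟶ Y) (x : F.obj X) :
    mapRat F X Y (a ⊗ₜ f) (b ⊗ₜ x) = (a * b) ⊗ₜ ((F.map f).hom x) := rfl

lemma mapRat_id {X : C} (x : ℚ ⊗[ℤ] F.obj X) : mapRat F X X (1 ⊗ₜ 𝟙 X) x = x := by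
  induction x with
  | zero => rw [map_zero]
  | tmul b g => rw [mapRat_tmul, one_mul, F.map_id]; rfl
  | add x y hx hy => rw [map_add, hx, hy]

lemma mapRat_comp {X Y Z : C} (f : ℚ ⊗[ℤ] (X ⟶ Y)) (g : ℚ ⊗[ℤ] (Y ⟶ Z)) (x : ℚ ⊗[ℤ] F.obj X) :
    mapRat F X Z (compRat X Y Z f g) x = mapRat F Y Z g (mapRat F X Y f x) := by
  induction f with
  | zero => simp only [map_zero, LinearMap.zero_apply]
  | add f f' hf hf' => simp only [map_add, LinearMap.add_apply, hf, hf']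
  | tmul a f =>
    induction g with
    | zero => simp only [map_zero, LinearMap.zero_apply]
    | add g g' hg hg' => simp only [map_add, LinearMap.add_apply, hg, hg']
    | tmul b g =>
      induction x with
      | zero => simp only [map_zero]
      | add x y hx hy => simp only [map_add, hx, hy]
      | tmul c x =>
        rw [compRat_tmul, mapRat_tmul, mapRat_tmul, mapRat_tmul, F.map_comp, mul_left_comm b a c,
          mul_assoc]
        rfl

/-- The functor `C ⊗ ℚ → Mod(ℚ)`, `X ↦ ℚ ⊗ F(X)`, induced by an additive functor `F`. -/
def lift : RatCat C ⥤ ModuleCat.{u} ℚ where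
  obj X := ModuleCat.of ℚ (ℚ ⊗[ℤ] F.obj X.of)
  map {X Y} f := ModuleCat.ofHom (mapRat F X.of Y.of f).toAddMonoidHom.toRatLinearMap
  map_id X := by
    refine ModuleCat.hom_ext (LinearMap.ext fun x => ?_)
    exact mapRat_id F x
  map_comp f g := by
    refine ModuleCat.hom_ext (LinearMap.ext fun x => ?_)
    exact mapRat_comp F f g x
end Lift
end RatCat
end Isogeny

section Groups
variable (k : Type u) [Field k]

/-- Functors from commutative `k`-algebras to abelian groups; commutative `k`-groups are identified
with their functors of points. -/
abbrev GroupFunctor := CommAlgCat.{u} k ⥤ AddCommGrpCat.{u}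

variable {k}

/-- `G` is a unipotent commutative algebraic `k`-group: it is represented by a finitely generated
`k`-algebra, and it embeds into the group of upper triangular unipotent matrices of some size. -/
def IsUnipotent (G : GroupFunctor k) : Prop :=
  (∃ A : CommAlgCat.{u} k, Algebra.FiniteType k A ∧
    Nonempty (coyoneda.obj (Opposite.op A) ≅ G ⋙ forget AddCommGrpCat)) ∧
  ∃ (n : ℕ) (ρ : ∀ R : CommAlgCat.{u} k,
      Multiplicative (G.obj R) →* Matrix (Fin n) (Fin n) R),
    (∀ R, Function.Injective (ρ R)) ∧
    (∀ (R R' : CommAlgCat.{u} k) (φ : R ⟶ R') (g : G.obj R),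
      ρ R' (Multiplicative.ofAdd ((G.map φ).hom g)) =
        (ρ R (Multiplicative.ofAdd g)).map φ.hom) ∧
    ∀ R g, (ρ R g).BlockTriangular id ∧ ∀ i, ρ R g i i = 1

variable (k) in
/-- The category of unipotent commutative algebraic `k`-groups up to isogeny. -/
abbrev Muni := ObjectProperty.FullSubcategory fun G : RatCat (GroupFunctor k) => IsUnipotent G.of

/-- The Lie algebra of `G`: the kernel of `G(k[ε]) → G(k)`. -/
def lie (G : GroupFunctor k) : AddSubgroup (G.obj (.of k (DualNumber k))) :=
  (G.map (CommAlgCat.ofHom (TrivSqZeroExt.fstHom k k k))).hom.ker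

/-- The homomorphism of Lie algebras induced by a homomorphism of groups. -/
def lieMap {G H : GroupFunctor k} (φ : G ⟶ H) : lie G →+ lie H :=
  ((φ.app (.of k (DualNumber k))).hom.comp (lie G).subtype).codRestrict (lie H) fun x => by
    have e := ConcreteCategory.congr_hom
      (φ.naturality (CommAlgCat.ofHom (TrivSqZeroExt.fstHom k k k))) x.1
    have hx : (G.map (CommAlgCat.ofHom (TrivSqZeroExt.fstHom k k k))).hom x.1 = 0 := x.2
    refine e.symm.trans ?_
    exact (congrArg (φ.app _).hom hx).trans (map_zero _)

variable (k) in
/-- The functor `Lie` on commutative groups. -/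
def lieFunctor : GroupFunctor k ⥤ AddCommGrpCat.{u} where
  obj G := AddCommGrpCat.of (lie G)
  map φ := AddCommGrpCat.ofHom (lieMap φ)

instance : (lieFunctor k).Additive where
  map_add := rfl

variable (k) in
/-- The functor `Lie` on commutative groups up to isogeny. -/
def lieRat : RatCat (GroupFunctor k) ⥤ ModuleCat.{u} ℚ := RatCat.lift (lieFunctor k)

/-- The vector group `R ↦ R ⊗ V`. -/
def vectorGroup (V : Type u) [AddCommGroup V] [Module k V] : GroupFunctor k where
  obj R := AddCommGrpCat.of (R ⊗[k] V)
  map φ := AddCommGrpCat.ofHom (φ.hom.toLinearMap.rTensor V).toAddMonoidHom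
  map_id R := by
    refine AddCommGrpCat.hom_ext (AddMonoidHom.ext fun x => ?_)
    exact LinearMap.rTensor_id_apply V R x
  map_comp φ ψ := by
    refine AddCommGrpCat.hom_ext (AddMonoidHom.ext fun x => ?_)
    exact LinearMap.rTensor_comp_apply V ψ.hom.toLinearMap φ.hom.toLinearMap x

/-- The homomorphism of vector groups induced by a linear map. -/
def vectorGroupMap {V W : Type u} [AddCommGroup V] [Module k V] [AddCommGroup W] [Module k W]
    (f : V →ₗ[k] W) : vectorGroup (k := k) V ⟶ vectorGroup (k := k) W where
  app R := AddCommGrpCat.ofHom (f.lTensor R).toAddMonoidHom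
  naturality R R' φ := by
    refine AddCommGrpCat.hom_ext (AddMonoidHom.ext fun (x : R ⊗[k] V) => ?_)
    have e : f.lTensor R' (φ.hom.toLinearMap.rTensor V x) =
        φ.hom.toLinearMap.rTensor W (f.lTensor R x) := by
      rw [← LinearMap.comp_apply, ← LinearMap.comp_apply, LinearMap.lTensor_comp_rTensor,
        LinearMap.rTensor_comp_lTensor]
    exact e

variable (k) in
/-- The functor which takes a finite dimensional `k`-vector space to its vector group, up to
isogeny. -/
def vectorGroupFunctor : FGModuleCat.{u} k ⥤ RatCat (GroupFunctor k) where
  obj V := (RatCat.incl _).obj (vectorGroup (k := k) V)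
  map f := (RatCat.incl _).map (vectorGroupMap f.hom.hom)
  map_id V := by
    have e : vectorGroupMap (k := k) (V := V) LinearMap.id = 𝟙 _ := by
      ext R x
      exact LinearMap.lTensor_id_apply R V x
    exact congrArg (RatCat.incl _).map e
  map_comp f g := by
    rw [← Functor.map_comp]
    refine congrArg (RatCat.incl _).map ?_
    ext R x
    exact LinearMap.lTensor_comp_apply R g.hom.hom f.hom.hom x
end Groups

section JacobianUnipotent
variable {k : Type u} [Field k]

/-- `Γ(D, 𝒪_D)`, the ring of functions on the divisor `D` (the factors outside the support
are zero). -/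
abbrev EffDiv.ring {C : Curve k} (D : EffDiv C) : Type u := ∀ x : C.X, C.stalk x ⧸ D.ideal x

/-- The restriction `Γ(D, 𝒪_D) → Γ(D_red, 𝒪_{D_red})`. -/
def EffDiv.toRed {C : Curve k} (D : EffDiv C) : D.ring →ₐ[k] D.red.ring :=
  AlgHom.pi fun x => (Ideal.Quotient.factorₐ k (D.ideal_le_red x)).comp (Pi.evalAlgHom k _ x)

/-- Pull-back of functions `Γ(Y', 𝒪) → Γ(Y, 𝒪)`. -/
def pullRing {p q : MCrv k} (f : MCrv.Hom p q) : q.Y.ring →ₐ[k] p.Y.ring :=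
  AlgHom.pi fun x => (Ideal.quotientMapₐ (p.Y.ideal x) (f.stalkMap x)
    (Ideal.map_le_iff_le_comap.1 (f.hY x))).comp (Pi.evalAlgHom k _ (f.f x))

/-- The unit group functor `R ↦ (R ⊗ B)ˣ`. -/
def unitsMap {B B' : Type u} [CommRing B] [Algebra k B] [CommRing B'] [Algebra k B']
    {R R' : Type u} [CommRing R] [Algebra k R] [CommRing R'] [Algebra k R']
    (φ : R →ₐ[k] R') (ψ : B →ₐ[k] B') : (R ⊗[k] B)ˣ →* (R' ⊗[k] B')ˣ :=
  Units.map (Algebra.TensorProduct.map φ ψ).toRingHom.toMonoidHom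

/-- `J(X,Y)_uni(R)`, where `J(X,Y)_uni` is the kernel of the map `J(X,Y) → J(X,Y_red)` of
generalized Jacobians: the kernel of `Γ(Y_R, 𝒪)ˣ → Γ((Y_red)_R, 𝒪)ˣ`. -/
def juniPoints (p : MCrv k) (R : Type u) [CommRing R] [Algebra k R] :
    Subgroup (R ⊗[k] p.Y.ring)ˣ :=
  (unitsMap (AlgHom.id k R) p.Y.toRed).ker

lemma unitsMap_comp {B B' B'' : Type u} [CommRing B] [Algebra k B] [CommRing B'] [Algebra k B']
    [CommRing B''] [Algebra k B''] {R R' R'' : Type u} [CommRing R] [Algebra k R] [CommRing R']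
    [Algebra k R'] [CommRing R''] [Algebra k R''] (φ : R →ₐ[k] R') (ψ : B →ₐ[k] B')
    (φ' : R' →ₐ[k] R'') (ψ' : B' →ₐ[k] B'') (g : (R ⊗[k] B)ˣ) :
    unitsMap φ' ψ' (unitsMap φ ψ g) = unitsMap (φ'.comp φ) (ψ'.comp ψ) g :=
  Units.ext (congrArg (fun h => h g.1) (Algebra.TensorProduct.map_comp φ' φ ψ' ψ)).symm

lemma unitsMap_id {B R : Type u} [CommRing B] [Algebra k B] [CommRing R] [Algebra k R]
    (g : (R ⊗[k] B)ˣ) : unitsMap (AlgHom.id k R) (AlgHom.id k B) g = g :=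
  by
  refine Units.ext ?_
  change Algebra.TensorProduct.map (AlgHom.id k R) (AlgHom.id k B) g.1 = g.1
  rw [Algebra.TensorProduct.map_id, AlgHom.id_apply]

lemma toRed_pullRing {p q : MCrv k} (f : MCrv.Hom p q) :
    p.Y.toRed.comp (pullRing f) = (pullRing (p := p.redY) (q := q.redY) f.redY).comp q.Y.toRed := by
  refine AlgHom.ext fun a => funext fun x => ?_
  obtain ⟨b, hb⟩ := Ideal.Quotient.mk_surjective (a (f.f x))
  have e1 : p.Y.toRed.comp (pullRing f) a x =
      Ideal.Quotient.mk (p.Y.red.ideal x) (f.stalkMap x b) := by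
    change Ideal.Quotient.factorₐ k (p.Y.ideal_le_red x) (Ideal.quotientMapₐ (p.Y.ideal x)
      (f.stalkMap x) (Ideal.map_le_iff_le_comap.1 (f.hY x)) (a (f.f x))) = _
    rw [← hb]
    rfl
  refine e1.trans ?_
  have e2 : q.Y.toRed a (f.f x) = Ideal.Quotient.mk (q.Y.red.ideal (f.f x)) b := by
    change Ideal.Quotient.factorₐ k (q.Y.ideal_le_red (f.f x)) (a (f.f x)) = _
    rw [← hb]
    rfl
  have h : q.Y.red.ideal (f.f x) ≤ (p.Y.red.ideal x).comap (f.stalkMap x) :=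
    Ideal.map_le_iff_le_comap.1 (f.redY.hY x)
  exact (congrArg (Ideal.quotientMapₐ (p.Y.red.ideal x) (f.stalkMap x) h) e2).symm

/-- The functoriality of `J(X,Y)_uni(R)` in `R`. -/
def juniPoints.map (p : MCrv k) {R R' : Type u} [CommRing R] [Algebra k R] [CommRing R']
    [Algebra k R'] (φ : R →ₐ[k] R') : juniPoints p R →* juniPoints p R' :=
  ((unitsMap φ (AlgHom.id k p.Y.ring)).comp (juniPoints p R).subtype).codRestrict
    (juniPoints p R') fun ⟨g, hg⟩ => by
      have h : unitsMap (AlgHom.id k R) p.Y.toRed g = 1 := hg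
      have e := unitsMap_comp (AlgHom.id k R) p.Y.toRed φ (AlgHom.id k p.Y.red.ring) g
      rw [h, map_one] at e
      exact (unitsMap_comp φ (AlgHom.id k p.Y.ring) (AlgHom.id k R') p.Y.toRed g).trans e.symm

/-- The functoriality of `J(X,Y)_uni(R)` in `(X,Y)`. -/
def juniPoints.pull {p q : MCrv k} (f : MCrv.Hom p q) (R : Type u) [CommRing R] [Algebra k R] :
    juniPoints q R →* juniPoints p R :=
  ((unitsMap (AlgHom.id k R) (pullRing f)).comp (juniPoints q R).subtype).codRestrict
    (juniPoints p R) fun ⟨g, hg⟩ => by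
      have h : unitsMap (AlgHom.id k R) q.Y.toRed g = 1 := hg
      have e := unitsMap_comp (AlgHom.id k R) q.Y.toRed (AlgHom.id k R)
        (pullRing (p := p.redY) (q := q.redY) f.redY) g
      rw [h, map_one, ← toRed_pullRing] at e
      exact (unitsMap_comp (AlgHom.id k R) (pullRing f) (AlgHom.id k R) p.Y.toRed g).trans e.symm

/-- The unipotent group `J(X,Y)_uni`. -/
def juni (p : MCrv k) : GroupFunctor k where
  obj R := AddCommGrpCat.of (Additive (juniPoints p R))
  map {R R'} φ := AddCommGrpCat.ofHom (MonoidHom.toAdditive (juniPoints.map p φ.hom))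
  map_id R := by
    refine AddCommGrpCat.hom_ext (AddMonoidHom.ext fun (g : Additive (juniPoints p R)) => ?_)
    exact Subtype.ext (unitsMap_id g.toMul.1)
  map_comp {R _ _} φ ψ := by
    refine AddCommGrpCat.hom_ext (AddMonoidHom.ext fun (g : Additive (juniPoints p R)) => ?_)
    exact Subtype.ext (unitsMap_comp φ.hom (AlgHom.id k p.Y.ring) ψ.hom
      (AlgHom.id k p.Y.ring) g.toMul.1).symm

/-- The homomorphism `f^* : J(X',Y')_uni → J(X,Y)_uni`. -/
def juniMap {p q : MCrv k} (f : MCrv.Hom p q) : juni q ⟶ juni p where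
  app R := AddCommGrpCat.ofHom (MonoidHom.toAdditive (juniPoints.pull f R))
  naturality R R' φ := by
    refine AddCommGrpCat.hom_ext (AddMonoidHom.ext fun (g : Additive (juniPoints q R)) => ?_)
    refine Subtype.ext ((unitsMap_comp φ.hom (AlgHom.id k q.Y.ring) (AlgHom.id k R')
      (pullRing f) g.toMul.1).trans ?_)
    exact (unitsMap_comp (AlgHom.id k R) (pullRing f) φ.hom (AlgHom.id k p.Y.ring) g.toMul.1).symm

/-- The element `1 + ε r` of the Lie algebra of `J(X,Y)_uni`, where `r` is a section
of `𝓘_{Y_red}/𝓘_Y`. -/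
def Nilp.toUnit {p : MCrv k} (r : Nilp p) : (DualNumber k ⊗[k] p.Y.ring)ˣ :=
  let n : p.Y.ring := fun x => Ideal.Quotient.mk _ (r x).1
  have h : (DualNumber.eps ⊗ₜ[k] n) * (DualNumber.eps ⊗ₜ[k] n) = (0 : DualNumber k ⊗[k] p.Y.ring) := by
    rw [Algebra.TensorProduct.tmul_mul_tmul, DualNumber.eps_mul_eps, zero_tmul]
  { val := 1 + DualNumber.eps ⊗ₜ n
    inv := 1 - DualNumber.eps ⊗ₜ n
    val_inv := by linear_combination -h
    inv_val := by linear_combination -h }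

lemma Nilp.toUnit_mem {p : MCrv k} (r : Nilp p) : r.toUnit ∈ juniPoints p (DualNumber k) := by
  refine Units.ext ?_
  have h : p.Y.toRed (fun x => Ideal.Quotient.mk (p.Y.ideal x) (r x).1) = 0 :=
    funext fun x => Ideal.Quotient.eq_zero_iff_mem.2 (r x).2
  change Algebra.TensorProduct.map (AlgHom.id k _) p.Y.toRed (1 + DualNumber.eps ⊗ₜ _) = 1
  rw [map_add, map_one, Algebra.TensorProduct.map_tmul, h, tmul_zero, add_zero]

/-- `1 + ε r` as an element of the Lie algebra. -/
def Nilp.toLie {p : MCrv k} (r : Nilp p) : lie (juni p) :=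
  ⟨Additive.ofMul ⟨r.toUnit, r.toUnit_mem⟩, by
    refine (AddMonoidHom.mem_ker).2 (Subtype.ext (Units.ext ?_))
    change Algebra.TensorProduct.map (TrivSqZeroExt.fstHom k k k) (AlgHom.id k p.Y.ring)
      (1 + DualNumber.eps ⊗ₜ _) = 1
    have h : TrivSqZeroExt.fstHom k k k DualNumber.eps = 0 := rfl
    rw [map_add, map_one, Algebra.TensorProduct.map_tmul, h, zero_tmul, add_zero]⟩

end JacobianUnipotent

section LM
variable {k : Type u} [Field k] [NumberField k]

/-- `L` is the restriction of the functor `LM` to the unipotent parts: `L` is additive,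
there are isomorphisms `α` of `L(fil² 𝐇¹_dR(X,Y,Z))` with the unipotent part `J(X,Y)_uni` of
`[F(X,Z) → J(X,Y)]`, natural in `(X,Y,Z)`, and an isomorphism `β` of the forgetful functor with the
de Rham realization (on unipotent groups, the Lie algebra) of `L`. Under `α` and `β` the canonical
maps from `H⁰(X, 𝓘_{Y_red}/𝓘_Y)` to `fil² 𝐇¹_dR(X,Y,Z)` and to `Lie J(X,Y)_uni` correspond to
each other. This determines `L` up to isomorphism. -/
structure IsLM (L : ECMMuni k ⥤ Muni k) : Prop where
  additive : L.Additive
  exists_iso : ∃ (α : ∀ p : MCrv k, (L.obj (fil2Obj p)).obj ≅ (RatCat.incl _).obj (juni p))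
    (β : ObjectProperty.ι _ ⋙ NoriObj.forgetful k ≅ L ⋙ ObjectProperty.ι _ ⋙ lieRat k),
    (∀ (p q : MCrv k) (f : MCrv.Hom p q),
      (L.map (fil2Map f)).hom ≫ (α p).hom = (α q).hom ≫ (RatCat.incl _).map (juniMap f)) ∧
    ∀ (p : MCrv k) (r : Nilp p),
      ((lieRat k).map (α p).hom).hom ((β.hom.app (fil2Obj p)).hom r.toFil2) =
        (1 : ℚ) ⊗ₜ[ℤ] r.toLie
end LM

end ModulusCurve

end

/-! Both categories are the category of finite dimensional `k`-vector spaces, and the functor takes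
a unipotent object to the vector group of its underlying space.

On the side of groups, a unipotent commutative group in characteristic zero is a vector group. The
logarithm of a unipotent matrix representation provides additive functions which separate the points
(`IsAdditiveChart`), and a basis of their span freely generates the coordinate ring
(`IsAdditiveChart.algebraicIndependent`, `IsAdditiveChart.surjective`). Homomorphisms of vector
groups are linear, because `φ(tx) - tφ(x)` is polynomial in `t` and vanishes at all natural numbers
(`vectorGroupHomApp_smul`). They already form a `ℚ`-vector space, so tensoring with `ℚ` changes
nothing.

On the side of curves, `fil²` of `(X,Y,Z)` is the space `N = H⁰(X, 𝓘_{Y_red}/𝓘_Y)` (`fil2Equiv`):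
the only relations come from functions `h` with `dh = 0`, which are algebraic over `k`, and an
algebraic element of the maximal ideal of a stalk is zero. The exponential identifies the vector
group of `N` with `J(X,Y)_uni` (`juniIso`).

The heart of the matter is `exists_scalar`: for a suitable larger finite subquiver, every
endomorphism of the representation acts on `fil²` as a scalar of `k`. The germ at a point of any
section of `𝓘_{Y_red}` is the pull-back of the coordinate `t` under a morphism to the projective
line with modulus `N·0` (`exists_pull_coord`), so only the class of `t` matters. There, the
endomorphism commutes with the pull-back `t ↦ 2t`, whose eigenspace for the eigenvalue `2` in
`(t)/(t^N)` is the line of `t`. Conversely `k` acts by endomorphisms of the representation, so the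
morphisms of unipotent objects are exactly the `k`-linear maps (`ECMMuni.homEquiv`).

This gives existence (`isLM_vectorLM`). For an arbitrary `L` with the required properties, the
argument runs on additivity and `β`: comparison of dimensions shows that `L(A)` is the vector group
of the space of `A`, faithfulness is inherited from the forgetful functor, fullness follows because
an injective `ℚ`-linear endomorphism of the finite dimensional space `Hom_k(A,B)` is surjective, and
the projective lines with modulus `(d+1)·0` realize every dimension `d`. -/

noncomputable section

namespace ModulusCurve

/-! ### Polynomial identities tested at the natural numbers -/

section Vandermonde

/-- A polynomial expression with coefficients in a vector space over a field of characteristic zero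
vanishes if it vanishes at all natural numbers. -/
lemma eq_zero_of_sum_pow_smul_eq_zero {k M : Type*} [Field k] [CharZero k] [AddCommGroup M]
    [Module k M] (n : ℕ) (x : ℕ → M)
    (h : ∀ m : ℕ, ∑ j ∈ Finset.range n, (m : k) ^ j • x j = 0) {j : ℕ} (hj : j < n) : x j = 0 := by
  -- Linear functionals reduce the claim to a scalar polynomial, which has all natural numbers as
  -- roots; these are distinct in characteristic zero.
  rw [← Module.forall_dual_apply_eq_zero_iff k]
  intro φ
  let P : Polynomial k := ∑ j ∈ Finset.range n, Polynomial.monomial j (φ (x j))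
  have hP : P = 0 := by
    refine Polynomial.eq_zero_of_infinite_isRoot P ?_
    refine (Set.infinite_range_of_injective (Nat.cast_injective (R := k))).mono ?_
    rintro _ ⟨m, rfl⟩
    have := congrArg φ (h m)
    simp only [map_sum, map_smul, smul_eq_mul, map_zero] at this
    simp only [Polynomial.IsRoot, P, Polynomial.eval_finsetSum, Polynomial.eval_monomial]
    simpa [mul_comm] using this
  have := congrArg (Polynomial.coeff · j) hP
  simpa [P, Polynomial.finsetSum_coeff, Polynomial.coeff_monomial, hj] using this

/-- A polynomial over a (not necessarily commutative) algebra over a field of characteristic zero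
vanishes if it vanishes at all natural numbers. -/
lemma polynomial_eq_zero_of_eval_natCast (k : Type*) {S : Type*} [Field k] [CharZero k] [Ring S]
    [Algebra k S] (P : Polynomial S) (h : ∀ m : ℕ, P.eval (m : S) = 0) : P = 0 := by
  ext j
  rcases lt_or_ge j (P.natDegree + 1) with hj | hj
  · refine eq_zero_of_sum_pow_smul_eq_zero (k := k) _ (fun j => P.coeff j) (fun m => ?_) hj
    rw [← h m, Polynomial.eval_eq_sum_range]
    refine Finset.sum_congr rfl fun i _ => ?_
    -- Powers of `m` are natural numbers, hence central in `S`; so the side on which the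
    -- coefficients stand is irrelevant.
    rw [← Nat.cast_pow, ← Nat.cast_pow, Nat.cast_smul_eq_nsmul, nsmul_eq_mul]
    exact Nat.cast_commute _ _
  · rw [Polynomial.coeff_zero, Polynomial.coeff_eq_zero_of_natDegree_lt (by omega)]

end Vandermonde

/-! ### The logarithm of a unipotent element -/

section Logarithm
variable (k : Type*) [Field k]

/-- The linear coefficient of the polynomial `binom(t, j)`. -/
def logCoeff (j : ℕ) : k := (j.factorial : k)⁻¹ * (descPochhammer k j).coeff 1

/-- The logarithm of `1 + x`, for `x ^ n = 0`. -/
def nilpLog {S : Type*} [Ring S] [Algebra k S] (n : ℕ) (x : S) : S :=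
  ∑ j ∈ Finset.range n, logCoeff k j • x ^ j

/-- The polynomial `t ↦ (1 + x) ^ t`, for `x ^ n = 0`. -/
def nilpPow {S : Type*} [Ring S] [Algebra k S] (n : ℕ) (x : S) : Polynomial S :=
  ∑ j ∈ Finset.range n, Polynomial.C (x ^ j) *
    (Polynomial.C ((j.factorial : k)⁻¹) * descPochhammer k j).map (algebraMap k S)

variable {S : Type*} [Ring S] [Algebra k S]

/-- The logarithm is the derivative of `t ↦ (1 + x) ^ t` at `t = 0`. This description makes its
additivity immediate, without identities between the coefficients of the series. -/
lemma nilpPow_coeff_one (n : ℕ) (x : S) : (nilpPow k n x).coeff 1 = nilpLog k n x := by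
  rw [nilpPow, nilpLog, Polynomial.finsetSum_coeff]
  refine Finset.sum_congr rfl fun j _ => ?_
  rw [Polynomial.coeff_C_mul, Polynomial.coeff_map, Polynomial.coeff_C_mul, Algebra.smul_def]
  exact (Algebra.commutes _ _).symm

variable {k} in
lemma map_nilpLog {S' : Type*} [Ring S'] [Algebra k S'] (φ : S →ₐ[k] S') (n : ℕ) (x : S) :
    φ (nilpLog k n x) = nilpLog k n (φ x) := by
  simp [nilpLog]

/-- The binomial theorem. The two ranges of summation differ only by zero terms: `x ^ j = 0` for `j
≥ n`, and `binom(m, j) = 0` for `j > m`. -/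
lemma nilpPow_eval [CharZero k] (n : ℕ) (x : S) (hx : x ^ n = 0) (m : ℕ) :
    (nilpPow k n x).eval (m : S) = (1 + x) ^ m := by
  rw [nilpPow, Polynomial.eval_finsetSum, add_comm, (Commute.one_right x).add_pow]
  have e : ∀ j, Polynomial.eval (m : S) (Polynomial.C (x ^ j) *
      (Polynomial.C ((j.factorial : k)⁻¹) * descPochhammer k j).map (algebraMap k S)) =
      x ^ j * (m.choose j : S) := by
    intro j
    rw [Polynomial.eval_C_mul]
    congr 1
    rw [show (m : S) = algebraMap k S (m : k) by simp, Polynomial.eval_map, Polynomial.eval₂_at_apply,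
      Polynomial.eval_C_mul, descPochhammer_eval_eq_descFactorial, Nat.descFactorial_eq_factorial_mul_choose,
      Nat.cast_mul, inv_mul_cancel_left₀ (by exact_mod_cast j.factorial_ne_zero)]
    simp
  simp_rw [e, one_pow, mul_one]
  rcases le_total n (m + 1) with h | h
  · refine Finset.sum_subset (Finset.range_mono h) fun j _ hj => ?_
    rw [pow_eq_zero_of_le (by simpa using hj) hx, zero_mul]
  · refine (Finset.sum_subset (Finset.range_mono h) fun j _ hj => ?_).symm
    rw [Nat.choose_eq_zero_of_lt (by simpa using hj)]
    simp

lemma nilpPow_coeff_zero [CharZero k] (n : ℕ) (x : S) (hx : x ^ n = 0) : (nilpPow k n x).coeff 0 = 1 := by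
  have := nilpPow_eval k n x hx 0
  rwa [Nat.cast_zero, ← Polynomial.coeff_zero_eq_eval_zero, pow_zero] at this

/-- `log ((1 + x) (1 + y)) = log (1 + x) + log (1 + y)` if `x` and `y` commute. -/
lemma nilpLog_mul [CharZero k] (n : ℕ) {x y z : S} (hx : x ^ n = 0) (hy : y ^ n = 0) (hz : z ^ n = 0)
    (hxy : Commute x y) (h : 1 + z = (1 + x) * (1 + y)) :
    nilpLog k n z = nilpLog k n x + nilpLog k n y := by
  -- Both sides are polynomials in `t` which agree at every natural number, where they are honest
  -- powers of commuting elements. The claim is the comparison of linear coefficients.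
  have e : nilpPow k n z = nilpPow k n x * nilpPow k n y := by
    rw [← sub_eq_zero]
    refine polynomial_eq_zero_of_eval_natCast k _ fun m => ?_
    rw [Polynomial.eval_sub, nilpPow_eval k n z hz, Polynomial.eval,
      Polynomial.eval₂_mul_noncomm _ _ fun _ => Nat.commute_cast _ _, ← Polynomial.eval,
      ← Polynomial.eval, nilpPow_eval k n x hx, nilpPow_eval k n y hy, h, Commute.mul_pow, sub_self]
    exact ((Commute.one_left _).add_left ((Commute.one_right _).add_right hxy))
  rw [← nilpPow_coeff_one, e, Polynomial.mul_coeff_one, nilpPow_coeff_zero k n x hx,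
    nilpPow_coeff_zero k n y hy, nilpPow_coeff_one, nilpPow_coeff_one]
  simp [add_comm]

/-- For `n ≥ 2` the logarithm has the form `x (1 + x y)` with `y` a polynomial in `x`. As `x y` is
nilpotent, the second factor is a unit. -/
lemma eq_zero_of_nilpLog_eq_zero (n : ℕ) {x : S} (hx : x ^ n = 0) (h : nilpLog k n x = 0) :
    x = 0 := by
  rcases n with _ | _ | n
  · exact eq_zero_of_zero_eq_one (by simpa using hx.symm) x
  · simpa using hx
  have h0 : logCoeff k 0 = 0 := by simp [logCoeff, Polynomial.coeff_one]
  have h1 : logCoeff k 1 = 1 := by simp [logCoeff]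
  rw [nilpLog, Finset.sum_range_succ', Finset.sum_range_succ', h0, h1] at h
  set y : S := ∑ j ∈ Finset.range n, logCoeff k (j + 1 + 1) • x ^ j with hy
  have hc : Commute x y := Commute.sum_right _ _ _ fun j _ =>
    ((Commute.refl x).pow_right j).smul_right _
  have e : x * (1 + x * y) = 0 := by
    rw [← h, mul_add, hy, Finset.mul_sum, Finset.mul_sum, add_comm]
    simp only [mul_smul_comm, ← pow_succ', mul_one, pow_zero, zero_smul, add_zero, zero_add,
      pow_one, one_smul]
  have hn : IsNilpotent (x * y) := ⟨n + 1 + 1, by rw [hc.mul_pow, hx, zero_mul]⟩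
  exact (hn.isUnit_one_add.mul_left_eq_zero).1 e

end Logarithm

/-! ### Additive functions which separate points freely generate the coordinate ring -/

section AdditiveCoordinates
variable {k : Type u} [Field k] {A : Type u} [CommRing A] [Algebra k A]

/-- The elements `ℓ i` are additive functions on the group `Spec A`, and they separate its
points. -/
structure IsAdditiveChart (k : Type u) [Field k] {A : Type u} [CommRing A] [Algebra k A]
    {ι : Type*} (ℓ : ι → A) : Prop where
  exists_zero : ∃ χ : A →ₐ[k] k, ∀ i, χ (ℓ i) = 0
  exists_add : ∀ (R : Type u) [CommRing R] [Algebra k R] (φ ψ : A →ₐ[k] R),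
    ∃ χ : A →ₐ[k] R, ∀ i, χ (ℓ i) = φ (ℓ i) + ψ (ℓ i)
  exists_neg : ∀ (R : Type u) [CommRing R] [Algebra k R] (φ : A →ₐ[k] R),
    ∃ χ : A →ₐ[k] R, ∀ i, χ (ℓ i) = - φ (ℓ i)
  injective : ∀ (R : Type u) [CommRing R] [Algebra k R] (φ ψ : A →ₐ[k] R),
    (∀ i, φ (ℓ i) = ψ (ℓ i)) → φ = ψ

lemma sum_tmul_eq_zero {V W ι : Type*} [AddCommGroup V] [Module k V] [AddCommGroup W] [Module k W]
    {v : ι → V} (hv : LinearIndependent k v) (s : Finset ι) (x : ι → W)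
    (h : ∑ i ∈ s, v i ⊗ₜ[k] x i = 0) {i : ι} (hi : i ∈ s) : x i = 0 := by
  classical
  obtain ⟨φ, hφ⟩ : ∃ φ : V →ₗ[k] k, ∀ j, φ (v j) = if j = i then 1 else 0 := by
    obtain ⟨g, hg⟩ := (Finsupp.linearCombination k v).exists_leftInverse_of_injective
      (LinearMap.ker_eq_bot.2 hv)
    refine ⟨Finsupp.lapply i ∘ₗ g, fun j => ?_⟩
    have := LinearMap.congr_fun hg (Finsupp.single j 1)
    rw [LinearMap.comp_apply, Finsupp.linearCombination_single, one_smul] at this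
    rw [LinearMap.comp_apply, this]
    simp [Finsupp.single_apply]
  have := congrArg (TensorProduct.lid k W ∘ φ.rTensor W) h
  simpa [map_sum, hφ, ite_smul, hi] using this

variable {m : ℕ} {ℓ : Fin m → A}

lemma IsAdditiveChart.nsmul (h : IsAdditiveChart k ℓ) {R : Type u} [CommRing R] [Algebra k R]
    (φ : A →ₐ[k] R) (n : ℕ) : ∃ χ : A →ₐ[k] R, ∀ i, χ (ℓ i) = n * φ (ℓ i) := by
  induction n with
  | zero =>
    obtain ⟨χ, hχ⟩ := h.exists_zero
    exact ⟨(Algebra.ofId k R).comp χ, fun i => by simp [hχ]⟩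
  | succ n ih =>
    obtain ⟨χ, hχ⟩ := ih
    obtain ⟨χ', hχ'⟩ := h.exists_add R χ φ
    exact ⟨χ', fun i => by rw [hχ', hχ]; push_cast; ring⟩

/-- Taylor expansion of `f(y + t x)` to first order in `t`, where the linear term is the directional
derivative. -/
lemma coeff_one_aeval {R : Type*} [CommRing R] [Algebra k R] (x y : Fin m → R)
    (f : MvPolynomial (Fin m) k) :
    (MvPolynomial.aeval (fun i => Polynomial.C (y i) + Polynomial.X * Polynomial.C (x i)) f).coeff 0
        = MvPolynomial.aeval y f ∧
    (MvPolynomial.aeval (fun i => Polynomial.C (y i) + Polynomial.X * Polynomial.C (x i)) f).coeff 1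
        = ∑ i, x i * MvPolynomial.aeval y (MvPolynomial.pderiv i f) := by
  induction f using MvPolynomial.induction_on with
  | C a => simp [Polynomial.algebraMap_apply]
  | add p q hp hq =>
    simp only [map_add, Polynomial.coeff_add, hp, hq, mul_add, Finset.sum_add_distrib, and_self]
  | mul_X p n hp =>
    rw [map_mul, Polynomial.mul_coeff_zero, Polynomial.mul_coeff_one, hp.1, hp.2]
    constructor
    · simp
    · simp only [MvPolynomial.aeval_X, Polynomial.coeff_add, Polynomial.coeff_C_zero,
        Polynomial.coeff_C_succ, Polynomial.coeff_X_mul, zero_add, Polynomial.mul_coeff_zero,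
        Polynomial.coeff_X_zero, zero_mul, add_zero, Derivation.leibniz, map_add, smul_eq_mul,
        map_mul, MvPolynomial.pderiv_X, mul_add, Finset.sum_add_distrib, Finset.sum_mul]
      congr 1
      · rw [Finset.sum_eq_single n]
        · simp; ring
        · intro b _ hb; simp [hb.symm]
        · simp
      · exact Finset.sum_congr rfl fun i _ => by ring

lemma exists_eq_C_of_pderiv_eq_zero [CharZero k] (f : MvPolynomial (Fin m) k)
    (h : ∀ i, MvPolynomial.pderiv i f = 0) : ∃ c, f = MvPolynomial.C c := by
  refine ⟨f.coeff 0, ?_⟩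
  ext s
  rw [MvPolynomial.coeff_C]
  split_ifs with hs
  · rw [hs]
  obtain ⟨i, hi⟩ : ∃ i, s i ≠ 0 := by
    by_contra! hc
    exact hs (Finsupp.ext fun i => (hc i).symm)
  have e := congrArg (MvPolynomial.coeff (s - Finsupp.single i 1)) (h i)
  rw [MvPolynomial.coeff_pderiv, MvPolynomial.coeff_zero,
    tsub_add_cancel_of_le (Finsupp.single_le_iff.2 (Nat.one_le_iff_ne_zero.2 hi))] at e
  exact (mul_eq_zero.1 e).resolve_right (Nat.cast_add_one_ne_zero _)

/-- Relations between the `ℓ i` are stable under derivation. By additivity `n x + y` is again a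
point of the group, so a relation `f` gives `f(y + n x) = 0` in `A ⊗ A` for all natural `n`, hence
`f(y + t x) = 0` as a polynomial in `t`. The linear term is `∑ ℓ i ⊗ (∂ᵢ f)(ℓ)`, and the `ℓ i` are
linearly independent. -/
lemma IsAdditiveChart.pderiv_aeval_eq_zero [CharZero k] (h : IsAdditiveChart k ℓ) (hℓ : LinearIndependent k ℓ)
    (f : MvPolynomial (Fin m) k) (hf : MvPolynomial.aeval ℓ f = 0) (i : Fin m) :
    MvPolynomial.aeval ℓ (MvPolynomial.pderiv i f) = 0 := by
  let x : Fin m → A ⊗[k] A := fun i => ℓ i ⊗ₜ 1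
  let y : Fin m → A ⊗[k] A := fun i => 1 ⊗ₜ ℓ i
  have hP : MvPolynomial.aeval
      (fun i => Polynomial.C (y i) + Polynomial.X * Polynomial.C (x i)) f = 0 := by
    refine polynomial_eq_zero_of_eval_natCast k _ fun n => ?_
    obtain ⟨χ, hχ⟩ := h.nsmul (Algebra.TensorProduct.includeLeft : A →ₐ[k] A ⊗[k] A) n
    obtain ⟨χ', hχ'⟩ := h.exists_add _ χ Algebra.TensorProduct.includeRight
    have e := congrArg χ' hf
    rw [MvPolynomial.comp_aeval_apply, map_zero] at e
    rw [← e]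
    rw [← Polynomial.coe_aeval_eq_eval]
    change (((Polynomial.aeval (n : A ⊗[k] A)).restrictScalars k)) _ = _
    rw [MvPolynomial.comp_aeval_apply]
    congr 2
    funext i
    rw [hχ', hχ]
    simp only [map_add, map_mul, AlgHom.restrictScalars_apply, Polynomial.aeval_C,
      Polynomial.aeval_X, Algebra.algebraMap_self, RingHom.id_apply, x, y,
      Algebra.TensorProduct.includeLeft_apply, Algebra.TensorProduct.includeRight_apply]
    ring
  have h1 := (coeff_one_aeval x y f).2
  rw [hP, Polynomial.coeff_zero] at h1
  refine sum_tmul_eq_zero hℓ Finset.univ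
    (fun i => MvPolynomial.aeval ℓ (MvPolynomial.pderiv i f)) ?_ (Finset.mem_univ i)
  rw [h1]
  refine Finset.sum_congr rfl fun i _ => ?_
  have : MvPolynomial.aeval y (MvPolynomial.pderiv i f) =
      (1 : A) ⊗ₜ[k] MvPolynomial.aeval ℓ (MvPolynomial.pderiv i f) :=
    (MvPolynomial.comp_aeval_apply ℓ
      (Algebra.TensorProduct.includeRight : A →ₐ[k] A ⊗[k] A) _).symm
  rw [this]
  simp [x]

/-- Partial derivatives of a relation are relations of smaller degree. By induction they all vanish,
so in characteristic zero the relation is a constant, and a constant relation is zero. -/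
lemma IsAdditiveChart.algebraicIndependent [CharZero k] (h : IsAdditiveChart k ℓ)
    (hℓ : LinearIndependent k ℓ) : AlgebraicIndependent k ℓ := by
  have hA : Nontrivial A := h.exists_zero.choose.toRingHom.domain_nontrivial
  rw [algebraicIndependent_iff]
  -- The bound is strict so that `d = 0` means an empty support; derivatives which vanish then need
  -- no separate treatment.
  suffices ∀ (d : ℕ) (f : MvPolynomial (Fin m) k), (∀ s ∈ f.support, s.degree < d) →
      MvPolynomial.aeval ℓ f = 0 → f = 0 from
    fun f => this (f.totalDegree + 1) f fun s hs => Nat.lt_succ_of_le (MvPolynomial.le_totalDegree hs)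
  intro d
  induction d with
  | zero =>
    intro f hf _
    exact MvPolynomial.support_eq_empty.1 (Finset.eq_empty_of_forall_notMem fun s hs =>
      Nat.not_lt_zero _ (hf s hs))
  | succ d ih =>
    intro f hd hf
    have hp : ∀ i, MvPolynomial.pderiv i f = 0 := by
      intro i
      refine ih _ (fun s hs => ?_) (h.pderiv_aeval_eq_zero hℓ f hf i)
      rw [MvPolynomial.mem_support_iff, MvPolynomial.coeff_pderiv] at hs
      have := hd _ (MvPolynomial.mem_support_iff.2 (left_ne_zero_of_mul hs))
      rw [map_add, Finsupp.degree_single] at this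
      omega
    obtain ⟨c, rfl⟩ := exists_eq_C_of_pderiv_eq_zero f hp
    rw [MvPolynomial.aeval_C] at hf
    rw [(map_eq_zero_iff _ (algebraMap k A).injective).1 hf, map_zero]

/-- A homomorphism from a field to a commutative ring whose two extensions to the tensor square
agree at `x`. -/
lemma mem_range_algebraMap_of_tmul_eq {K T : Type*} [Field K] [CommRing T] [Algebra K T] {x : T}
    (h : x ⊗ₜ[K] (1 : T) = 1 ⊗ₜ x) : ∃ c, algebraMap K T c = x := by
  rcases subsingleton_or_nontrivial T with hT | hT
  · exact ⟨0, Subsingleton.elim _ _⟩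
  -- Applied to the left factor, a functional with `φ 1 = 1` turns `x ⊗ 1 = 1 ⊗ x` into `φ x • 1 =
  -- x`.
  obtain ⟨φ, hφ⟩ := Module.Projective.exists_dual_eq_one K (one_ne_zero (α := T))
  have := congrArg (TensorProduct.lid K T ∘ φ.rTensor T) h
  refine ⟨φ x, ?_⟩
  simpa [hφ, Algebra.algebraMap_eq_smul_one] using this

/-- Points with the same coordinates coincide, so `B = k[x] → A` is an epimorphism of rings. Over
the fraction field `K` of `B` the two maps from `A` to `T ⊗ T`, where `T = K ⊗ A`, therefore agree;
this places the image of `A` in `K`. Clearing denominators gives the claim: generically, every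
function on the group is a fraction of polynomials in the coordinates. -/
lemma IsAdditiveChart.exists_mul_mem_range (h : IsAdditiveChart k ℓ)
    (a : A) : ∃ f : MvPolynomial (Fin m) k, f ≠ 0 ∧
      ∃ b : MvPolynomial (Fin m) k, MvPolynomial.aeval ℓ f * a = MvPolynomial.aeval ℓ b := by
  let B := MvPolynomial (Fin m) k
  let K := FractionRing B
  let _ : Algebra B A := (MvPolynomial.aeval ℓ).toRingHom.toAlgebra
  have hBA : ∀ b : B, algebraMap B A b = MvPolynomial.aeval ℓ b := fun _ => rfl
  have : IsScalarTower k B A := .of_algebraMap_eq fun c => by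
    rw [hBA, MvPolynomial.algebraMap_eq, MvPolynomial.aeval_C]
  let T := K ⊗[B] A
  let i : A →ₐ[k] T := (Algebra.TensorProduct.includeRight : A →ₐ[B] T).restrictScalars k
  let i₁ : T →ₐ[K] T ⊗[K] T := Algebra.TensorProduct.includeLeft
  let i₂ : T →ₐ[K] T ⊗[K] T := Algebra.TensorProduct.includeRight
  let φ : A →ₐ[k] T ⊗[K] T := (i₁.restrictScalars k).comp i
  let ψ : A →ₐ[k] T ⊗[K] T := (i₂.restrictScalars k).comp i
  have e : φ = ψ := by
    refine h.injective (T ⊗[K] T) φ ψ fun j => ?_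
    have hj : i (ℓ j) = algebraMap K T (algebraMap B K (MvPolynomial.X j)) := by
      rw [← IsScalarTower.algebraMap_apply B K T, ← (Algebra.TensorProduct.includeRight :
        A →ₐ[B] T).commutes, hBA, MvPolynomial.aeval_X]
      rfl
    change i₁ (i (ℓ j)) = i₂ (i (ℓ j))
    rw [hj, AlgHom.commutes, AlgHom.commutes]
  obtain ⟨c, hc⟩ := mem_range_algebraMap_of_tmul_eq (K := K) (x := i a) (DFunLike.congr_fun e a)
  obtain ⟨b, s, hs, rfl⟩ := IsFractionRing.div_surjective (A := B) c
  have hs0 : s ≠ 0 := nonZeroDivisors.ne_zero hs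
  have h0 : TensorProduct.mk B K A 1 (s • a - algebraMap B A b) = 0 := by
    have h1 : (s : B) • i a = algebraMap B T b := by
      rw [← hc]
      refine (Algebra.smul_def (A := T) s _).trans ?_
      rw [IsScalarTower.algebraMap_apply B K T, ← map_mul,
        mul_div_cancel₀, ← IsScalarTower.algebraMap_apply B K T]
      exact (map_ne_zero_iff _ (IsFractionRing.injective B K)).2 hs0
    rw [map_sub, map_smul, sub_eq_zero]
    refine h1.trans ?_
    exact ((Algebra.TensorProduct.includeRight : A →ₐ[B] T).commutes b).symm
  -- An equality in `K ⊗ A` holds in `A` only after multiplication by a further denominator `s'`.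
  have := (isLocalizedModule_iff_isBaseChange (nonZeroDivisors B) K
    (TensorProduct.mk B K A 1)).2 (TensorProduct.isBaseChange B A K)
  obtain ⟨s', hs'⟩ := (IsLocalizedModule.eq_zero_iff (nonZeroDivisors B)
    (TensorProduct.mk B K A 1)).1 h0
  refine ⟨s' * s, mul_ne_zero (nonZeroDivisors.ne_zero s'.2) hs0, s' * b, ?_⟩
  have h2 : (s' : B) • (s • a - algebraMap B A b) = 0 := hs'
  rw [Algebra.smul_def, Algebra.smul_def, hBA, hBA, hBA, mul_sub, sub_eq_zero] at h2
  rw [map_mul, map_mul, ← h2, mul_assoc]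

/-- `f(y) ↦ 1 ⊗ f(ℓ)` and `x_i ↦ ℓ_i ⊗ 1` -/
def chartEval (ℓ : Fin m → A) : MvPolynomial (Fin m) (MvPolynomial (Fin m) k) →+* A ⊗[k] A :=
  MvPolynomial.eval₂Hom (((Algebra.TensorProduct.includeRight : A →ₐ[k] A ⊗[k] A).comp
    (MvPolynomial.aeval ℓ)).toRingHom) fun i => ℓ i ⊗ₜ 1

lemma chartEval_X (i : Fin m) :
    chartEval (k := k) ℓ (MvPolynomial.X i) = ℓ i ⊗ₜ 1 := by
  simp [chartEval]

lemma chartEval_C (b : MvPolynomial (Fin m) k) :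
    chartEval (k := k) ℓ (MvPolynomial.C b) = 1 ⊗ₜ MvPolynomial.aeval ℓ b := by
  simp [chartEval]

lemma chartEval_map_C (b : MvPolynomial (Fin m) k) :
    chartEval (k := k) ℓ (MvPolynomial.map MvPolynomial.C b) = MvPolynomial.aeval ℓ b ⊗ₜ 1 := by
  induction b using MvPolynomial.induction_on with
  | C a =>
    rw [MvPolynomial.map_C, chartEval_C, MvPolynomial.aeval_C, Algebra.algebraMap_eq_smul_one,
      TensorProduct.tmul_smul, TensorProduct.smul_tmul']
  | add p q hp hq => simp only [map_add, hp, hq, TensorProduct.add_tmul]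
  | mul_X p n hp =>
    rw [map_mul, map_mul, hp, MvPolynomial.map_X, chartEval_X, map_mul, MvPolynomial.aeval_X,
      Algebra.TensorProduct.tmul_mul_tmul, mul_one]

/-- Sorting by monomials in the `x`-variables prepares the comparison of coefficients: the left
factors are monomials in `ℓ`, which will be linearly independent. -/
lemma chartEval_eq_sum (Q : MvPolynomial (Fin m) (MvPolynomial (Fin m) k)) :
    chartEval (k := k) ℓ Q = ∑ s ∈ Q.support,
      MvPolynomial.aeval ℓ (MvPolynomial.monomial s (1 : k)) ⊗ₜ
        MvPolynomial.aeval ℓ (MvPolynomial.coeff s Q) := by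
  conv_lhs => rw [Q.as_sum, map_sum]
  refine Finset.sum_congr rfl fun s _ => ?_
  have : MvPolynomial.monomial s (MvPolynomial.coeff s Q) = MvPolynomial.C (MvPolynomial.coeff s Q) *
      MvPolynomial.map MvPolynomial.C (MvPolynomial.monomial s (1 : k)) := by
    rw [MvPolynomial.map_monomial, map_one, MvPolynomial.C_mul_monomial, mul_one]
  rw [this, map_mul, chartEval_C, chartEval_map_C, Algebra.TensorProduct.tmul_mul_tmul, one_mul,
    mul_one]

lemma IsAdditiveChart.exists_mul_eq_chartEval (h : IsAdditiveChart k ℓ) (z : A ⊗[k] A) :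
    ∃ f : MvPolynomial (Fin m) k, f ≠ 0 ∧ ∃ P,
      (MvPolynomial.aeval ℓ f ⊗ₜ MvPolynomial.aeval ℓ f) * z = chartEval ℓ P := by
  induction z with
  | zero => exact ⟨1, one_ne_zero, 0, by simp⟩
  | tmul x y =>
    obtain ⟨f, hf, b, hb⟩ := h.exists_mul_mem_range x
    obtain ⟨g, hg, c, hc⟩ := h.exists_mul_mem_range y
    refine ⟨f * g, mul_ne_zero hf hg, MvPolynomial.map MvPolynomial.C (g * b) *
      MvPolynomial.C (f * c), ?_⟩
    rw [map_mul (chartEval ℓ), chartEval_C, chartEval_map_C, Algebra.TensorProduct.tmul_mul_tmul,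
      Algebra.TensorProduct.tmul_mul_tmul, map_mul, map_mul, map_mul, ← hb, ← hc, mul_one, one_mul]
    congr 1 <;> ring
  | add x y hx hy =>
    obtain ⟨f, hf, b, hb⟩ := hx
    obtain ⟨g, hg, c, hc⟩ := hy
    refine ⟨f * g, mul_ne_zero hf hg, MvPolynomial.map MvPolynomial.C g * MvPolynomial.C g * b +
      MvPolynomial.map MvPolynomial.C f * MvPolynomial.C f * c, ?_⟩
    simp only [map_add, map_mul, chartEval_C, chartEval_map_C, ← hb, ← hc,
      Algebra.TensorProduct.tmul_mul_tmul, mul_add, ← mul_assoc, one_mul, mul_one]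
    congr 3 <;> ring

/-- Modulo `n` the product `f(x) f(y - x)` vanishes in a polynomial ring over a field, so one factor
does. The substitution `x ↦ y - x` is an involution, so in either case `f` vanishes modulo `n`; and
`k` embeds into the residue field. -/
lemma eq_zero_of_forall_coeff_mem {B : Type*} [CommRing B] (n : Ideal B) [n.IsMaximal]
    [Algebra k B] (y : Fin m → B) (f : MvPolynomial (Fin m) k)
    (h : ∀ s, MvPolynomial.coeff s (MvPolynomial.map (algebraMap k B) f *
      MvPolynomial.aeval (fun i => MvPolynomial.C (y i) - MvPolynomial.X i) f) ∈ n) : f = 0 := by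
  let _ : Field (B ⧸ n) := Ideal.Quotient.field n
  let π := MvPolynomial.map (σ := Fin m) (Ideal.Quotient.mk n)
  let f' := MvPolynomial.map (σ := Fin m) (algebraMap k (B ⧸ n)) f
  let τ : MvPolynomial (Fin m) (B ⧸ n) →ₐ[B ⧸ n] MvPolynomial (Fin m) (B ⧸ n) :=
    MvPolynomial.aeval fun i => MvPolynomial.C (Ideal.Quotient.mk n (y i)) - MvPolynomial.X i
  have hτ : Function.Involutive τ := by
    have : τ.comp τ = AlgHom.id _ _ := by
      ext i : 1
      simp [τ]
    exact DFunLike.congr_fun this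
  have e1 : π (MvPolynomial.map (algebraMap k B) f) = f' := by
    rw [MvPolynomial.map_map]; rfl
  have e2 : ∀ g, π (MvPolynomial.aeval (fun i => MvPolynomial.C (y i) - MvPolynomial.X i) g) =
      τ (MvPolynomial.map (algebraMap k (B ⧸ n)) g) := by
    intro g
    induction g using MvPolynomial.induction_on with
    | C a => simp [π, τ, MvPolynomial.algebraMap_apply]
    | add p q hp hq => simp only [map_add, hp, hq]
    | mul_X p n hp => simp only [map_mul, hp]; simp [π, τ]
  have e : f' * τ f' = 0 := by
    rw [← e2 f, ← e1, ← map_mul]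
    ext s
    rw [MvPolynomial.coeff_map, MvPolynomial.coeff_zero]
    exact Ideal.Quotient.eq_zero_iff_mem.2 (h s)
  have hf' : f' = 0 := by
    rcases mul_eq_zero.1 e with h | h
    · exact h
    · rw [← hτ f', h, map_zero]
  exact MvPolynomial.map_injective _ (algebraMap k (B ⧸ n)).injective (hf'.trans (map_zero _).symm)

/-- Translations spread the generic statement over the whole group. Let `f(x) f(y) a(x + y)` be a
polynomial in the coordinates of `x` and `y`. Substituting `y - x` for `y` shows that `f(x) f(y - x)
a(y)` is one too. Comparing coefficients of monomials in `x`, each coefficient of `f(x) f(y - x)`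
multiplies `a` into the subring generated by `ℓ`. By `eq_zero_of_forall_coeff_mem` these
coefficients lie in no common maximal ideal, so `a` itself is in the subring. -/
lemma IsAdditiveChart.surjective [CharZero k] (h : IsAdditiveChart k ℓ) (hℓ : LinearIndependent k ℓ) :
    Function.Surjective (MvPolynomial.aeval (R := k) ℓ) := by
  intro a
  -- With `x` and `y` the two tautological points over `A ⊗ A`, the maps `θ`, `ν`, `σ` are the
  -- points `x + y`, `-x` and `y - x`.
  obtain ⟨θ, hθ⟩ := h.exists_add _ (Algebra.TensorProduct.includeLeft : A →ₐ[k] A ⊗[k] A)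
    Algebra.TensorProduct.includeRight
  obtain ⟨ν, hν⟩ := h.exists_neg _ (Algebra.TensorProduct.includeLeft : A →ₐ[k] A ⊗[k] A)
  obtain ⟨σ, hσ⟩ := h.exists_add _ (Algebra.TensorProduct.includeRight : A →ₐ[k] A ⊗[k] A) ν
  obtain ⟨f, hf, P, hP⟩ := h.exists_mul_eq_chartEval (θ a)
  let Φ : A ⊗[k] A →ₐ[k] A ⊗[k] A := Algebra.TensorProduct.lift Algebra.TensorProduct.includeLeft σ
    fun _ _ => Commute.all _ _
  have hΦt : ∀ x y, Φ (x ⊗ₜ y) = (x ⊗ₜ 1) * σ y := fun x y => by simp [Φ]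
  have hone : ∀ z : A ⊗[k] A, ((1 : A) ⊗ₜ[k] (1 : A)) * z = z := fun z => one_mul z
  -- `Φ` substitutes `y - x` for `y`, so it takes `a(x + y)` to `a(y)`. It suffices to check
  -- coordinates, since they separate points.
  have hΦ : Φ (θ a) = 1 ⊗ₜ a := by
    have : Φ.comp θ = Algebra.TensorProduct.includeRight := by
      refine h.injective _ _ _ fun i => ?_
      simp only [AlgHom.comp_apply, hθ, map_add, Algebra.TensorProduct.includeLeft_apply,
        Algebra.TensorProduct.includeRight_apply, hΦt, hσ, hν, map_one, hone, mul_one]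
      ring
    exact DFunLike.congr_fun this a
  let S (b : MvPolynomial (Fin m) k) : MvPolynomial (Fin m) (MvPolynomial (Fin m) k) :=
    MvPolynomial.aeval (fun i => MvPolynomial.C (MvPolynomial.X i) - MvPolynomial.X i) b
  have hS : ∀ b, σ (MvPolynomial.aeval ℓ b) = chartEval ℓ (S b) := by
    intro b
    induction b using MvPolynomial.induction_on with
    | C c =>
      simp only [S, MvPolynomial.aeval_C, AlgHom.commutes, MvPolynomial.algebraMap_apply,
        chartEval_C, MvPolynomial.algebraMap_eq]
      rw [Algebra.TensorProduct.algebraMap_apply, Algebra.algebraMap_eq_smul_one,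
        TensorProduct.tmul_smul, TensorProduct.smul_tmul']
    | add p q hp hq => simp only [S, map_add, hp, hq]
    | mul_X p n hp =>
      have : chartEval (k := k) ℓ (S (MvPolynomial.X n)) = σ (ℓ n) := by
        simp only [S, MvPolynomial.aeval_X, map_sub, chartEval_C, chartEval_X, hσ, hν]
        simp [sub_eq_add_neg]
      simp only [S, map_mul, hp] at this ⊢
      rw [this, MvPolynomial.aeval_X]
  have hΦE : ∀ P, ∃ P', Φ (chartEval ℓ P) = chartEval ℓ P' := by
    intro P
    induction P using MvPolynomial.induction_on with
    | C c => exact ⟨S c, by rw [chartEval_C, ← hS, hΦt, hone]⟩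
    | add p q hp hq =>
      obtain ⟨p', hp⟩ := hp
      obtain ⟨q', hq⟩ := hq
      exact ⟨p' + q', by rw [map_add, map_add, map_add, hp, hq]⟩
    | mul_X p n hp =>
      obtain ⟨p', hp⟩ := hp
      exact ⟨p' * MvPolynomial.X n, by rw [map_mul, map_mul, map_mul, hp, chartEval_X, hΦt, map_one, mul_one]⟩
  obtain ⟨P', hP'⟩ := hΦE P
  have key : chartEval ℓ (MvPolynomial.map MvPolynomial.C f * S f) * (1 ⊗ₜ a) = chartEval ℓ P' := by
    rw [← hP', ← hP, map_mul Φ, hΦ, map_mul, chartEval_map_C, ← hS, hΦt]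
  set Q := MvPolynomial.map MvPolynomial.C f * S f with hQ
  have hmon : LinearIndependent k
      fun s => MvPolynomial.aeval ℓ (MvPolynomial.monomial s (1 : k)) := by
    have := (MvPolynomial.basisMonomials (Fin m) k).linearIndependent.map'
      (MvPolynomial.aeval (R := k) ℓ).toLinearMap
      (LinearMap.ker_eq_bot.2 (h.algebraicIndependent hℓ))
    simpa [Function.comp_def] using this
  have hcoeff : ∀ s, MvPolynomial.aeval ℓ (MvPolynomial.coeff s Q) * a =
      MvPolynomial.aeval ℓ (MvPolynomial.coeff s P') := by
    classical
    intro s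
    have hsum : ∀ (R : MvPolynomial (Fin m) (MvPolynomial (Fin m) k)),
        R.support ⊆ insert s (Q.support ∪ P'.support) →
        chartEval ℓ R = ∑ s ∈ insert s (Q.support ∪ P'.support),
          MvPolynomial.aeval ℓ (MvPolynomial.monomial s (1 : k)) ⊗ₜ
            MvPolynomial.aeval ℓ (MvPolynomial.coeff s R) := by
      intro R hR
      rw [chartEval_eq_sum]
      refine Finset.sum_subset hR fun t _ ht => ?_
      rw [MvPolynomial.notMem_support_iff.1 ht, map_zero, TensorProduct.tmul_zero]
    rw [hsum Q (fun t ht => by simp only [Finset.mem_insert, Finset.mem_union]; tauto),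
      hsum P' (fun t ht => by simp only [Finset.mem_insert, Finset.mem_union]; tauto),
      ← sub_eq_zero, Finset.sum_mul, ← Finset.sum_sub_distrib] at key
    simp only [Algebra.TensorProduct.tmul_mul_tmul, mul_one, ← TensorProduct.tmul_sub] at key
    exact sub_eq_zero.1 (sum_tmul_eq_zero hmon _ _ key (Finset.mem_insert_self _ _))
  -- The ideal of denominators of `a`; the aim is `1 ∈ J`.
  let J : Ideal (MvPolynomial (Fin m) k) :=
    { carrier := {b | ∃ c : MvPolynomial (Fin m) k, MvPolynomial.aeval ℓ c = MvPolynomial.aeval ℓ b * a}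
      add_mem' := by
        rintro b b' ⟨c, hc⟩ ⟨c', hc'⟩
        exact ⟨c + c', by rw [map_add, map_add, hc, hc', add_mul]⟩
      zero_mem' := ⟨0, by simp⟩
      smul_mem' := by
        rintro d b ⟨c, hc⟩
        exact ⟨d * c, by rw [map_mul, hc, smul_eq_mul, map_mul, mul_assoc]⟩ }
  have hJ : J = ⊤ := by
    by_contra hJ
    obtain ⟨n, hn, hJn⟩ := J.exists_le_maximal hJ
    exact hf (eq_zero_of_forall_coeff_mem n MvPolynomial.X f fun s =>
      hJn ⟨MvPolynomial.coeff s P', (hcoeff s).symm⟩)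
  obtain ⟨c, hc⟩ : (1 : MvPolynomial (Fin m) k) ∈ J := hJ ▸ Submodule.mem_top
  exact ⟨c, by rw [hc, map_one, one_mul]⟩

end AdditiveCoordinates

/-! ### Isomorphisms of group functors -/

section GroupIso
variable {k : Type u} [Field k]

/-- A natural family of bijective homomorphisms is an isomorphism of group functors. -/
def groupFunctorIso {G H : GroupFunctor k} (φ : ∀ R, G.obj R →+ H.obj R)
    (hφ : ∀ R, Function.Bijective (φ R))
    (nat : ∀ (R R' : CommAlgCat.{u} k) (f : R ⟶ R') (g : G.obj R),
      φ R' ((G.map f).hom g) = (H.map f).hom (φ R g)) : G ≅ H :=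
  NatIso.ofComponents (fun R => (AddEquiv.ofBijective (φ R) (hφ R)).toAddCommGrpIso)
    fun {R R'} f => AddCommGrpCat.hom_ext (AddMonoidHom.ext fun g => nat R R' f g)

lemma groupFunctor_hom_natural {G H : GroupFunctor k} (f : G ⟶ H) {R R' : CommAlgCat.{u} k}
    (φ : R ⟶ R') (g : G.obj R) :
    (f.app R').hom ((G.map φ).hom g) = (H.map φ).hom ((f.app R).hom g) :=
  ConcreteCategory.congr_hom (f.naturality φ) g

lemma IsUnipotent.of_iso {G H : GroupFunctor k} (e : G ≅ H) (hG : IsUnipotent G) :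
    IsUnipotent H := by
  obtain ⟨⟨A, hA, ⟨i⟩⟩, n, ρ, h1, h2, h3⟩ := hG
  refine ⟨⟨A, hA, ⟨i ≪≫ Functor.isoWhiskerRight e _⟩⟩, n,
    fun R => (ρ R).comp (AddMonoidHom.toMultiplicative (e.inv.app R).hom), fun R => ?_, ?_, ?_⟩
  · refine (h1 R).comp fun a b h => ?_
    exact ((ConcreteCategory.bijective_of_isIso (e.inv.app R)).1 h)
  · intro R R' φ g
    refine Eq.trans ?_ (h2 R R' φ ((e.inv.app R).hom g))
    exact congrArg (fun x => ρ R' (Multiplicative.ofAdd x)) (groupFunctor_hom_natural e.inv φ g)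
  · intro R g
    exact h3 R _

end GroupIso

/-! ### Unipotent commutative groups are vector groups -/

section Coordinates
variable {k : Type u} [Field k]

/-- All conditions on a chart are linear in `ℓ`, so they depend only on its span. This permits the
passage from the entries of a matrix to a basis of their span. -/
lemma IsAdditiveChart.of_span {A : Type u} [CommRing A] [Algebra k A] {ι κ : Type*} {ℓ : ι → A}
    {ℓ' : κ → A} (h : IsAdditiveChart k ℓ) (h1 : ∀ i, ℓ' i ∈ Submodule.span k (Set.range ℓ))
    (h2 : ∀ i, ℓ i ∈ Submodule.span k (Set.range ℓ')) : IsAdditiveChart k ℓ' where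
  exists_zero := by
    obtain ⟨χ, hχ⟩ := h.exists_zero
    refine ⟨χ, fun i => ?_⟩
    exact Submodule.span_le (p := LinearMap.ker χ.toLinearMap).2
      (by rintro _ ⟨j, rfl⟩; exact hχ j) (h1 i)
  exists_add R _ _ φ ψ := by
    obtain ⟨χ, hχ⟩ := h.exists_add R φ ψ
    refine ⟨χ, fun i => ?_⟩
    exact Submodule.span_le (p := LinearMap.eqLocus χ.toLinearMap
      (φ.toLinearMap + ψ.toLinearMap)).2 (by rintro _ ⟨j, rfl⟩; exact hχ j) (h1 i)
  exists_neg R _ _ φ := by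
    obtain ⟨χ, hχ⟩ := h.exists_neg R φ
    refine ⟨χ, fun i => ?_⟩
    exact Submodule.span_le (p := LinearMap.eqLocus χ.toLinearMap
      (-φ.toLinearMap)).2 (by rintro _ ⟨j, rfl⟩; exact hχ j) (h1 i)
  injective R _ _ φ ψ e := by
    refine h.injective R φ ψ fun i => ?_
    exact Submodule.span_le (p := LinearMap.eqLocus φ.toLinearMap ψ.toLinearMap).2
      (by rintro _ ⟨j, rfl⟩; exact e j) (h2 i)

/-- `R ⊗ kᵐ ≃ Rᵐ` -/
def coordEquiv (m : ℕ) (R : Type u) [CommRing R] [Algebra k R] :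
    R ⊗[k] (Fin m → k) ≃ₗ[k] (Fin m → R) :=
  TensorProduct.piScalarRight k k R (Fin m)

lemma coordEquiv_tmul (m : ℕ) (R : Type u) [CommRing R] [Algebra k R] (r : R) (v : Fin m → k) :
    coordEquiv m R (r ⊗ₜ v) = fun i => v i • r := rfl

lemma coordEquiv_map (m : ℕ) {R R' : Type u} [CommRing R] [Algebra k R] [CommRing R'] [Algebra k R']
    (φ : R →ₐ[k] R') (x : R ⊗[k] (Fin m → k)) :
    coordEquiv m R' (φ.toLinearMap.rTensor _ x) = φ ∘ coordEquiv m R x := by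
  induction x with
  | zero => simp
  | tmul r v =>
    funext i
    simp [coordEquiv_tmul]
  | add x y hx hy =>
    rw [map_add, map_add, hx, hy, map_add]
    funext i
    simp

/-- A group functor whose `R`-points are, naturally, vectors in `R ^ m`, is a vector group. -/
def vectorGroupIso {m : ℕ} {G : GroupFunctor k} (φ : ∀ R : CommAlgCat.{u} k, G.obj R →+ (Fin m → R))
    (hφ : ∀ R, Function.Bijective (φ R))
    (nat : ∀ (R R' : CommAlgCat.{u} k) (f : R ⟶ R') (g : G.obj R),
      φ R' ((G.map f).hom g) = f.hom ∘ (φ R g)) : G ≅ vectorGroup (k := k) (Fin m → k) :=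
  groupFunctorIso (H := vectorGroup (k := k) (Fin m → k))
    (fun R => (coordEquiv m R).symm.toLinearMap.toAddMonoidHom.comp (φ R))
    (fun R => (coordEquiv m R).symm.bijective.comp (hφ R)) fun R R' f g => by
      refine (coordEquiv m R').injective ?_
      refine Eq.trans ?_ (coordEquiv_map m f.hom ((coordEquiv m R).symm (φ R g))).symm
      rw [LinearEquiv.apply_symm_apply]
      exact (LinearEquiv.apply_symm_apply (coordEquiv m R') _).trans (nat R R' f g)

/-- Cayley–Hamilton: the characteristic polynomial is `X ^ n`. -/
lemma Matrix.pow_eq_zero_of_strictUpperTriangular {R : Type*} [CommRing R] {n : ℕ}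
    (M : Matrix (Fin n) (Fin n) R) (h : M.BlockTriangular id) (h0 : ∀ i, M i i = 0) :
    M ^ n = 0 := by
  have := Matrix.aeval_self_charpoly M
  rw [Matrix.charpoly_of_isUpperTriangular M h] at this
  simpa [h0] using this

lemma IsAdditiveChart.exists_coordinates [CharZero k] {A : Type u} [CommRing A] [Algebra k A]
    {ι : Type*} [Finite ι] {ℓ : ι → A} (h : IsAdditiveChart k ℓ) :
    ∃ (m : ℕ) (ℓ' : Fin m → A), (∀ i, ℓ' i ∈ Submodule.span k (Set.range ℓ)) ∧
      ∀ (R : Type u) [CommRing R] [Algebra k R],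
        Function.Bijective fun (φ : A →ₐ[k] R) i => φ (ℓ' i) := by
  let W := Submodule.span k (Set.range ℓ)
  have : FiniteDimensional k W := FiniteDimensional.span_of_finite k (Set.finite_range ℓ)
  let b := Module.finBasis k W
  let ℓ' : Fin (Module.finrank k W) → A := fun i => b i
  have hli : LinearIndependent k ℓ' := b.linearIndependent.map' W.subtype (Submodule.ker_subtype W)
  have hspan : Submodule.span k (Set.range ℓ') = W := by
    have : Set.range ℓ' = W.subtype '' Set.range b := by
      rw [← Set.range_comp]; rfl
    rw [this, Submodule.span_image, b.span_eq, Submodule.map_subtype_top]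
  have hW : ∀ i, ℓ' i ∈ W := fun i => (b i).2
  have h' : IsAdditiveChart k ℓ' := h.of_span hW fun i => by
    rw [hspan]; exact Submodule.subset_span ⟨i, rfl⟩
  refine ⟨_, ℓ', hW, fun R _ _ => ⟨fun φ ψ e => h'.injective R φ ψ fun i => congrFun e i,
    fun x => ?_⟩⟩
  let e : MvPolynomial (Fin (Module.finrank k W)) k ≃ₐ[k] A := AlgEquiv.ofBijective
    (MvPolynomial.aeval ℓ') ⟨h'.algebraicIndependent hli, h'.surjective hli⟩
  refine ⟨(MvPolynomial.aeval x).comp e.symm.toAlgHom, funext fun i => ?_⟩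
  have : e.symm (ℓ' i) = MvPolynomial.X i := by
    rw [AlgEquiv.symm_apply_eq]
    exact (MvPolynomial.aeval_X ℓ' i).symm
  simp [this]

/-- Every unipotent commutative group in characteristic zero is a vector group. -/
lemma IsUnipotent.exists_iso [CharZero k] {G : GroupFunctor k} (hG : IsUnipotent G) :
    ∃ m : ℕ, Nonempty (G ≅ vectorGroup (k := k) (Fin m → k)) := by
  obtain ⟨⟨A, hA, ⟨e⟩⟩, n, ρ, h1, h2, h3⟩ := hG
  let pt (R : CommAlgCat.{u} k) : (A →ₐ[k] R) ≃ G.obj R :=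
    { toFun := fun φ => e.hom.app R (CommAlgCat.ofHom φ)
      invFun := fun g => (e.inv.app R g : A ⟶ R).hom
      left_inv := fun φ => by
        have := ConcreteCategory.congr_hom (e.hom_inv_id_app R) (CommAlgCat.ofHom φ)
        exact congrArg CommAlgCat.Hom.hom this
      right_inv := fun g => ConcreteCategory.congr_hom (e.inv_hom_id_app R) g }
  have pt_nat : ∀ {R R' : CommAlgCat.{u} k} (f : R ⟶ R') (φ : A →ₐ[k] R),
      pt R' (f.hom.comp φ) = (G.map f).hom (pt R φ) := fun f φ =>
    ConcreteCategory.congr_hom (e.hom.naturality f) (CommAlgCat.ofHom φ)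
  let N (R : CommAlgCat.{u} k) (g : G.obj R) : Matrix (Fin n) (Fin n) R :=
    ρ R (Multiplicative.ofAdd g) - 1
  have hN : ∀ R g, N R g ^ n = 0 := fun R g => by
    refine Matrix.pow_eq_zero_of_strictUpperTriangular _ ((h3 R _).1.sub
      (Matrix.blockTriangular_one)) fun i => ?_
    simp [N, (h3 R _).2]
  -- The logarithm of the representing matrix. It is additive because `G` is commutative, so that
  -- the matrices commute.
  let L (R : CommAlgCat.{u} k) : G.obj R →+ Matrix (Fin n) (Fin n) R :=
    AddMonoidHom.mk' (fun g => nilpLog k n (N R g)) fun g h => by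
      have hc : Commute (ρ R (Multiplicative.ofAdd g)) (ρ R (Multiplicative.ofAdd h)) :=
        (Commute.all _ _).map (ρ R)
      refine nilpLog_mul k n (hN R g) (hN R h) (hN R _) ?_ ?_
      · exact ((hc.sub_left (Commute.one_left _)).sub_right (Commute.one_right _))
      · simp only [N, add_sub_cancel, ofAdd_add, map_mul]
  have L_inj : ∀ R, Function.Injective (L R) := fun R => by
    rw [injective_iff_map_eq_zero]
    intro g hg
    have h0 := eq_zero_of_nilpLog_eq_zero k n (hN R g) hg
    have h1' : ρ R (Multiplicative.ofAdd g) = ρ R 1 := by rw [map_one]; exact sub_eq_zero.1 h0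
    exact congrArg Multiplicative.toAdd (h1 R h1')
  have L_nat : ∀ {R R' : CommAlgCat.{u} k} (f : R ⟶ R') (g : G.obj R),
      L R' ((G.map f).hom g) = (L R g).map f.hom := fun {R R'} f g => by
    change nilpLog k n (N R' _) = (AlgHom.mapMatrix f.hom) (nilpLog k n (N R g))
    rw [map_nilpLog]
    congr 1
    simp only [N, h2 R R' f g, map_sub, map_one]
    rfl
  -- The logarithm of the universal point. By naturality its entries evaluate at any point to the
  -- entries of the logarithm of that point, so they form an additive chart.
  let U : Matrix (Fin n) (Fin n) A := L A (pt A (AlgHom.id k A))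
  have hU : ∀ (R : CommAlgCat.{u} k) (φ : A →ₐ[k] R) i j, φ (U i j) = L R (pt R φ) i j := by
    intro R φ i j
    have h := pt_nat (R := A) (R' := R) (CommAlgCat.ofHom φ) (AlgHom.id k A)
    have h' := L_nat (R := A) (R' := R) (CommAlgCat.ofHom φ) (pt A (AlgHom.id k A))
    exact (congrFun (congrFun ((congrArg (L R) h).trans h') i) j).symm
  let ℓ : Fin n × Fin n → A := fun ij => U ij.1 ij.2
  have hℓ : IsAdditiveChart k ℓ :=
    { exists_zero := ⟨(pt (.of k k)).symm 0, fun ij => by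
        refine (hU (.of k k) _ _ _).trans ?_
        rw [Equiv.apply_symm_apply, map_zero]; rfl⟩
      exists_add := fun R _ _ φ ψ => ⟨(pt (.of k R)).symm (pt (.of k R) φ + pt (.of k R) ψ),
        fun ij => by
          refine (hU (.of k R) _ _ _).trans ?_
          rw [Equiv.apply_symm_apply, map_add]
          exact congrArg₂ (· + ·) (hU (.of k R) φ _ _).symm (hU (.of k R) ψ _ _).symm⟩
      exists_neg := fun R _ _ φ => ⟨(pt (.of k R)).symm (-pt (.of k R) φ), fun ij => by
          refine (hU (.of k R) _ _ _).trans ?_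
          rw [Equiv.apply_symm_apply, map_neg]
          exact congrArg (- ·) (hU (.of k R) φ _ _).symm⟩
      injective := fun R _ _ φ ψ h => by
        refine (pt (.of k R)).injective (L_inj _ ?_)
        ext i j
        exact ((hU (.of k R) φ i j).symm.trans (h (i, j))).trans (hU (.of k R) ψ i j) }
  obtain ⟨m, ℓ', hspan, hbij⟩ := hℓ.exists_coordinates
  refine ⟨m, ⟨vectorGroupIso (fun R => AddMonoidHom.mk' (fun g i => (pt R).symm g (ℓ' i))
    fun g h => funext fun i => ?_) (fun R => (hbij R).comp (pt R).symm.bijective) ?_⟩⟩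
  · refine Submodule.span_le (p := LinearMap.eqLocus ((pt R).symm (g + h)).toLinearMap
      (((pt R).symm g).toLinearMap + ((pt R).symm h).toLinearMap)).2 ?_ (hspan i)
    rintro _ ⟨⟨a, b⟩, rfl⟩
    change (pt R).symm (g + h) (U a b) = (pt R).symm g (U a b) + (pt R).symm h (U a b)
    rw [hU, hU, hU, Equiv.apply_symm_apply, Equiv.apply_symm_apply, Equiv.apply_symm_apply, map_add]
    rfl
  · intro R R' f g
    funext i
    change (pt R').symm ((G.map f).hom g) (ℓ' i) = f.hom ((pt R).symm g (ℓ' i))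
    have : (pt R').symm ((G.map f).hom g) = f.hom.comp ((pt R).symm g) := by
      rw [Equiv.symm_apply_eq, pt_nat, Equiv.apply_symm_apply]
    rw [this]
    rfl

end Coordinates

/-! ### Tensor products with `ℚ` -/

section RatTensor

/-- `m ↦ 1 ⊗ m` is an isomorphism `M ≃ ℚ ⊗ M` if `M` is (isomorphic to) a `ℚ`-vector space. -/
def ratTensorEquiv {M N : Type*} [AddCommGroup M] [AddCommGroup N] [Module ℚ N] (e : M ≃+ N) :
    M ≃+ ℚ ⊗[ℤ] M where
  toFun m := 1 ⊗ₜ m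
  invFun z := e.symm (TensorProduct.lift (LinearMap.mk₂ ℤ (fun (q : ℚ) m => q • e m)
    (fun _ _ _ => add_smul _ _ _) (fun c q m => by rw [zsmul_eq_mul, mul_smul, Int.cast_smul_eq_zsmul])
    (fun _ _ _ => by rw [map_add, smul_add]) (fun c q m => by rw [map_zsmul, smul_comm])) z)
  left_inv m := by simp
  right_inv z := by
    induction z with
    | zero => simp
    | add x y hx hy =>
      dsimp only at hx hy ⊢
      rw [map_add, map_add, TensorProduct.tmul_add, hx, hy]
    | tmul q m =>
      dsimp only
      rw [TensorProduct.lift.tmul, LinearMap.mk₂_apply]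
      have hd : (q.den : ℚ) ≠ 0 := by exact_mod_cast q.den_ne_zero
      -- `x` is `m` divided by the denominator of `q`, whence `q ⊗ m = q ⊗ den • x = 1 ⊗ num • x`.
      -- The division is done in `N`, as `M` carries no `ℚ`-structure of its own here.
      set x := e.symm ((q.den : ℚ)⁻¹ • e m)
      have h1 : m = (q.den : ℤ) • x := by
        apply e.injective
        rw [map_zsmul, AddEquiv.apply_symm_apply, ← Int.cast_smul_eq_zsmul ℚ, smul_smul]
        simp [hd]
      have h2 : e.symm (q • e m) = q.num • x := by
        apply e.injective
        rw [map_zsmul, AddEquiv.apply_symm_apply, AddEquiv.apply_symm_apply,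
          ← Int.cast_smul_eq_zsmul ℚ, smul_smul, ← div_eq_mul_inv, Rat.num_div_den]
      rw [h2]
      conv_rhs => rw [h1]
      rw [← TensorProduct.smul_tmul, ← TensorProduct.smul_tmul, zsmul_eq_mul, zsmul_eq_mul, mul_one]
      congr 1
      rw [mul_comm]
      exact (Rat.mul_den_eq_num q).symm
  map_add' _ _ := TensorProduct.tmul_add _ _ _

end RatTensor

/-! ### Vector groups: unipotence and homomorphisms -/

section VectorGroups
variable {k : Type u} [Field k]

section Unipotent

/-- The matrix with first row `(0, x)` and all other rows zero. -/
def firstRow {m : ℕ} {R : Type*} [CommRing R] (x : Fin m → R) :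
    Matrix (Fin (m + 1)) (Fin (m + 1)) R :=
  Matrix.of fun i j => if i = 0 then (Fin.cons 0 x : Fin (m + 1) → R) j else 0

lemma firstRow_mul {m : ℕ} {R : Type*} [CommRing R] (x y : Fin m → R) :
    firstRow x * firstRow y = 0 := by
  ext i j
  rw [Matrix.mul_apply]
  refine Finset.sum_eq_zero fun l _ => ?_
  by_cases hl : l = 0
  · subst hl; simp [firstRow]
  · simp [firstRow, hl]

lemma firstRow_add {m : ℕ} {R : Type*} [CommRing R] (x y : Fin m → R) :
    firstRow (x + y) = firstRow x + firstRow y := by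
  ext i j
  refine Fin.cases ?_ (fun j => ?_) j <;> by_cases hi : i = 0 <;> simp [firstRow, hi]

lemma firstRow_zero {m : ℕ} {R : Type*} [CommRing R] : firstRow (0 : Fin m → R) = 0 := by
  ext i j
  refine Fin.cases ?_ (fun j => ?_) j <;> simp [firstRow]

/-- Products of two matrices `firstRow` vanish, so `x ↦ 1 + firstRow x` turns sums into products.
This is the embedding of a vector group into unipotent matrices. -/
lemma one_add_firstRow_mul {m : ℕ} {R : Type*} [CommRing R] (x y : Fin m → R) :
    1 + firstRow (x + y) = (1 + firstRow x) * (1 + firstRow y) := by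
  rw [firstRow_add, mul_add, add_mul, add_mul, firstRow_mul]
  simp [add_assoc]

lemma firstRow_map {m : ℕ} {R R' : Type*} [CommRing R] [CommRing R'] (φ : R →+* R')
    (x : Fin m → R) : 1 + firstRow (φ ∘ x) = (1 + firstRow x).map φ := by
  ext i j
  refine Fin.cases ?_ (fun j => ?_) j <;> by_cases hi : i = 0 <;>
    simp [firstRow, hi, Matrix.one_apply, apply_ite φ]

lemma isUnipotent_vectorGroup_pi (m : ℕ) : IsUnipotent (vectorGroup (k := k) (Fin m → k)) := by
  refine ⟨⟨.of k (MvPolynomial (Fin m) k), inferInstanceAs (Algebra.FiniteType k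
    (MvPolynomial (Fin m) k)), ⟨NatIso.ofComponents (fun R => Equiv.toIso
      { toFun := fun φ => (coordEquiv m R).symm fun i => φ.hom (MvPolynomial.X i)
        invFun := fun x => CommAlgCat.ofHom (MvPolynomial.aeval (coordEquiv m R x))
        left_inv := fun φ => ?_
        right_inv := fun x => ?_ }) fun {R R'} f => ?_⟩⟩, m + 1, fun R =>
      { toFun := fun x => 1 + firstRow (coordEquiv m R (Multiplicative.toAdd x))
        map_one' := ?_
        map_mul' := fun x y => ?_ }, fun R x y h => ?_, fun R R' φ x => ?_,
      fun R x => ⟨fun i j hij => ?_, fun i => ?_⟩⟩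
  · refine CommAlgCat.hom_ext (MvPolynomial.algHom_ext fun i => ?_)
    simp
  · refine (coordEquiv m R).injective ?_
    funext i
    simp
  · ext φ
    refine (coordEquiv m R').injective ?_
    refine ((coordEquiv m R').apply_symm_apply _).trans ?_
    refine Eq.trans ?_ (coordEquiv_map m f.hom _).symm
    funext i
    change f.hom (φ.hom (MvPolynomial.X i)) = f.hom ((coordEquiv m R) ((coordEquiv m R).symm _) i)
    rw [LinearEquiv.apply_symm_apply]
  · exact (congrArg (1 + firstRow ·) (map_zero (coordEquiv (k := k) m R))).trans (by
      rw [firstRow_zero, add_zero])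
  · exact (congrArg (1 + firstRow ·) (map_add (coordEquiv (k := k) m R) (Multiplicative.toAdd x)
      (Multiplicative.toAdd y))).trans (one_add_firstRow_mul _ _)
  · refine (coordEquiv m R).injective (funext fun i => ?_)
    have h' : firstRow (coordEquiv (k := k) m R (Multiplicative.toAdd x)) =
      firstRow (coordEquiv (k := k) m R (Multiplicative.toAdd y)) := add_left_cancel (a := 1) h
    have h'' := congrFun (congrFun h' 0) i.succ
    simp only [firstRow, Matrix.of_apply, if_true, Fin.cons_succ] at h''
    exact h''
  · exact (congrArg (1 + firstRow ·) (coordEquiv_map m φ.hom x)).trans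
      (firstRow_map (φ.hom : R →+* R') _)
  · have h1 : i ≠ j := (ne_of_lt hij).symm
    have h2 : i ≠ 0 := fun h => by subst h; exact absurd hij (by simp)
    simp [firstRow, h1, h2]
  · by_cases hi : i = 0
    · subst hi; simp [firstRow]
    · simp [firstRow, hi]

lemma vectorGroupMap_comp {V W U : Type u} [AddCommGroup V] [Module k V] [AddCommGroup W]
    [Module k W] [AddCommGroup U] [Module k U] (f : V →ₗ[k] W) (g : W →ₗ[k] U) :
    vectorGroupMap f ≫ vectorGroupMap g = vectorGroupMap (g ∘ₗ f) := by
  ext R x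
  exact (LinearMap.lTensor_comp_apply R g f x).symm

lemma vectorGroupMap_id {V : Type u} [AddCommGroup V] [Module k V] :
    vectorGroupMap (k := k) (V := V) LinearMap.id = 𝟙 _ := by
  ext R x
  exact LinearMap.lTensor_id_apply R V x

/-- Isomorphic vector spaces have isomorphic vector groups. -/
def vectorGroupCongr {V W : Type u} [AddCommGroup V] [Module k V] [AddCommGroup W]
    [Module k W] (e : V ≃ₗ[k] W) : vectorGroup (k := k) V ≅ vectorGroup (k := k) W where
  hom := vectorGroupMap e.toLinearMap
  inv := vectorGroupMap e.symm.toLinearMap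
  hom_inv_id := by rw [vectorGroupMap_comp, LinearEquiv.symm_comp, vectorGroupMap_id]
  inv_hom_id := by rw [vectorGroupMap_comp, LinearEquiv.comp_symm, vectorGroupMap_id]

lemma isUnipotent_vectorGroup (V : Type u) [AddCommGroup V] [Module k V] [Module.Finite k V] :
    IsUnipotent (vectorGroup (k := k) V) :=
  (isUnipotent_vectorGroup_pi (Module.finrank k V)).of_iso
    (vectorGroupCongr (Module.finBasis k V).equivFun.symm)
end Unipotent

section Linear
variable {V W : Type u} [AddCommGroup V] [Module k V] [AddCommGroup W] [Module k W]

/-- Evaluation of polynomials with values in `R ⊗ W`. -/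
lemma exists_eval_eq_sum (R : Type u) [CommRing R] [Algebra k R] (z : Polynomial R ⊗[k] W) :
    ∃ (n : ℕ) (x : ℕ → R ⊗[k] W), ∀ r : R,
      (((Polynomial.aeval r).restrictScalars k : Polynomial R →ₐ[k] R).toLinearMap.rTensor W) z =
        ∑ j ∈ Finset.range n, r ^ j • x j := by
  induction z with
  | zero => exact ⟨0, 0, by simp⟩
  | tmul p w =>
    refine ⟨p.natDegree + 1, fun j => p.coeff j ⊗ₜ w, fun r => ?_⟩
    rw [LinearMap.rTensor_tmul]
    change (Polynomial.aeval r p) ⊗ₜ w = _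
    rw [Polynomial.aeval_eq_sum_range, TensorProduct.sum_tmul]
    refine Finset.sum_congr rfl fun j _ => ?_
    rw [TensorProduct.smul_tmul', smul_eq_mul, smul_eq_mul, mul_comm]
  | add y z hy hz =>
    obtain ⟨n, x, hx⟩ := hy
    obtain ⟨n', x', hx'⟩ := hz
    refine ⟨n + n', fun j => (if j < n then x j else 0) + if j < n' then x' j else 0, fun r => ?_⟩
    rw [map_add, hx, hx']
    simp only [smul_add, Finset.sum_add_distrib]
    congr 1
    · refine (Finset.sum_congr rfl fun j hj => ?_).trans (Finset.sum_subset
        (Finset.range_mono (Nat.le_add_right n n')) fun j _ hj => ?_)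
      · rw [if_pos (Finset.mem_range.1 hj)]
      · rw [if_neg (by simpa using hj), smul_zero]
    · refine (Finset.sum_congr rfl fun j hj => ?_).trans (Finset.sum_subset
        (Finset.range_mono (Nat.le_add_left n' n)) fun j _ hj => ?_)
      · rw [if_pos (Finset.mem_range.1 hj)]
      · rw [if_neg (by simpa using hj), smul_zero]

/-- As a function of `r` the value is a polynomial with coefficients in `R ⊗ W`; vanishing at the
natural numbers kills all its coefficients. -/
lemma eval_eq_zero_of_eval_natCast [CharZero k] (R : Type u) [CommRing R] [Algebra k R]
    (z : Polynomial R ⊗[k] W)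
    (h : ∀ n : ℕ, (((Polynomial.aeval (n : R)).restrictScalars k :
      Polynomial R →ₐ[k] R).toLinearMap.rTensor W) z = 0) (r : R) :
    (((Polynomial.aeval r).restrictScalars k : Polynomial R →ₐ[k] R).toLinearMap.rTensor W) z = 0 := by
  obtain ⟨n, x, hx⟩ := exists_eval_eq_sum R z
  have : ∀ j, j < n → x j = 0 := fun j hj => by
    refine eq_zero_of_sum_pow_smul_eq_zero (k := k) n x (fun m => ?_) hj
    rw [← h m, hx]
    refine Finset.sum_congr rfl fun j _ => ?_
    rw [← Nat.cast_pow, ← Nat.cast_pow, Nat.cast_smul_eq_nsmul, Nat.cast_smul_eq_nsmul]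
  rw [hx]
  exact Finset.sum_eq_zero fun j hj => by rw [this j (Finset.mem_range.1 hj), smul_zero]

/-- The homomorphism `R ⊗ V → R ⊗ W` induced by a homomorphism of vector groups. -/
def vectorGroupHomApp (φ : vectorGroup (k := k) V ⟶ vectorGroup (k := k) W) (R : Type u)
    [CommRing R] [Algebra k R] : R ⊗[k] V →+ R ⊗[k] W := (φ.app (.of k R)).hom

lemma vectorGroupHomApp_natural (φ : vectorGroup (k := k) V ⟶ vectorGroup (k := k) W) {R R' : Type u}
    [CommRing R] [Algebra k R] [CommRing R'] [Algebra k R'] (f : R →ₐ[k] R') (x : R ⊗[k] V) :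
    vectorGroupHomApp φ R' (f.toLinearMap.rTensor V x) =
      f.toLinearMap.rTensor W (vectorGroupHomApp φ R x) :=
  groupFunctor_hom_natural φ (CommAlgCat.ofHom f) x

lemma rTensor_smul {R R' : Type u} [CommRing R] [Algebra k R] [CommRing R'] [Algebra k R']
    (f : R →ₐ[k] R') (r : R) (x : R ⊗[k] V) :
    f.toLinearMap.rTensor V (r • x) = f r • f.toLinearMap.rTensor V x := by
  induction x with
  | zero => simp
  | tmul s v => simp [TensorProduct.smul_tmul']
  | add x y hx hy => rw [smul_add, map_add, map_add, hx, hy, smul_add]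

/-- Additivity gives the claim for natural numbers `r`. Over `R[t]` the difference `φ(t x) - t φ(x)`
is a single element `z` whose value at `t = r` is, by naturality, the difference for `r`. It
vanishes at natural numbers, hence everywhere. -/
lemma vectorGroupHomApp_smul [CharZero k] (φ : vectorGroup (k := k) V ⟶ vectorGroup (k := k) W)
    (R : Type u) [CommRing R] [Algebra k R] (r : R) (x : R ⊗[k] V) :
    vectorGroupHomApp φ R (r • x) = r • vectorGroupHomApp φ R x := by
  let ev (r : R) : Polynomial R →ₐ[k] R := (Polynomial.aeval r).restrictScalars k
  let c : R →ₐ[k] Polynomial R := IsScalarTower.toAlgHom k R (Polynomial R)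
  have hc : ∀ (U : Type u) [AddCommGroup U] [Module k U] (r : R) (x : R ⊗[k] U),
      (ev r).toLinearMap.rTensor U ((Polynomial.X : Polynomial R) • c.toLinearMap.rTensor U x) =
        r • x := by
    intro U _ _ r x
    rw [rTensor_smul, ← LinearMap.rTensor_comp_apply]
    have h1 : (ev r).toLinearMap ∘ₗ c.toLinearMap = LinearMap.id := by
      ext a
      simp [ev, c]
    have h2 : ev r Polynomial.X = r := Polynomial.aeval_X r
    rw [h1, h2, LinearMap.rTensor_id_apply]
  let z := vectorGroupHomApp φ (Polynomial R)
    ((Polynomial.X : Polynomial R) • c.toLinearMap.rTensor V x) -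
      (Polynomial.X : Polynomial R) • c.toLinearMap.rTensor W (vectorGroupHomApp φ R x)
  have hz : ∀ r, (ev r).toLinearMap.rTensor W z =
      vectorGroupHomApp φ R (r • x) - r • vectorGroupHomApp φ R x := by
    intro r
    rw [map_sub, ← vectorGroupHomApp_natural, hc, hc]
  rw [← sub_eq_zero, ← hz]
  refine eval_eq_zero_of_eval_natCast R z (fun n => ?_) r
  refine (hz n).trans ?_
  rw [Nat.cast_smul_eq_nsmul, Nat.cast_smul_eq_nsmul, map_nsmul, sub_self]

/-- The linear map which induces a homomorphism of vector groups. -/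
def linearOfHom [CharZero k] (φ : vectorGroup (k := k) V ⟶ vectorGroup (k := k) W) : V →ₗ[k] W where
  toFun v := TensorProduct.lid k W (vectorGroupHomApp φ k (1 ⊗ₜ v))
  map_add' v w := by rw [TensorProduct.tmul_add, map_add, map_add]
  map_smul' c v := by rw [TensorProduct.tmul_smul, vectorGroupHomApp_smul, map_smul, RingHom.id_apply]

/-- By `R`-linearity a homomorphism is determined by its values at `1 ⊗ v`, and by naturality these
come from its values over `k`. -/
lemma vectorGroupMap_linearOfHom [CharZero k]
    (φ : vectorGroup (k := k) V ⟶ vectorGroup (k := k) W) :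
    vectorGroupMap (linearOfHom φ) = φ := by
  ext R x
  change (linearOfHom φ).lTensor R x = vectorGroupHomApp φ R x
  induction x using TensorProduct.induction_on with
  | zero => simp
  | add x y hx hy => rw [map_add, map_add, hx, hy]
  | tmul r v =>
    have h := vectorGroupHomApp_natural φ (Algebra.ofId k R) ((1 : k) ⊗ₜ[k] v)
    have e1 : r ⊗ₜ[k] v = r • (Algebra.ofId k R).toLinearMap.rTensor V ((1 : k) ⊗ₜ[k] v) := by
      simp [TensorProduct.smul_tmul']
    rw [LinearMap.lTensor_tmul, e1, vectorGroupHomApp_smul, h]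
    have e2 : vectorGroupHomApp φ k ((1 : k) ⊗ₜ[k] v) = 1 ⊗ₜ linearOfHom φ v := by
      exact (TensorProduct.lid k W).injective (by simp [linearOfHom])
    rw [e2]
    simp [TensorProduct.smul_tmul']

lemma linearOfHom_vectorGroupMap [CharZero k] (f : V →ₗ[k] W) : linearOfHom (vectorGroupMap f) = f := by
  ext v
  change TensorProduct.lid k W (f.lTensor k (1 ⊗ₜ v)) = f v
  simp

/-- Homomorphisms of vector groups are linear maps. -/
def homEquivLinear [CharZero k] (V W : Type u) [AddCommGroup V] [Module k V] [AddCommGroup W]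
    [Module k W] : (vectorGroup (k := k) V ⟶ vectorGroup (k := k) W) ≃+ (V →ₗ[k] W) where
  toFun := linearOfHom
  invFun := vectorGroupMap
  left_inv := vectorGroupMap_linearOfHom
  right_inv := linearOfHom_vectorGroupMap
  map_add' φ ψ := by
    ext v
    change TensorProduct.lid k W (vectorGroupHomApp φ k _ + vectorGroupHomApp ψ k _) = _
    rw [map_add]
    rfl

variable [CharZero k]

instance : Module ℚ (V →ₗ[k] W) := Module.compHom _ (algebraMap ℚ k)

/-- `Hom ⊗ ℚ` of vector groups is the space of linear maps. -/
def ratHomEquivLinear (V W : Type u) [AddCommGroup V] [Module k V] [AddCommGroup W]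
    [Module k W] : (V →ₗ[k] W) ≃+ ((RatCat.incl (GroupFunctor k)).obj (vectorGroup (k := k) V) ⟶
      (RatCat.incl (GroupFunctor k)).obj (vectorGroup (k := k) W)) :=
  (homEquivLinear V W).symm.trans (ratTensorEquiv (homEquivLinear V W))

/-- The homomorphisms already form a `ℚ`-vector space, so no new morphisms arise in the isogeny
category. -/
lemma vectorGroupFunctor_full : (vectorGroupFunctor k).Full where
  map_surjective {V W} f := by
    obtain ⟨g, hg⟩ := (ratHomEquivLinear (k := k) V W).surjective f
    exact ⟨FGModuleCat.ofHom g, hg⟩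

lemma vectorGroupFunctor_faithful : (vectorGroupFunctor k).Faithful where
  map_injective {V W} f g h := by
    have := (ratHomEquivLinear (k := k) V W).injective h
    exact FGModuleCat.hom_ext this
end Linear

/-- Every unipotent group is isomorphic to a vector group. -/
lemma Muni.exists_iso_vectorGroup [CharZero k] (G : Muni k) :
    ∃ V : FGModuleCat.{u} k, Nonempty (G.obj ≅ (vectorGroupFunctor k).obj V) := by
  obtain ⟨m, ⟨e⟩⟩ := G.property.exists_iso
  exact ⟨FGModuleCat.of k (Fin m → k) , ⟨(RatCat.incl _).mapIso e⟩⟩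
end VectorGroups

/-! ### Local algebra of smooth curves -/

section LocalAlgebra

/-- A Noetherian local ring whose maximal ideal is generated by a nonzerodivisor is a domain. -/
lemma isDomain_of_maximalIdeal_eq_span {A : Type*} [CommRing A] [IsLocalRing A]
    [IsNoetherianRing A] (π : A) (h : IsLocalRing.maximalIdeal A = Ideal.span {π})
    (hπ : π = 0 ∨ π ∈ nonZeroDivisors A) : IsDomain A := by
  -- By Krull's intersection theorem a nonzero `a` lies outside some power of the maximal ideal; the
  -- last power containing it gives the exponent.
  have key : ∀ a : A, a ≠ 0 → ∃ n : ℕ, ∃ v : A, IsUnit v ∧ a = v * π ^ n := by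
    intro a ha
    have hn : ∃ n, a ∉ Ideal.span {π ^ n} := by
      by_contra! hc
      refine ha ?_
      have := Ideal.iInf_pow_eq_bot_of_isLocalRing (IsLocalRing.maximalIdeal A)
        (IsLocalRing.maximalIdeal.isMaximal A).ne_top
      rw [← Ideal.mem_bot, ← this, Ideal.mem_iInf]
      intro n
      rw [h, Ideal.span_singleton_pow]
      exact hc n
    classical
    have h0 : Nat.find hn ≠ 0 := fun h0 => by
      have := Nat.find_spec hn
      rw [h0, pow_zero, Ideal.span_singleton_one] at this
      exact this trivial
    obtain ⟨n, hn'⟩ := Nat.exists_eq_succ_of_ne_zero h0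
    have h1 := Nat.find_min hn (m := n) (by omega)
    rw [not_not, Ideal.mem_span_singleton'] at h1
    obtain ⟨v, hv⟩ := h1
    refine ⟨n, v, ?_, hv.symm⟩
    by_contra hu
    have : v ∈ IsLocalRing.maximalIdeal A := hu
    rw [h, Ideal.mem_span_singleton'] at this
    obtain ⟨w, rfl⟩ := this
    refine Nat.find_spec hn ?_
    rw [hn', Ideal.mem_span_singleton']
    exact ⟨w, by rw [← hv, Nat.succ_eq_add_one, pow_succ]; ring⟩
  have : NoZeroDivisors A := ⟨fun {a b} hab => by
    by_contra! hc
    obtain ⟨n, v, hv, rfl⟩ := key a hc.1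
    obtain ⟨m, w, hw, rfl⟩ := key b hc.2
    have e : π ^ (n + m) = 0 := by
      refine (hv.mul hw).mul_left_cancel ?_
      rw [mul_zero, pow_add, ← hab]; ring
    rcases hπ with rfl | hπ
    · have : n ≠ 0 ∨ m ≠ 0 := by
        by_contra! h'
        rw [h'.1, h'.2] at e
        simp at e
      rcases this with h' | h'
      · exact hc.1 (by simp [h'])
      · exact hc.2 (by simp [h'])
    · have := pow_mem hπ (n + m)
      rw [e] at this
      exact zero_notMem_nonZeroDivisors this⟩
  exact NoZeroDivisors.to_isDomain A

/-- The localizations of an étale algebra over a principal ideal domain are local principal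
ideal domains. -/
lemma isPrincipalIdealRing_localization_of_etale {P S : Type*} [CommRing P] [IsDomain P]
    [IsPrincipalIdealRing P] [CommRing S] [Algebra P S] [Algebra.Etale P S] (q : Ideal S)
    [q.IsPrime] : IsDomain (Localization.AtPrime q) ∧
      IsPrincipalIdealRing (Localization.AtPrime q) := by
  have : IsNoetherianRing S := Algebra.FiniteType.isNoetherianRing P S
  have : IsNoetherianRing (Localization.AtPrime q) :=
    IsLocalization.isNoetherianRing q.primeCompl _ inferInstance
  have hu : Algebra.FormallyUnramified P (Localization.AtPrime q) := by
    have : Algebra.FormallyUnramified S (Localization.AtPrime q) :=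
      Algebra.FormallyUnramified.of_isLocalization q.primeCompl
    exact Algebra.FormallyUnramified.comp P S _
  have : Module.Flat S (Localization.AtPrime q) := IsLocalization.flat _ q.primeCompl
  have : Module.Flat P (Localization.AtPrime q) := Module.Flat.trans P S _
  have : Algebra.EssFiniteType P S := inferInstance
  let p := q.under P
  let _ : Algebra (Localization.AtPrime p) (Localization.AtPrime q) :=
    (Localization.localRingHom p q (algebraMap P S) rfl).toAlgebra
  have : Localization.AtPrime.IsLiesOverAlgebra p q := ⟨rfl⟩
  -- Unramifiedness: a generator `ϖ` of the prime below generates the maximal ideal. By flatness it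
  -- stays a nonzerodivisor, unless it is zero.
  have h : p.map (algebraMap P (Localization.AtPrime q)) = IsLocalRing.maximalIdeal _ :=
    ((Algebra.isUnramifiedAt_iff_map_eq P p q).1 hu).2
  obtain ⟨ϖ, hϖ⟩ := IsPrincipalIdealRing.principal p
  have h' : IsLocalRing.maximalIdeal (Localization.AtPrime q) =
      Ideal.span {algebraMap P (Localization.AtPrime q) ϖ} := by
    rw [← h, hϖ, ← Ideal.span, Ideal.map_span, Set.image_singleton]
  have : IsDomain (Localization.AtPrime q) := by
    refine isDomain_of_maximalIdeal_eq_span _ h' ?_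
    by_cases h0 : ϖ = 0
    · left; rw [h0, map_zero]
    · right
      have := Module.Flat.isSMulRegular_of_nonZeroDivisors (M := Localization.AtPrime q)
        (mem_nonZeroDivisors_of_ne_zero h0)
      rw [mem_nonZeroDivisors_iff_right]
      intro x hx
      refine this ?_
      simp only [Algebra.smul_def]
      rw [mul_comm, hx, mul_zero]
  refine ⟨this, ((tfae_of_isNoetherianRing_of_isLocalRing_of_isDomain
    (R := Localization.AtPrime q)).out 0 4).2 ?_⟩
  exact ⟨_, h'⟩

/-- In a local principal ideal domain every prime is zero or maximal. -/
lemma eq_bot_or_eq_maximalIdeal {A : Type*} [CommRing A] [IsLocalRing A] [IsDomain A]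
    [IsPrincipalIdealRing A] (P : Ideal A) [P.IsPrime] :
    P = ⊥ ∨ P = IsLocalRing.maximalIdeal A := by
  by_cases h : P = ⊥
  · exact Or.inl h
  · exact Or.inr (IsLocalRing.eq_maximalIdeal (IsPrime.to_maximal_ideal h))

/-- An element of the maximal ideal which is algebraic over a field of constants is zero. -/
lemma eq_zero_of_isAlgebraic_of_mem {k A : Type*} [Field k] [CommRing A] [IsDomain A]
    [IsLocalRing A] [Algebra k A] (a : A) (h : IsAlgebraic k a)
    (ha : a ∈ IsLocalRing.maximalIdeal A) : a = 0 := by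
  by_contra h0
  have hu : IsUnit a := by
    -- A nonzero algebraic element of a domain divides a nonzero constant, so it is a unit.
    obtain ⟨b, hb, e⟩ := h.exists_nonzero_dvd
      (mem_nonZeroDivisors_of_ne_zero h0)
    exact isUnit_of_dvd_unit e ((Ne.isUnit hb).map (algebraMap k A))
  exact ha hu
end LocalAlgebra
-- Stalks and generic points of a curve
section Stalks
variable {k : Type u} [Field k] (C : Curve k)

/-- Locally a smooth curve is étale over the affine line, whose coordinate ring is a principal ideal
domain. -/
lemma Curve.stalk_isDomain_and_isPrincipalIdealRing (x : C.X) :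
    IsDomain (C.stalk x) ∧ IsPrincipalIdealRing (C.stalk x) := by
  have := C.smooth
  obtain ⟨U, hU, V, hV, hx, e, hf⟩ :=
    SmoothOfRelativeDimension.exists_isStandardSmoothOfRelativeDimension (n := 1) (f := C.str) x
  obtain ⟨g, -, hg⟩ := hf.exists_etale_mvPolynomial
  -- The spectrum of a field has one point, so a nonempty open subset is everything.
  have hUt : U = ⊤ := by
    ext y
    have : y = C.str x := Subsingleton.elim (α := PrimeSpectrum k) _ _
    simp only [this, TopologicalSpace.Opens.coe_top, Set.mem_univ, iff_true]
    exact e hx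
  subst hUt
  let E : Γ(Spec (CommRingCat.of k), ⊤) ≃+* k :=
    (Scheme.ΓSpecIso (CommRingCat.of k)).commRingCatIsoToRingEquiv
  let _ : Field Γ(Spec (CommRingCat.of k), ⊤) := (E.isField (Field.toIsField k)).toField
  let P := MvPolynomial (Fin 1) Γ(Spec (CommRingCat.of k), ⊤)
  have : IsPrincipalIdealRing P := IsPrincipalIdealRing.of_surjective
    (MvPolynomial.uniqueAlgEquiv _ (Fin 1)).symm (AlgEquiv.surjective _)
  algebraize [g]
  let _ : Algebra Γ(C.X, V) (C.stalk x) := C.X.presheaf.algebra_section_stalk ⟨x, hx⟩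
  have := hV.isLocalization_stalk ⟨x, hx⟩
  obtain ⟨h1, h2⟩ := isPrincipalIdealRing_localization_of_etale (P := P)
    (hV.primeIdealOf ⟨x, hx⟩).asIdeal
  let e : Localization.AtPrime (hV.primeIdealOf ⟨x, hx⟩).asIdeal ≃ₐ[Γ(C.X, V)] C.stalk x :=
    IsLocalization.algEquiv (hV.primeIdealOf ⟨x, hx⟩).asIdeal.primeCompl _ _
  exact ⟨e.symm.toRingEquiv.toMulEquiv.isDomain, IsPrincipalIdealRing.of_surjective e e.surjective⟩

instance (x : C.X) : IsDomain (C.stalk x) := (C.stalk_isDomain_and_isPrincipalIdealRing x).1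
instance (x : C.X) : IsPrincipalIdealRing (C.stalk x) :=
  (C.stalk_isDomain_and_isPrincipalIdealRing x).2

/-- The point with the zero ideal of `𝒪_{X,x}`: the generic point of the component of `x`. -/
def Curve.gen (x : C.X) : C.X := C.X.fromSpecStalk x (⊥ : PrimeSpectrum (C.stalk x))

lemma Curve.gen_specializes (x : C.X) : C.gen x ⤳ x := by
  have : C.gen x ∈ Set.range (C.X.fromSpecStalk x) := ⟨_, rfl⟩
  rwa [Scheme.range_fromSpecStalk] at this

/-- The generalizations of `x` are the primes of its stalk, a local principal ideal domain: only
zero and the maximal ideal. -/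
lemma Curve.eq_gen_or_eq {x y : C.X} (h : y ⤳ x) : y = C.gen x ∨ y = x := by
  have : y ∈ Set.range (C.X.fromSpecStalk x) := by rwa [Scheme.range_fromSpecStalk]
  obtain ⟨P, rfl⟩ := this
  have hP : (PrimeSpectrum.asIdeal P).IsPrime := P.2
  rcases eq_bot_or_eq_maximalIdeal (PrimeSpectrum.asIdeal P) with h | h
  · left
    have : P = (⊥ : PrimeSpectrum (C.stalk x)) := PrimeSpectrum.ext h
    rw [this]; rfl
  · right
    have : P = IsLocalRing.closedPoint (C.stalk x) := PrimeSpectrum.ext h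
    rw [this, Scheme.fromSpecStalk_closedPoint]

lemma Curve.gen_specializes_of {x y : C.X} (h : y ⤳ x) : C.gen x ⤳ y := by
  rcases C.eq_gen_or_eq h with rfl | rfl
  · exact specializes_rfl
  · exact C.gen_specializes _

lemma Curve.isGeneric_gen (x : C.X) : IsGeneric C (C.gen x) := fun _ hy =>
  (hy.antisymm (C.gen_specializes_of (hy.trans (C.gen_specializes x)))).eq

lemma IsGeneric.eq_gen {C : Curve k} {η x : C.X} (hη : IsGeneric C η) (h : η ⤳ x) : η = C.gen x :=
  (hη _ (C.gen_specializes_of h)).symm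

/-- Both stalks are localizations of the ring of an affine neighbourhood. A numerator which dies at
`η` is killed by an element whose germ at `x` is nonzero, and the stalk at `x` is a domain. -/
lemma Curve.spec_injective {η x : C.X} (h : η ⤳ x) : Function.Injective (C.spec h) := by
  rw [injective_iff_map_eq_zero]
  intro a ha
  obtain ⟨U, hU, hx, -⟩ := exists_isAffineOpen_mem_and_subset (U := ⊤) (x := x) trivial
  have hη : η ∈ U := h.mem_open U.2 hx
  let _ : Algebra Γ(C.X, U) (C.stalk x) := C.X.presheaf.algebra_section_stalk ⟨x, hx⟩
  let _ : Algebra Γ(C.X, U) (C.stalk η) := C.X.presheaf.algebra_section_stalk ⟨η, hη⟩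
  have h1 := hU.isLocalization_stalk ⟨x, hx⟩
  have h2 := hU.isLocalization_stalk ⟨η, hη⟩
  have hs : ∀ s : Γ(C.X, U), C.spec h (algebraMap _ _ s) = algebraMap _ _ s := fun s =>
    congr($(C.X.presheaf.germ_stalkSpecializes (U := U) hx h).hom s)
  obtain ⟨⟨s, t⟩, e⟩ := IsLocalization.surj (hU.primeIdealOf ⟨x, hx⟩).asIdeal.primeCompl a
  have e1 : algebraMap Γ(C.X, U) (C.stalk η) s = 0 := by
    rw [← hs, ← e, map_mul, ha, zero_mul]
  obtain ⟨w, hw⟩ := (IsLocalization.map_eq_zero_iff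
    (hU.primeIdealOf ⟨η, hη⟩).asIdeal.primeCompl _ _).1 e1
  have hw1 : algebraMap Γ(C.X, U) (C.stalk x) w ≠ 0 := fun h0 => by
    have := IsLocalization.map_units (C.stalk η) w
    rw [← hs, h0, map_zero] at this
    exact not_isUnit_zero this
  have hs0 : algebraMap Γ(C.X, U) (C.stalk x) s = 0 := by
    have := congrArg (algebraMap Γ(C.X, U) (C.stalk x)) hw
    rw [map_mul, map_zero] at this
    exact (mul_eq_zero.1 this).resolve_left hw1
  rw [hs0] at e
  exact (IsLocalization.map_units (C.stalk x) t).mul_left_eq_zero.1 e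

/-- The place of a point. -/
def Curve.place (x : C.X) : Place C := ⟨⟨C.gen x, C.isGeneric_gen x⟩, x, C.gen_specializes x⟩

/-- Only one component passes through a point, so families indexed by places are families indexed by
points. -/
lemma Place.eq_place {C : Curve k} (i : Place C) : i = C.place i.x := by
  obtain ⟨⟨η, hη⟩, x, h⟩ := i
  obtain rfl := hη.eq_gen h
  rfl

/-- The zero ideal and the maximal ideal of the stalk give the same point of `X`, so they are equal.
-/
lemma IsGeneric.isField_stalk {C : Curve k} {η : C.X} (hη : IsGeneric C η) :
    IsField (C.stalk η) := by
  rw [IsLocalRing.isField_iff_maximalIdeal_eq]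
  have h := hη _ (C.gen_specializes η)
  have := (C.X.fromSpecStalk η).isEmbedding.injective (h.trans Scheme.fromSpecStalk_closedPoint.symm)
  exact (congrArg PrimeSpectrum.asIdeal this).symm

end Stalks

/-- In characteristic `0` a function with zero differential is algebraic over the constants. -/
lemma isAlgebraic_of_D_eq_zero {k L : Type u} [Field k] [CharZero k] [inst : CommRing L]
    [Algebra k L] (hL : IsField L) (h : L) (hD : KaehlerDifferential.D k L h = 0) :
    IsAlgebraic k h := by
  obtain ⟨F, rfl⟩ : ∃ F : Field L, F.toCommRing = inst := ⟨hL.toField, rfl⟩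
  by_contra ht
  have ht : Transcendental k h := ht
  -- If `h` were transcendental, `t ↦ h` would embed `k[t]` into `L`. In characteristic zero `L` is
  -- formally smooth over `k(t)`, hence over `k[t]`, so `L ⊗ Ω_{k[t]} → Ω_L` is injective. It takes
  -- the basis element `dt` to `dh = 0`, a contradiction.
  let P := Polynomial k
  let φ : P →ₐ[k] L := Polynomial.aeval h
  have hφ : Function.Injective φ := transcendental_iff_injective.1 ht
  algebraize [φ.toRingHom]
  have : IsScalarTower k P L := .of_algebraMap_eq' φ.comp_algebraMap.symm
  have : FaithfulSMul P L := (faithfulSMul_iff_algebraMap_injective P L).2 hφ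
  let K := FractionRing P
  let _ : Algebra K L := FractionRing.liftAlgebra P L
  have : CharZero K := charZero_of_injective_algebraMap (algebraMap k K).injective
  have h1 : Algebra.FormallySmooth K L := by
    obtain ⟨s, hs⟩ := exists_isTranscendenceBasis K L
    have : Algebra.IsAlgebraic (IntermediateField.adjoin K (Set.range ((↑) : s → L))) L :=
      hs.isAlgebraic_field
    exact .of_algebraicIndependent_of_isSeparable hs.1
  have h2 : Algebra.FormallySmooth P K := .of_isLocalization (nonZeroDivisors P)
  have h3 : Algebra.FormallySmooth P L := .comp P K L
  have hinj : Function.Injective (KaehlerDifferential.mapBaseChange k P L) := by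
    rw [injective_iff_map_eq_zero]
    intro x hx
    obtain ⟨y, rfl⟩ := (Algebra.H1Cotangent.exact_δ_mapBaseChange k P L x).1 hx
    rw [Subsingleton.elim y 0, map_zero]
  have h4 : (1 : L) ⊗ₜ[P] KaehlerDifferential.D k P Polynomial.X = 0 := by
    apply hinj
    rw [map_zero, KaehlerDifferential.mapBaseChange_tmul, KaehlerDifferential.map_D, one_smul]
    have : algebraMap P L Polynomial.X = h := Polynomial.aeval_X h
    rw [this, hD]
  have h5 := congrArg (TensorProduct.rid P L) (congrArg
    ((KaehlerDifferential.polynomialEquiv k).toLinearMap.lTensor L) h4)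
  rw [LinearMap.lTensor_tmul, LinearEquiv.coe_coe, KaehlerDifferential.polynomialEquiv_D,
    Polynomial.derivative_X, map_zero, map_zero, TensorProduct.rid_tmul, one_smul] at h5
  exact one_ne_zero h5

/-! ### Identification of `fil²` with the nilpotent functions on `Y` -/

section NilpotentPart
variable {k : Type u} [Field k] {p q : MCrv k}

/-- The nilpotent ideal `H⁰(X, 𝓘_{Y_red}/𝓘_Y)` of `Γ(Y, 𝒪)`. -/
def nilIdeal (p : MCrv k) : Ideal p.Y.ring := RingHom.ker p.Y.toRed

/-- `r` as a function on `Y`. -/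
def Nilp.toRing (p : MCrv k) : Nilp p →ₗ[k] p.Y.ring where
  toFun r x := Ideal.Quotient.mk _ (r x).1
  map_add' _ _ := rfl
  map_smul' _ _ := rfl

lemma Nilp.toRing_mem (r : Nilp p) : Nilp.toRing p r ∈ nilIdeal p :=
  funext fun x => Ideal.Quotient.eq_zero_iff_mem.2 (r x).2

lemma Nilp.exists_toRing {n : p.Y.ring} (hn : n ∈ nilIdeal p) : ∃ r : Nilp p, Nilp.toRing p r = n := by
  choose a ha using fun x => Ideal.Quotient.mk_surjective (n x)
  refine ⟨fun x => ⟨a x, ?_⟩, funext ha⟩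
  have := congrFun (RingHom.mem_ker.1 hn) x
  refine Ideal.Quotient.eq_zero_iff_mem.1 (Eq.trans ?_ this)
  change _ = Ideal.Quotient.factorₐ k (p.Y.ideal_le_red x) (n x)
  rw [← ha]
  rfl

/-- The map `r ↦ [(0, r)]`. -/
def Nilp.toH1Lin (p : MCrv k) : Nilp p →ₗ[k] H1 p where
  toFun r := r.toH1
  map_add' r s := by
    refine (congrArg (H1.mk p) (Subtype.ext (Prod.ext (add_zero _).symm (funext fun i => ?_)))).trans
      (map_add (H1.mk p) _ _)
    exact map_add i.loc _ _
  map_smul' a r := by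
    refine (congrArg (H1.mk p) (Subtype.ext (Prod.ext (smul_zero a).symm (funext fun i => ?_)))).trans
      (map_smul (H1.mk p) a _)
    exact map_smul i.loc a _

lemma Nilp.toH1Lin_apply (r : Nilp p) : Nilp.toH1Lin p r = r.toH1 := rfl

lemma Nilp.toRing_eq_zero_iff (r : Nilp p) : Nilp.toRing p r = 0 ↔ ∀ x, (r x).1 ∈ p.Y.ideal x :=
  ⟨fun h x => Ideal.Quotient.eq_zero_iff_mem.1 (congrFun h x),
    fun h => funext fun x => Ideal.Quotient.eq_zero_iff_mem.2 (h x)⟩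

/-- If `(0, r)` is a coboundary, then `dh = 0`, so `h` is algebraic over `k`, and at a point of `Y`
the germ `r` differs from `h` by some `b` in `𝓘_Y`. Then `r - b` is algebraic and lies in the
maximal ideal, hence is zero, and `r = b`. -/
lemma Nilp.toH1_eq_zero_iff [CharZero k] (r : Nilp p) : r.toH1 = 0 ↔ Nilp.toRing p r = 0 := by
  rw [Nilp.toRing_eq_zero_iff]
  constructor
  · intro h x
    obtain ⟨h, h1, h2⟩ := (H1.mk_eq_zero _).1 h
    by_cases hx : p.Y.mult x = 0
    · rw [EffDiv.ideal_of_eq_zero _ _ hx]; trivial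
    let η : GenPt p.C := (p.C.place x).η
    let loc : p.C.stalk x →ₐ[k] p.C.stalk η.1 := (p.C.place x).loc
    obtain ⟨b, hb, e⟩ : ∃ b : p.C.stalk x, b ∈ p.Y.ideal x ∧ loc b = loc (r x).1 - h η :=
      h2 (p.C.place x)
    have h3 : IsAlgebraic k (h η) :=
      isAlgebraic_of_D_eq_zero η.2.isField_stalk (h η) (h1 η).symm
    have hloc : loc ((r x).1 - b) = h η := by
      rw [map_sub, e, sub_sub_cancel]
    have hinj : Function.Injective loc := p.C.spec_injective _
    have h4 : IsAlgebraic k ((r x).1 - b) := by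
      rw [← hloc] at h3
      exact (isAlgebraic_algHom_iff loc hinj).1 h3
    have hr : (r x).1 ∈ IsLocalRing.maximalIdeal (p.C.stalk x) := by
      rw [← p.Y.ideal_red_of_pos x (Nat.pos_of_ne_zero hx)]
      exact (r x).2
    have h5 := eq_zero_of_isAlgebraic_of_mem _ h4 (sub_mem hr (Ideal.pow_le_self hx hb))
    rw [sub_eq_zero.1 h5]
    exact hb
  · intro h
    refine (H1.mk_eq_zero _).2 ⟨0, fun η => (map_zero _).symm, fun i => ?_⟩
    rw [Pi.zero_apply, sub_zero]
    exact ⟨_, h i.x, rfl⟩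

lemma Nilp.exists_toH1 {x : H1 p} (hx : x ∈ fil2 p) : ∃ r : Nilp p, r.toH1 = x := by
  obtain ⟨s, rfl⟩ := fil2_le_range p hx
  choose a ha ha' using fun x => (s (p.C.place x)).2
  refine ⟨fun x => ⟨a x, ha x⟩, congrArg (H1.mk p) (Subtype.ext (Prod.ext rfl (funext fun i => ?_)))⟩
  obtain ⟨x, rfl⟩ : ∃ x, i = p.C.place x := ⟨_, i.eq_place⟩
  exact ha' x

/-- `H⁰(X, 𝓘_{Y_red}/𝓘_Y) ≅ fil² 𝐇¹_dR(X,Y,Z)`. -/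
def fil2Equiv [CharZero k] (p : MCrv k) : (nilIdeal p).restrictScalars k ≃ₗ[k] fil2 p :=
  -- Both spaces are quotients of `Nilp p`, by the same kernel.
  have hr : LinearMap.range (Nilp.toRing p) = (nilIdeal p).restrictScalars k :=
    le_antisymm (fun _ ⟨r, hr⟩ => hr ▸ r.toRing_mem) fun _ hn => Nilp.exists_toRing hn
  have hf : LinearMap.range (Nilp.toH1Lin p) = fil2 p :=
    le_antisymm (fun _ ⟨r, hr⟩ => hr ▸ r.toH1_mem) fun _ hn => Nilp.exists_toH1 hn
  have hk : LinearMap.ker (Nilp.toRing p) = LinearMap.ker (Nilp.toH1Lin p) :=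
    Submodule.ext fun r => r.toH1_eq_zero_iff.symm
  (LinearEquiv.ofEq _ _ hr.symm).trans ((Nilp.toRing p).quotKerEquivRange.symm.trans
    ((Submodule.quotEquivOfEq _ _ hk).trans
      ((Nilp.toH1Lin p).quotKerEquivRange.trans (LinearEquiv.ofEq _ _ hf))))

lemma fil2Equiv_toRing [CharZero k] (r : Nilp p) :
    fil2Equiv p ⟨Nilp.toRing p r, r.toRing_mem⟩ = ⟨r.toH1, r.toH1_mem⟩ := by
  have : (Nilp.toRing p).quotKerEquivRange.symm ⟨Nilp.toRing p r, ⟨r, rfl⟩⟩ =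
      Submodule.Quotient.mk r := by
    rw [LinearEquiv.symm_apply_eq]
    exact Subtype.ext ((Nilp.toRing p).quotKerEquivRange_apply_mk r).symm
  refine Subtype.ext ?_
  simp only [fil2Equiv, LinearEquiv.trans_apply, LinearEquiv.coe_ofEq_apply]
  erw [this]
  rfl

/-- The pull-back of local sections of `𝓘_{Y_red}`. -/
def Nilp.pull (f : MCrv.Hom p q) (r : Nilp q) : Nilp p := fun x =>
  ⟨f.stalkMap x (r (f.f x)).1, f.redY.hY x (Ideal.mem_map_of_mem _ (r (f.f x)).2)⟩

lemma Curve.spec_mem_maximalIdeal {C : Curve k} {x y : C.X} (h : y ⤳ x) (e : y = x)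
    {a : C.stalk x} (ha : a ∈ IsLocalRing.maximalIdeal (C.stalk x)) :
    C.spec h a ∈ IsLocalRing.maximalIdeal (C.stalk y) := by
  subst e
  have : C.spec h a = a := by
    change (C.X.presheaf.stalkSpecializes h).hom a = a
    rw [TopCat.Presheaf.stalkSpecializes_refl]
    rfl
  rwa [this]

/-- The point at issue is a component on which `f` is constant, where the pull-back of cochains is
zero by definition. At a point of `Y` on it, `r` lies in the maximal ideal of the image point, which
is also the image of the generic point `η`. The local homomorphism into the field at `η` kills that
maximal ideal, so the germ pulled back is zero as well. -/
lemma pull_toH1 (f : MCrv.Hom p q) (r : Nilp q) : pull f r.toH1 = (r.pull f).toH1 := by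
  rw [← sub_eq_zero]
  refine (map_sub (H1.mk p) _ _).symm.trans ((H1.mk_eq_zero (p := p) _).2
    ⟨0, fun η => ?_, fun i => ?_⟩)
  · refine Eq.trans ?_ (map_zero _).symm
    refine (sub_zero _).trans ?_
    by_cases h : IsGeneric q.C (f.f η.1)
    · exact (dif_pos h).trans (map_zero _)
    · exact dif_neg h
  · have hs := f.spec_stalkMap i.h (r (f.f i.x)).1
    by_cases h : IsGeneric q.C (f.f i.η.1)
    · have e : (pullCochain f r.cochain).2 i = i.loc (f.stalkMap i.x (r (f.f i.x)).1) :=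
        (dif_pos h).trans hs
      refine (congrArg (· ∈ p.Y.functions i) ?_).mpr (zero_mem _)
      exact (sub_zero _).trans (sub_eq_zero.2 e)
    · have e : (pullCochain f r.cochain).2 i = 0 := dif_neg h
      have e2 : (pullCochain f r.cochain - (r.pull f).cochain).2 i - (0 : ∀ η, FunField η) i.η =
          - i.loc (f.stalkMap i.x (r (f.f i.x)).1) := by
        refine (sub_zero _).trans ?_
        change (pullCochain f r.cochain).2 i - _ = _
        rw [e, zero_sub]
        rfl
      refine (congrArg (· ∈ p.Y.functions i) e2).mpr (neg_mem ?_)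
      by_cases hx : p.Y.mult i.x = 0
      · refine ⟨_, ?_, rfl⟩
        rw [EffDiv.ideal_of_eq_zero _ _ hx]
        trivial
      · have hq : q.Y.mult (f.f i.x) ≠ 0 := fun hq => by
          have := f.hY i.x
          rw [EffDiv.ideal_of_eq_zero _ _ hq, Ideal.map_top, top_le_iff] at this
          exact (IsLocalRing.maximalIdeal.isMaximal (p.C.stalk i.x)).ne_top
            (top_le_iff.1 (this.ge.trans (Ideal.pow_le_self hx)))
        have hr : (r (f.f i.x)).1 ∈ IsLocalRing.maximalIdeal (q.C.stalk (f.f i.x)) := by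
          rw [← q.Y.ideal_red_of_pos _ (Nat.pos_of_ne_zero hq)]
          exact (r (f.f i.x)).2
        have hsp := f.f.base.hom.map_specializes i.h
        have hfx : f.f i.η.1 = f.f i.x := by
          rcases q.C.eq_gen_or_eq hsp with h' | h'
          · exact absurd (show IsGeneric q.C (f.f i.η.1) from
              (congrArg (IsGeneric q.C) h').mpr (q.C.isGeneric_gen _)) h
          · exact h'
        have h1 := q.C.spec_mem_maximalIdeal hsp hfx hr
        have h2 : f.stalkMap i.η.1 (q.C.spec hsp (r (f.f i.x)).1) ∈
            IsLocalRing.maximalIdeal (p.C.stalk i.η.1) := by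
          have hl : IsLocalHom (f.f.stalkMap i.η.1).hom := inferInstance
          have := ((IsLocalRing.local_hom_TFAE (f.f.stalkMap i.η.1).hom).out 0 2).1 hl
          exact this (Ideal.mem_map_of_mem _ h1)
        rw [IsLocalRing.isField_iff_maximalIdeal_eq.1 i.η.2.isField_stalk] at h2
        refine (congrArg (· ∈ p.Y.functions i) ?_).mpr (zero_mem _)
        exact hs.symm.trans h2

end NilpotentPart

/-! ### The exponential of nilpotent elements -/

section Exp
variable {A : Type*} [CommRing A] [Module ℚ A]

lemma exists_exp_eq {x : A} (hx : IsNilpotent x) :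
    ∃ c : A, IsNilpotent.exp x = 1 + x + x ^ 2 * c := by
  obtain ⟨n, hn⟩ := hx
  refine ⟨∑ i ∈ Finset.range n, (((i + 2).factorial : ℕ) : ℚ)⁻¹ • x ^ i, ?_⟩
  have h2 : x ^ (n + 2) = 0 := by rw [pow_add, hn, zero_mul]
  rw [IsNilpotent.exp_eq_sum h2, Finset.sum_range_succ', Finset.sum_range_succ', Finset.mul_sum]
  have : ∀ i, (((i + 1 + 1).factorial : ℕ) : ℚ)⁻¹ • x ^ (i + 1 + 1) =
      x ^ 2 * ((((i + 2).factorial : ℕ) : ℚ)⁻¹ • x ^ i) := fun i => by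
    rw [mul_smul_comm, ← pow_add, add_comm 2 i]
  rw [Finset.sum_congr rfl fun i _ => this i]
  simp
  ring

/-- `exp x - 1` is `x` times the unit `1 + x c`. -/
lemma eq_zero_of_exp_eq_one {x : A} (hx : IsNilpotent x) (h : IsNilpotent.exp x = 1) : x = 0 := by
  obtain ⟨c, hc⟩ := exists_exp_eq hx
  have h1 : IsUnit (1 + x * c) := IsNilpotent.isUnit_one_add ((Commute.all x c).isNilpotent_mul_right hx)
  refine h1.mul_left_eq_zero.1 ?_
  linear_combination h - hc

lemma exp_sub_one_mem {I : Ideal A} {x : A} (hx : IsNilpotent x) (hI : x ∈ I) :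
    IsNilpotent.exp x - 1 ∈ I := by
  obtain ⟨c, hc⟩ := exists_exp_eq hx
  have : IsNilpotent.exp x - 1 = x * (1 + x * c) := by linear_combination hc
  rw [this]
  exact I.mul_mem_right _ hI

/-- Successive approximation: if `y exp(-x) = 1 + z` with `z ∈ I ^ (j + 1)`, then replacing `x` by
`x + z` leaves an error divisible by `z ^ 2`, which lies in `I ^ (j + 2)`. -/
lemma exists_exp_eq_of_sub_one_mem {I : Ideal A} {n : ℕ} (hI : I ^ n = ⊥) {y : A}
    (hy : y - 1 ∈ I) : ∃ x ∈ I, IsNilpotent.exp x = y := by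
  have hn : ∀ x ∈ I, IsNilpotent x := fun x hx => ⟨n, by
    have := Ideal.pow_mem_pow hx n
    rwa [hI] at this⟩
  have key : ∀ j : ℕ, ∃ x ∈ I, y * IsNilpotent.exp (-x) - 1 ∈ I ^ (j + 1) := by
    intro j
    induction j with
    | zero => exact ⟨0, I.zero_mem, by rwa [neg_zero, IsNilpotent.exp_zero, mul_one, zero_add, pow_one]⟩
    | succ j ih =>
      obtain ⟨x, hx, hj⟩ := ih
      set z := y * IsNilpotent.exp (-x) - 1 with hz
      have hzI : z ∈ I := Ideal.pow_le_self (by omega) hj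
      refine ⟨x + z, I.add_mem hx hzI, ?_⟩
      rw [neg_add, IsNilpotent.exp_add_of_commute (Commute.all _ _) (hn x hx).neg (hn z hzI).neg,
        ← mul_assoc]
      obtain ⟨c, hc⟩ := exists_exp_eq (hn z hzI).neg
      have e : y * IsNilpotent.exp (-x) * IsNilpotent.exp (-z) - 1 =
          z * z * (-1 + c + z * c) := by
        have : y * IsNilpotent.exp (-x) = 1 + z := by rw [hz]; ring
        rw [this, hc]; ring
      rw [e, pow_succ]
      exact Ideal.mul_mem_right _ _ (Ideal.mul_mem_mul hj hzI)
  obtain ⟨x, hx, h⟩ := key n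
  refine ⟨x, hx, ?_⟩
  rw [pow_succ, hI, Ideal.bot_mul, Ideal.mem_bot, sub_eq_zero] at h
  calc IsNilpotent.exp x = (y * IsNilpotent.exp (-x)) * IsNilpotent.exp x := by rw [h, one_mul]
    _ = y := by rw [mul_assoc, IsNilpotent.exp_neg_mul_exp_self (hn x hx), mul_one]

lemma exp_of_mul_self_eq_zero {x : A} (hx : x * x = 0) : IsNilpotent.exp x = 1 + x := by
  obtain ⟨c, hc⟩ := exists_exp_eq (x := x) ⟨2, by rw [pow_two, hx]⟩
  rw [hc, pow_two, hx, zero_mul, add_zero]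
end Exp

/-! ### The exponential isomorphism onto the unipotent part of the Jacobian -/

section JacobianExp
variable {k : Type u} [Field k]

/-- The ring of functions is a product over all points of `X`, so one exponent is needed for all
factors; a bound for the multiplicities of `Y` serves. -/
lemma nilIdeal_pow_eq_bot (p : MCrv k) : ∃ n, nilIdeal p ^ n = ⊥ := by
  obtain ⟨n, hn⟩ : ∃ n, ∀ x, p.Y.mult x ≤ n := by
    obtain ⟨n, hn⟩ := (p.Y.finite.image p.Y.mult).bddAbove
    refine ⟨n, fun x => ?_⟩
    by_cases hx : p.Y.mult x = 0
    · omega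
    · exact hn ⟨x, hx, rfl⟩
  refine ⟨n, le_bot_iff.1 fun a ha => funext fun x => ?_⟩
  have h1 : (nilIdeal p).map (Pi.evalRingHom (fun x => p.C.stalk x ⧸ p.Y.ideal x) x) ≤
      (p.Y.red.ideal x).map (Ideal.Quotient.mk (p.Y.ideal x)) := by
    refine Ideal.map_le_of_le_comap fun b hb => ?_
    obtain ⟨r, rfl⟩ := Nilp.exists_toRing hb
    exact Ideal.mem_map_of_mem _ (r x).2
  have h2 := Ideal.mem_map_of_mem (Pi.evalRingHom (fun x => p.C.stalk x ⧸ p.Y.ideal x) x) ha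
  rw [Ideal.map_pow] at h2
  have h3 := Ideal.pow_right_mono h1 n h2
  rw [← Ideal.map_pow] at h3
  have h4 : p.Y.red.ideal x ^ n ≤ p.Y.ideal x := by
    rw [EffDiv.ideal, EffDiv.ideal, ← pow_mul]
    refine Ideal.pow_le_pow_right ?_
    have := hn x
    rcases Nat.eq_zero_or_pos (p.Y.mult x) with h0 | h0
    · omega
    · have : p.Y.red.mult x = 1 := by simp only [EffDiv.red]; omega
      rw [this]; omega
  have h5 := Ideal.map_mono (f := Ideal.Quotient.mk (p.Y.ideal x)) h4 h3
  rwa [Ideal.map_quotient_self, Ideal.mem_bot] at h5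

lemma EffDiv.toRed_surjective {C : Curve k} (D : EffDiv C) : Function.Surjective D.toRed := by
  intro a
  choose b hb using fun x => Ideal.Quotient.mk_surjective (a x)
  exact ⟨fun x => Ideal.Quotient.mk _ (b x), funext hb⟩

variable (R : Type u) [CommRing R] [Algebra k R]

/-- The ideal of `R ⊗ Γ(Y, 𝒪)` which defines `R ⊗ Γ(Y_red, 𝒪)`. -/
def nilIdealTensor (p : MCrv k) : Ideal (R ⊗[k] p.Y.ring) :=
  RingHom.ker (Algebra.TensorProduct.map (AlgHom.id k R) p.Y.toRed)

lemma nilIdealTensor_eq (p : MCrv k) : nilIdealTensor R p =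
    (nilIdeal p).map (Algebra.TensorProduct.includeRight : p.Y.ring →ₐ[k] R ⊗[k] p.Y.ring) :=
  Algebra.TensorProduct.lTensor_ker p.Y.toRed p.Y.toRed_surjective

lemma nilIdealTensor_pow_eq_bot (p : MCrv k) : ∃ n, nilIdealTensor R p ^ n = ⊥ := by
  obtain ⟨n, hn⟩ := nilIdeal_pow_eq_bot p
  exact ⟨n, by rw [nilIdealTensor_eq, ← Ideal.map_pow, hn, Ideal.map_bot]⟩

/-- `H⁰(X, 𝓘_{Y_red}/𝓘_Y)` as a vector space. -/
abbrev NilSpace (p : MCrv k) : Type u := (nilIdeal p).restrictScalars k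

/-- The inclusion `R ⊗ N → R ⊗ Γ(Y, 𝒪)`. -/
def nilIncl (p : MCrv k) : R ⊗[k] NilSpace p →ₗ[k] R ⊗[k] p.Y.ring :=
  ((nilIdeal p).restrictScalars k).subtype.lTensor R

lemma nilIncl_injective (p : MCrv k) : Function.Injective (nilIncl R p) :=
  Module.Flat.lTensor_preserves_injective_linearMap _ (Submodule.subtype_injective _)

lemma range_nilIncl (p : MCrv k) (z : R ⊗[k] p.Y.ring) :
    z ∈ nilIdealTensor R p ↔ ∃ w, nilIncl R p w = z := by
  have := Module.Flat.lTensor_exact R (f := ((nilIdeal p).restrictScalars k).subtype)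
    (g := p.Y.toRed.toLinearMap) (LinearMap.exact_subtype_ker_map _)
  exact this z

variable {R}

lemma isNilpotent_nilIncl (p : MCrv k) (z : R ⊗[k] NilSpace p) : IsNilpotent (nilIncl R p z) := by
  obtain ⟨n, hn⟩ := nilIdealTensor_pow_eq_bot R p
  have := Ideal.pow_mem_pow ((range_nilIncl R p _).2 ⟨z, rfl⟩) n
  exact ⟨n, by rwa [hn] at this⟩

lemma mem_juniPoints_iff (p : MCrv k) (g : (R ⊗[k] p.Y.ring)ˣ) :
    g ∈ juniPoints p R ↔ g.1 - 1 ∈ nilIdealTensor R p := by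
  have : g.1 - 1 ∈ nilIdealTensor R p ↔
      Algebra.TensorProduct.map (AlgHom.id k R) p.Y.toRed g.1 = 1 := by
    rw [nilIdealTensor, RingHom.mem_ker, map_sub, map_one, sub_eq_zero]
  rw [this]
  exact Units.ext_iff

variable [CharZero k]

/-- A `k`-algebra in characteristic zero is a `ℚ`-vector space. -/
abbrev ratModule (k : Type u) [Field k] [CharZero k] (A : Type*) [AddCommGroup A] [Module k A] :
    Module ℚ A := Module.compHom A (algebraMap ℚ k)

/-- The exponential of `z ∈ R ⊗ N`. -/
def nilExp (p : MCrv k) (z : R ⊗[k] NilSpace p) : R ⊗[k] p.Y.ring :=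
  letI := ratModule k (R ⊗[k] p.Y.ring)
  IsNilpotent.exp (nilIncl R p z)

lemma nilExp_add (p : MCrv k) (z w : R ⊗[k] NilSpace p) :
    nilExp p (z + w) = nilExp p z * nilExp p w := by
  let _ := ratModule k (R ⊗[k] p.Y.ring)
  simp only [nilExp, map_add]
  exact IsNilpotent.exp_add_of_commute (Commute.all _ _) (isNilpotent_nilIncl p z)
    (isNilpotent_nilIncl p w)

lemma nilExp_zero (p : MCrv k) : nilExp p (0 : R ⊗[k] NilSpace p) = 1 := by
  let _ := ratModule k (R ⊗[k] p.Y.ring)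
  simp only [nilExp, map_zero]
  exact IsNilpotent.exp_zero

/-- The exponential as a homomorphism from `R ⊗ N` to the units. -/
def nilExpUnit (p : MCrv k) (z : R ⊗[k] NilSpace p) : (R ⊗[k] p.Y.ring)ˣ where
  val := nilExp p z
  inv := nilExp p (-z)
  val_inv := by rw [← nilExp_add, add_neg_cancel, nilExp_zero]
  inv_val := by rw [← nilExp_add, neg_add_cancel, nilExp_zero]

lemma nilExpUnit_mem (p : MCrv k) (z : R ⊗[k] NilSpace p) : nilExpUnit p z ∈ juniPoints p R := by
  let _ := ratModule k (R ⊗[k] p.Y.ring)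
  rw [mem_juniPoints_iff]
  exact exp_sub_one_mem (isNilpotent_nilIncl p z) ((range_nilIncl R p _).2 ⟨z, rfl⟩)

/-- The exponential as a homomorphism to `J(X,Y)_uni(R)`. -/
def nilExpHom (p : MCrv k) (R : Type u) [CommRing R] [Algebra k R] :
    R ⊗[k] NilSpace p →+ Additive (juniPoints p R) where
  toFun z := Additive.ofMul ⟨nilExpUnit p z, nilExpUnit_mem p z⟩
  map_zero' := Subtype.ext (Units.ext (nilExp_zero p))
  map_add' z w := Subtype.ext (Units.ext (nilExp_add p z w))

/-- Flatness over `k` identifies `R ⊗ N` with the nilpotent ideal of `R ⊗ Γ(Y, 𝒪)`, on which the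
exponential is a bijection onto the units congruent to `1`. -/
lemma nilExpHom_bijective (p : MCrv k) : Function.Bijective (nilExpHom p R) := by
  let _ := ratModule k (R ⊗[k] p.Y.ring)
  constructor
  · rw [injective_iff_map_eq_zero]
    intro z hz
    have h : nilExp p z = 1 := congrArg (fun g => (Additive.toMul g).1.1) hz
    refine nilIncl_injective R p ?_
    rw [map_zero]
    exact eq_zero_of_exp_eq_one (isNilpotent_nilIncl p z) h
  · intro g
    obtain ⟨n, hn⟩ := nilIdealTensor_pow_eq_bot R p
    obtain ⟨x, hx, h⟩ := exists_exp_eq_of_sub_one_mem hn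
      ((mem_juniPoints_iff p _).1 (Additive.toMul g).2)
    obtain ⟨z, rfl⟩ := (range_nilIncl R p x).1 hx
    exact ⟨z, Subtype.ext (Units.ext h)⟩

/-- The restriction of `f^*` to the nilpotent ideals. -/
def nilPull {p q : MCrv k} (f : MCrv.Hom p q) : NilSpace q →ₗ[k] NilSpace p :=
  (pullRing f).toLinearMap.restrict fun n hn => by
    obtain ⟨r, rfl⟩ := Nilp.exists_toRing hn
    exact (r.pull f).toRing_mem

/-- The ring `R` and the curve vary simultaneously, so that the same computation gives the
naturality in `R` and the compatibility with `f^*`. -/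
lemma map_nilExp {p q : MCrv k} {R R' : Type u} [CommRing R] [Algebra k R] [CommRing R']
    [Algebra k R'] (φ : R →ₐ[k] R') (ψ : q.Y.ring →ₐ[k] p.Y.ring)
    (ψ' : NilSpace q →ₗ[k] NilSpace p) (h : ∀ n, ψ n.1 = (ψ' n).1) (z : R ⊗[k] NilSpace q) :
    Algebra.TensorProduct.map φ ψ (nilExp q z) =
      nilExp p (TensorProduct.map φ.toLinearMap ψ' z) := by
  let _ := ratModule k (R ⊗[k] q.Y.ring)
  let _ := ratModule k (R' ⊗[k] p.Y.ring)
  have e : Algebra.TensorProduct.map φ ψ (nilIncl R q z) =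
      nilIncl R' p (TensorProduct.map φ.toLinearMap ψ' z) := by
    induction z with
    | zero => simp only [map_zero]
    | add x y hx hy => simp only [map_add, hx, hy]
    | tmul r n => exact congrArg (φ r ⊗ₜ[k] ·) (h n)
  refine (IsNilpotent.map_exp (isNilpotent_nilIncl q z) (Algebra.TensorProduct.map φ ψ)).trans ?_
  exact congrArg IsNilpotent.exp e

/-- The exponential isomorphism `N ≅ J(X,Y)_uni`. -/
def juniIso (p : MCrv k) : vectorGroup (k := k) (NilSpace p) ≅ juni p :=
  groupFunctorIso (G := vectorGroup (k := k) (NilSpace p)) (H := juni p)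
    (fun R => nilExpHom p R) (fun _ => nilExpHom_bijective p) fun _ _ f z =>
      Subtype.ext (Units.ext (map_nilExp f.hom (AlgHom.id k _) LinearMap.id (fun _ => rfl) z).symm)

lemma juniIso_natural {p q : MCrv k} (f : MCrv.Hom p q) :
    vectorGroupMap (nilPull f) ≫ (juniIso p).hom = (juniIso q).hom ≫ juniMap f := by
  ext R z
  exact Subtype.ext (Units.ext (map_nilExp (AlgHom.id k R) (pullRing f) (nilPull f)
    (fun _ => rfl) z).symm)

/-- As `ε² = 0`, the exponential series stops: `exp(ε r) = 1 + ε r`. -/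
lemma juniIso_eps (p : MCrv k) (r : Nilp p) :
    ((juniIso p).hom.app (.of k (DualNumber k))).hom
      (DualNumber.eps ⊗ₜ[k] (⟨Nilp.toRing p r, r.toRing_mem⟩ : NilSpace p)) = r.toLie.1 := by
  let _ := ratModule k (DualNumber k ⊗[k] p.Y.ring)
  refine Subtype.ext (Units.ext (exp_of_mul_self_eq_zero
    (x := (DualNumber.eps : DualNumber k) ⊗ₜ[k] Nilp.toRing p r) ?_))
  rw [Algebra.TensorProduct.tmul_mul_tmul, DualNumber.eps_mul_eps, zero_tmul]
end JacobianExp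

/-! ### The projective line as a smooth proper curve -/

section ProjectiveLine

/-- One generator and no relations: the Jacobian is an empty determinant. -/
lemma isStandardSmooth_polynomial (k : Type u) [CommRing k] :
    Algebra.IsStandardSmoothOfRelativeDimension 1 k (Polynomial k) := by
  classical
  let e := MvPolynomial.uniqueAlgEquiv k Unit
  let P : Algebra.PreSubmersivePresentation k (Polynomial k) Unit PEmpty.{1} :=
  { toGenerators := .ofSurjective (fun _ => Polynomial.X) e.surjective
    relation := PEmpty.elim
    span_range_relation_eq_ker := by
      rw [Set.range_eq_empty, Ideal.span_empty]
      exact ((RingHom.injective_iff_ker_eq_bot e.toRingHom).1 e.injective).symm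
    map := PEmpty.elim
    map_inj := fun a => a.elim }
  let P' : Algebra.SubmersivePresentation k (Polynomial k) Unit PEmpty.{1} :=
  { __ := P
    jacobian_isUnit := by
      rw [Algebra.PreSubmersivePresentation.jacobian_eq_jacobiMatrix_det, Matrix.det_isEmpty,
        map_one]
      exact isUnit_one }
  refine P'.isStandardSmoothOfRelativeDimension ?_
  simp [Algebra.Presentation.dimension]

lemma smooth_specMap_C (k : Type u) [CommRing k] :
    SmoothOfRelativeDimension 1 (Spec.map (CommRingCat.ofHom (Polynomial.C (R := k)))) := by
  rw [HasRingHomProperty.Spec_iff (P := @SmoothOfRelativeDimension 1)]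
  refine RingHom.locally_of RingHom.isStandardSmoothOfRelativeDimension_respectsIso _ ?_
  have := isStandardSmooth_polynomial k
  exact RingHom.isStandardSmoothOfRelativeDimension_algebraMap (n := 1) (R := k) (S := Polynomial k) |>.2 this

variable (k : Type u) [Field k]

/-- The homogeneous coordinate ring of the projective line. -/
abbrev projGrading : ℕ → Submodule k (MvPolynomial (Fin 2) k) :=
  MvPolynomial.homogeneousSubmodule (Fin 2) k

instance : GradedAlgebra (projGrading k) := MvPolynomial.gradedAlgebra

variable {k}

lemma X_mem_projGrading (i : Fin 2) : MvPolynomial.X i ∈ projGrading k 1 :=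
  MvPolynomial.isHomogeneous_X k i

/-- The constants in degree zero. -/
def projConst (k : Type u) [Field k] : k →+* projGrading k 0 where
  toFun c := ⟨MvPolynomial.C c, MvPolynomial.isHomogeneous_C (Fin 2) c⟩
  map_one' := Subtype.ext (map_one _)
  map_mul' _ _ := Subtype.ext (map_mul _ _ _)
  map_zero' := Subtype.ext (map_zero _)
  map_add' _ _ := Subtype.ext (map_add _ _ _)

lemma projConst_bijective : Function.Bijective (projConst k) := by
  constructor
  · intro a b h
    exact MvPolynomial.C_injective (Fin 2) k (congrArg Subtype.val h)
  · rintro ⟨f, hf⟩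
    have hf : f.IsHomogeneous 0 := hf
    exact ⟨f.coeff 0, Subtype.ext (MvPolynomial.totalDegree_eq_zero_iff_eq_C.1
      (Nat.le_zero.1 hf.totalDegree_le)).symm⟩

/-- The degree zero part of the localization at `x_i`. -/
abbrev ProjAway (k : Type u) [Field k] (i : Fin 2) : Type u :=
  HomogeneousLocalization.Away (projGrading k) (MvPolynomial.X i : MvPolynomial (Fin 2) k)

/-- The other index. -/
abbrev other (i : Fin 2) : Fin 2 := 1 - i

/-- The coordinate `x_{1-i}/x_i`. -/
def projCoord (i : Fin 2) : ProjAway k i :=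
  HomogeneousLocalization.Away.mk (projGrading k) (X_mem_projGrading i) 1
    (MvPolynomial.X (other i)) (X_mem_projGrading (other i))

/-- The map `k[t] → k[x_0,x_1]_{(x_i)}`. -/
def polyToAway (i : Fin 2) : Polynomial k →+* ProjAway k i :=
  Polynomial.eval₂RingHom ((HomogeneousLocalization.fromZeroRingHom (projGrading k)
    (Submonoid.powers (MvPolynomial.X i))).comp (projConst k)) (projCoord i)

/-- Dehomogenization. -/
def dehom (k : Type u) [Field k] (i : Fin 2) : MvPolynomial (Fin 2) k →ₐ[k] Polynomial k :=
  MvPolynomial.aeval fun l => if l = i then 1 else Polynomial.X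

/-- The inverse of `polyToAway`. -/
def awayToPoly (k : Type u) [Field k] (i : Fin 2) : ProjAway k i →+* Polynomial k :=
  (IsLocalization.Away.lift (S := Localization.Away (MvPolynomial.X i : MvPolynomial (Fin 2) k))
    (MvPolynomial.X i) (g := (dehom k i).toRingHom) (by simp [dehom])).comp
    (algebraMap (ProjAway k i) (Localization.Away (MvPolynomial.X i : MvPolynomial (Fin 2) k)))

lemma awayToPoly_mk (i : Fin 2) (n : ℕ) (a : MvPolynomial (Fin 2) k)
    (ha : a ∈ projGrading k (n • 1)) : awayToPoly k i
      (HomogeneousLocalization.Away.mk (projGrading k) (X_mem_projGrading i) n a ha) =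
        dehom k i a := by
  let S := Localization.Away (MvPolynomial.X i : MvPolynomial (Fin 2) k)
  have h : (HomogeneousLocalization.Away.mk (projGrading k) (X_mem_projGrading i) n a ha).val *
      algebraMap (MvPolynomial (Fin 2) k) S (MvPolynomial.X i ^ n) =
        algebraMap (MvPolynomial (Fin 2) k) S a := by
    rw [HomogeneousLocalization.Away.val_mk, Localization.mk_eq_mk']
    exact IsLocalization.mk'_spec S a
      (⟨MvPolynomial.X i ^ n, n, rfl⟩ : Submonoid.powers (MvPolynomial.X i))
  have hu : IsUnit ((dehom k i).toRingHom (MvPolynomial.X i)) := by simp [dehom]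
  have h' := congrArg (IsLocalization.Away.lift (S := S) (MvPolynomial.X i : MvPolynomial (Fin 2) k)
    (g := (dehom k i).toRingHom) hu) h
  rw [map_mul, IsLocalization.Away.lift_eq, IsLocalization.Away.lift_eq] at h'
  have h1 : (dehom k i).toRingHom (MvPolynomial.X i ^ n) = 1 := by simp [dehom]
  rw [h1, mul_one] at h'
  exact h'

lemma awayToPoly_const (i : Fin 2) (c : k) : awayToPoly k i
    (HomogeneousLocalization.fromZeroRingHom (projGrading k) (Submonoid.powers (MvPolynomial.X i))
      (projConst k c)) = Polynomial.C c := by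
  have hu : IsUnit ((dehom k i).toRingHom (MvPolynomial.X i)) := by simp [dehom]
  have h : (HomogeneousLocalization.fromZeroRingHom (projGrading k)
      (Submonoid.powers (MvPolynomial.X i)) (projConst k c)).val =
      algebraMap _ (Localization.Away (MvPolynomial.X i : MvPolynomial (Fin 2) k))
        (MvPolynomial.C c) := Localization.mk_one_eq_algebraMap _
  refine (congrArg (IsLocalization.Away.lift (MvPolynomial.X i) hu) h).trans ?_
  rw [IsLocalization.Away.lift_eq]
  simp [dehom]

lemma other_ne (i : Fin 2) : other i ≠ i := by revert i; decide

lemma awayToPoly_polyToAway (i : Fin 2) (f : Polynomial k) :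
    awayToPoly k i (polyToAway i f) = f := by
  have : (awayToPoly k i).comp (polyToAway i) = RingHom.id _ := by
    refine Polynomial.ringHom_ext (fun a => ?_) ?_
    · refine (congrArg (awayToPoly k i) (Polynomial.eval₂_C _ _)).trans ?_
      exact awayToPoly_const i a
    · have : polyToAway i (Polynomial.X : Polynomial k) = projCoord i := Polynomial.eval₂_X _ _
      rw [RingHom.comp_apply, this, projCoord, awayToPoly_mk]
      simp [dehom, other_ne i]
  exact congr($this f)

/-- In a form of fixed degree in two variables the exponent of one variable determines the monomial,
so dehomogenization merges no terms. -/
lemma awayToPoly_injective (i : Fin 2) : Function.Injective (awayToPoly k i) := by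
  rw [injective_iff_map_eq_zero]
  intro z hz
  obtain ⟨n, a, ha, rfl⟩ := HomogeneousLocalization.Away.mk_surjective (projGrading k)
    (X_mem_projGrading i) z
  rw [awayToPoly_mk] at hz
  have ha : a.IsHomogeneous n := by simpa using ha
  suffices h : a = 0 by
    subst h
    refine HomogeneousLocalization.val_injective _ ?_
    rw [HomogeneousLocalization.Away.val_mk, HomogeneousLocalization.val_zero, Localization.mk_zero]
  have hd : ∀ m : Fin 2 →₀ ℕ, m.degree = m i + m (other i) := fun m => by
    rw [Finsupp.degree_eq_sum, Fin.sum_univ_two]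
    clear hz
    revert i
    refine Fin.forall_fin_two.2 ⟨rfl, add_comm _ _⟩
  have hsum : dehom k i a = ∑ m ∈ a.support, Polynomial.monomial (m (other i)) (a.coeff m) := by
    conv_lhs => rw [a.as_sum, map_sum]
    refine Finset.sum_congr rfl fun m _ => ?_
    rw [dehom, MvPolynomial.aeval_monomial, ← Polynomial.C_mul_X_pow_eq_monomial]
    congr 1
    rw [Finsupp.prod_fintype _ _ (by simp), Fin.prod_univ_two]
    clear hz hd
    revert i
    refine Fin.forall_fin_two.2 ⟨?_, ?_⟩ <;> simp [other]
  by_contra h0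
  obtain ⟨m, hm⟩ := MvPolynomial.support_nonempty.2 h0
  have hc := congrArg (fun f => Polynomial.coeff f (m (other i))) (hsum.symm.trans hz)
  simp only [Polynomial.finsetSum_coeff, Polynomial.coeff_monomial, Polynomial.coeff_zero] at hc
  rw [Finset.sum_eq_single m] at hc
  · rw [if_pos rfl] at hc
    exact MvPolynomial.mem_support_iff.1 hm hc
  · intro m' hm' hne
    refine if_neg fun he => hne ?_
    have h1 := hd m
    have h2 := hd m'
    have e1 : m.degree = n := by
      rw [Finsupp.degree_eq_weight_one]
      exact ha (MvPolynomial.mem_support_iff.1 hm)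
    have e2 : m'.degree = n := by
      rw [Finsupp.degree_eq_weight_one]
      exact ha (MvPolynomial.mem_support_iff.1 hm')
    ext l
    have hl : l = i ∨ l = other i := by
      clear * -
      revert i l; decide
    rcases hl with rfl | rfl
    · omega
    · omega
  · intro h; exact absurd hm h

/-- The ring of functions on the chart `x_i ≠ 0`. -/
def awayEquiv (k : Type u) [Field k] (i : Fin 2) : ProjAway k i ≃+* Polynomial k :=
  RingEquiv.ofBijective (awayToPoly k i)
    ⟨awayToPoly_injective i, fun f => ⟨polyToAway i f, awayToPoly_polyToAway i f⟩⟩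

/-- The projective line. -/
abbrev projLine (k : Type u) [Field k] : Scheme.{u} := Proj (projGrading k)

/-- The structure morphism of the projective line. -/
def projLineStr (k : Type u) [Field k] : projLine k ⟶ Spec (.of k) :=
  Proj.toSpecZero (projGrading k) ≫ Spec.map (CommRingCat.ofHom (projConst k))

/-- The affine charts of the projective line. -/
def projChart (k : Type u) [Field k] (i : Fin 2) : Spec (.of (Polynomial k)) ⟶ projLine k :=
  Spec.map (CommRingCat.ofHom (awayEquiv k i : ProjAway k i →+* Polynomial k)) ≫
    Proj.awayι (projGrading k) (MvPolynomial.X i) (X_mem_projGrading i) one_pos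

instance (i : Fin 2) : IsIso (Spec.map (CommRingCat.ofHom
    (awayEquiv k i : ProjAway k i →+* Polynomial k))) :=
  inferInstanceAs (IsIso (Spec.map (awayEquiv k i).toCommRingCatIso.hom))

instance (i : Fin 2) : IsOpenImmersion (projChart k i) := by
  unfold projChart; infer_instance

lemma projChart_str (i : Fin 2) :
    projChart k i ≫ projLineStr k = Spec.map (CommRingCat.ofHom Polynomial.C) := by
  rw [projChart, projLineStr, Category.assoc, Proj.awayι_toSpecZero_assoc, ← Spec.map_comp,
    ← Spec.map_comp]
  congr 1
  exact CommRingCat.hom_ext (RingHom.ext fun c => awayToPoly_const i c)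

lemma iSup_opensRange_projChart : ⨆ i, (projChart k i).opensRange = ⊤ := by
  have := Proj.iSup_basicOpen_eq_top' (projGrading k) (fun i => MvPolynomial.X i)
    (fun i => ⟨1, X_mem_projGrading i⟩) (by
      rw [eq_top_iff]
      rintro f -
      induction f using MvPolynomial.induction_on with
      | C a => exact Subalgebra.algebraMap_mem _ (projConst k a)
      | add p q hp hq => exact add_mem hp hq
      | mul_X p i hp => exact mul_mem hp (Algebra.subset_adjoin ⟨i, rfl⟩))
  rw [← this]
  congr 1
  funext i
  exact (Scheme.Hom.opensRange_comp_of_isIso _ _).trans (Proj.opensRange_awayι _ _ _ _)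

lemma projLine_finiteType : Algebra.FiniteType (projGrading k 0) (MvPolynomial (Fin 2) k) := by
  classical
  refine ⟨⟨Finset.univ.image MvPolynomial.X, ?_⟩⟩
  rw [eq_top_iff]
  rintro f -
  induction f using MvPolynomial.induction_on with
  | C a => exact Subalgebra.algebraMap_mem _ (projConst k a)
  | add p q hp hq => exact add_mem hp hq
  | mul_X p i hp => exact mul_mem hp (Algebra.subset_adjoin (by simp))

instance : IsProper (projLineStr k) := by
  have := projLine_finiteType (k := k)
  have : IsIso (Spec.map (CommRingCat.ofHom (projConst k))) :=
    inferInstanceAs (IsIso (Spec.map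
      (RingEquiv.ofBijective (projConst k) projConst_bijective).toCommRingCatIso.hom))
  unfold projLineStr
  infer_instance

instance : SmoothOfRelativeDimension 1 (projLineStr k) := by
  have : IsZariskiLocalAtSource (@SmoothOfRelativeDimension.{u} 1) :=
    HasRingHomProperty.instIsZariskiLocalAtSource
  rw [IsZariskiLocalAtSource.iff_of_iSup_eq_top (P := @SmoothOfRelativeDimension 1) _
    (iSup_opensRange_projChart (k := k))]
  intro i
  have e : (projChart k i).opensRange.ι ≫ projLineStr k =
      (projChart k i).isoOpensRange.inv ≫ Spec.map (CommRingCat.ofHom Polynomial.C) := by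
    rw [← projChart_str i, Scheme.Hom.isoOpensRange_inv_comp_assoc]
  rw [e]
  have := smooth_specMap_C k
  exact smoothOfRelativeDimension_comp (n := 0) (m := 1) _ _

/-- The projective line as a curve. -/
def projCurve (k : Type u) [Field k] : Curve k where
  X := projLine k
  str := projLineStr k
  smooth := inferInstance
  proper := inferInstance

end ProjectiveLine

/-! ### Extension of morphisms from a curve to a proper scheme -/

section Extension
open Limits
variable {k : Type u} [Field k] (C : Curve k)

instance : IsReduced C.X := by
  have : ∀ x : C.X, _root_.IsReduced (C.X.presheaf.stalk x) := fun x =>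
    inferInstanceAs (_root_.IsReduced (C.stalk x))
  exact isReduced_of_isReduced_stalk C.X

instance : IsLocallyNoetherian C.X := by
  have := C.proper
  exact LocallyOfFiniteType.isLocallyNoetherian C.str

lemma IsGeneric.exists_lift {C : Curve k} {W : Scheme.{u}} (ι : W ⟶ C.X) [IsOpenImmersion ι]
    (w : W) : ∃ l : Spec (C.X.presheaf.stalk (ι w)) ⟶ W,
      l ≫ ι = C.X.fromSpecStalk (ι w) ∧ l (IsLocalRing.closedPoint _) = w := by
  have h : Set.range (C.X.fromSpecStalk (ι w)) ⊆ Set.range ι := by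
    rw [Scheme.range_fromSpecStalk]
    intro y hy
    exact Specializes.mem_open hy ι.opensRange.2 ⟨w, rfl⟩
  refine ⟨IsOpenImmersion.lift ι (C.X.fromSpecStalk (ι w)) h, IsOpenImmersion.lift_fac _ _ _,
    ι.isOpenEmbedding.injective ?_⟩
  exact congr($(IsOpenImmersion.lift_fac ι (C.X.fromSpecStalk (ι w)) h)
    (IsLocalRing.closedPoint (C.X.presheaf.stalk (ι w)))).trans Scheme.fromSpecStalk_closedPoint

/-- The equalizer contains the generic points, so it is dominant in `W`; and `W` is reduced and `P`
separated. -/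
lemma Curve.hom_ext_of_generic {W P S : Scheme.{u}} (ι : W ⟶ C.X) [IsOpenImmersion ι]
    {f g : W ⟶ P} (s : P ⟶ S) [IsSeparated s] (hs : f ≫ s = g ≫ s)
    (h : ∀ (η : GenPt C) (l : Spec (C.X.presheaf.stalk η.1) ⟶ W),
      l ≫ ι = C.X.fromSpecStalk η.1 → l ≫ f = l ≫ g) : f = g := by
  have : IsReduced W := isReduced_of_isOpenImmersion ι
  suffices IsDominant (equalizer.ι f g) from
    ext_of_isDominant_of_isSeparated s hs (equalizer.ι f g) (equalizer.condition _ _)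
  refine ⟨fun w => ?_⟩
  have hw : C.gen (ι w) ∈ ι.opensRange :=
    (C.gen_specializes (ι w)).mem_open ι.opensRange.2 ⟨w, rfl⟩
  obtain ⟨w', hw'⟩ := hw
  have hg : IsGeneric C (ι w') := hw' ▸ C.isGeneric_gen (ι w)
  obtain ⟨l, hl, hl'⟩ := IsGeneric.exists_lift ι w'
  have hsp : w' ⤳ w := by
    rw [← ι.isOpenEmbedding.isInducing.specializes_iff]
    exact hw' ▸ C.gen_specializes (ι w)
  refine closure_mono (s := {w'}) ?_ (specializes_iff_mem_closure.1 hsp)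
  rintro _ ⟨⟩
  refine ⟨equalizer.lift l (h ⟨_, hg⟩ l hl) (IsLocalRing.closedPoint _), ?_⟩
  exact congr($(equalizer.lift_ι l (h ⟨_, hg⟩ l hl))
    (IsLocalRing.closedPoint (C.X.presheaf.stalk (ι w')))).trans hl'

lemma Curve.isFractionRing {η x : C.X} (hη : IsGeneric C η) (h : η ⤳ x) :
    let _ : Algebra (C.stalk x) (C.stalk η) := (C.spec h).toRingHom.toAlgebra
    IsFractionRing (C.stalk x) (C.stalk η) := by
  intro _
  have hinj := C.spec_injective h
  refine ⟨fun a => ?_, fun z => ?_, fun {a b} e => ⟨1, by rw [hinj e]⟩⟩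
  · obtain ⟨b, hb⟩ := hη.isField_stalk.mul_inv_cancel
      (fun h0 => nonZeroDivisors.ne_zero a.2 (hinj (h0.trans (map_zero (C.spec h)).symm)) :
        C.spec h a.1 ≠ 0)
    exact IsUnit.of_mul_eq_one _ hb
  · obtain ⟨U, hU, hx, -⟩ := exists_isAffineOpen_mem_and_subset (U := ⊤) (x := x) trivial
    have hηU : η ∈ U := h.mem_open U.2 hx
    let _ : Algebra Γ(C.X, U) (C.stalk x) := C.X.presheaf.algebra_section_stalk ⟨x, hx⟩
    let _ : Algebra Γ(C.X, U) (C.stalk η) := C.X.presheaf.algebra_section_stalk ⟨η, hηU⟩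
    have h2 := hU.isLocalization_stalk ⟨η, hηU⟩
    have hs : ∀ s : Γ(C.X, U), C.spec h (algebraMap _ _ s) = algebraMap _ _ s := fun s =>
      congr($(C.X.presheaf.germ_stalkSpecializes (U := U) hx h).hom s)
    obtain ⟨⟨s, t⟩, e⟩ := IsLocalization.surj (hU.primeIdealOf ⟨η, hηU⟩).asIdeal.primeCompl z
    have ht : algebraMap Γ(C.X, U) (C.stalk x) t ≠ 0 := fun h0 => by
      have := IsLocalization.map_units (C.stalk η) t
      rw [← hs, h0, map_zero] at this
      exact not_isUnit_zero this
    refine ⟨⟨algebraMap _ _ s, ⟨_, mem_nonZeroDivisors_of_ne_zero ht⟩⟩, ?_⟩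
    exact (congrArg (z * ·) (hs t)).trans (e.trans (hs s).symm)

/-- The valuative criterion: the stalk at `x` is a valuation ring with the function field as its
fraction field. -/
lemma Curve.exists_extension {P : Scheme.{u}} (s : P ⟶ Spec (.of k)) [IsProper s] {η x : C.X}
    (hη : IsGeneric C η) (h : η ⤳ x) (ψ : Spec (C.X.presheaf.stalk η) ⟶ P)
    (hψ : ψ ≫ s = C.X.fromSpecStalk η ≫ C.str) :
    ∃ φ : Spec (C.X.presheaf.stalk x) ⟶ P, φ ≫ s = C.X.fromSpecStalk x ≫ C.str ∧
      Spec.map (C.X.presheaf.stalkSpecializes h) ≫ φ = ψ := by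
  have hs : ValuativeCriterion.Existence s := by
    have : UniversallyClosed s := inferInstance
    rw [UniversallyClosed.eq_valuativeCriterion] at this
    exact this.1
  have hK := hη.isField_stalk
  let _ : Field (C.stalk η) := hK.toField
  let _ : Algebra (C.stalk x) (C.stalk η) := (C.spec h).toRingHom.toAlgebra
  have hfr : IsFractionRing (C.stalk x) (C.stalk η) := C.isFractionRing hη h
  have hv : ValuationRing (C.stalk x) := inferInstance
  have w : CommSq ψ (Spec.map (CommRingCat.ofHom (algebraMap (C.stalk x) (C.stalk η)))) s
      (C.X.fromSpecStalk x ≫ C.str) := by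
    refine ⟨hψ.trans ?_⟩
    rw [← Scheme.SpecMap_stalkSpecializes_fromSpecStalk h, Category.assoc]
    rfl
  obtain ⟨l, hl₁, hl₂⟩ := (hs { R := C.stalk x, K := C.stalk η, commSq := w, .. }).exists_lift
  exact ⟨l, hl₂, hl₁⟩

/-- The extension over the local ring at `x` spreads out to a neighbourhood. Removing the finitely
many components not through `x` leaves a single generic point at which the prescribed value must be
checked. -/
lemma Curve.exists_local_extension {P : Scheme.{u}} (s : P ⟶ Spec (.of k)) [IsProper s]
    (ψ : ∀ η : GenPt C, Spec (C.X.presheaf.stalk η.1) ⟶ P)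
    (hψ : ∀ η, ψ η ≫ s = C.X.fromSpecStalk η.1 ≫ C.str) (x : C.X) :
    ∃ (U : C.X.Opens) (_ : x ∈ U) (f : U.toScheme ⟶ P), f ≫ s = U.ι ≫ C.str ∧
      ∀ (η : GenPt C) (l : Spec (C.X.presheaf.stalk η.1) ⟶ U.toScheme),
        l ≫ U.ι = C.X.fromSpecStalk η.1 → l ≫ f = ψ η := by
  obtain ⟨φ, hφ, hφψ⟩ := C.exists_extension s (C.isGeneric_gen x) (C.gen_specializes x)
    (ψ ⟨_, C.isGeneric_gen x⟩) (hψ _)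
  obtain ⟨U, hxU, f, hf, hfs⟩ := spread_out_of_isGermInjective' C.str s φ hφ
  let Z : Set C.X := ⋃ η : {η : GenPt C // η.1 ≠ C.gen x}, closure {η.1.1}
  have hZ : IsClosed Z := isClosed_iUnion_of_finite fun _ => isClosed_closure
  have hxZ : x ∉ Z := by
    intro h
    obtain ⟨η, hη⟩ := Set.mem_iUnion.1 h
    exact η.2 (η.1.2.eq_gen (specializes_iff_mem_closure.2 hη))
  let V : C.X.Opens := U ⊓ ⟨Zᶜ, hZ.isOpen_compl⟩
  refine ⟨V, ⟨hxU, hxZ⟩, C.X.homOfLE (inf_le_left : V ≤ U) ≫ f, ?_, ?_⟩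
  · rw [Category.assoc, hfs, Scheme.homOfLE_ι_assoc]
  rintro ⟨η, hη⟩ l hl
  have hηV : η ∈ V := by
    have : (l ≫ V.ι) (IsLocalRing.closedPoint (C.X.presheaf.stalk η)) = η :=
      congr($hl (IsLocalRing.closedPoint (C.X.presheaf.stalk η))).trans
        Scheme.fromSpecStalk_closedPoint
    refine (congrArg (· ∈ V) this).mp ?_
    exact (l (IsLocalRing.closedPoint (C.X.presheaf.stalk η))).2
  obtain rfl : η = C.gen x := by
    by_contra hne
    exact hηV.2 (Set.mem_iUnion.2 ⟨⟨⟨η, hη⟩, hne⟩, subset_closure rfl⟩)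
  have e : l ≫ C.X.homOfLE (inf_le_left : V ≤ U) =
      Spec.map (C.X.presheaf.stalkSpecializes (C.gen_specializes x)) ≫
        U.fromSpecStalkOfMem x hxU := by
    rw [← cancel_mono U.ι, Category.assoc, Category.assoc, Scheme.homOfLE_ι,
      Scheme.Opens.fromSpecStalkOfMem_ι, Scheme.SpecMap_stalkSpecializes_fromSpecStalk]
    exact hl
  rw [reassoc_of% e, ← hf]
  exact hφψ

/-- Morphisms from a curve to a proper scheme can be prescribed at the generic points. -/
lemma Curve.exists_hom_of_generic {P : Scheme.{u}} (s : P ⟶ Spec (.of k)) [IsProper s]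
    (ψ : ∀ η : GenPt C, Spec (C.X.presheaf.stalk η.1) ⟶ P)
    (hψ : ∀ η, ψ η ≫ s = C.X.fromSpecStalk η.1 ≫ C.str) :
    ∃ F : C.X ⟶ P, F ≫ s = C.str ∧ ∀ η : GenPt C, C.X.fromSpecStalk η.1 ≫ F = ψ η := by
  choose U hU f hf hψf using C.exists_local_extension s ψ hψ
  have hcov : TopologicalSpace.IsOpenCover U :=
    .mk (eq_top_iff.2 fun x _ => TopologicalSpace.Opens.mem_iSup.2 ⟨x, hU x⟩)
  let 𝒰 := C.X.openCoverOfIsOpenCover U hcov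
  -- On overlaps the local extensions agree at the generic points, hence everywhere.
  have hglue : ∀ x y : C.X,
      pullback.fst (U x).ι (U y).ι ≫ f x = pullback.snd (U x).ι (U y).ι ≫ f y := by
    intro x y
    refine C.hom_ext_of_generic (pullback.fst (U x).ι (U y).ι ≫ (U x).ι) s ?_ ?_
    · rw [Category.assoc, Category.assoc, hf, hf, pullback.condition_assoc]
    · intro η l hl
      rw [← Category.assoc, ← Category.assoc, hψf x η _ ((Category.assoc _ _ _).trans hl),
        hψf y η]
      rw [Category.assoc, ← pullback.condition, hl]
  let F : C.X ⟶ P := 𝒰.glueMorphisms f hglue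
  have hF : ∀ x, (U x).ι ≫ F = f x := fun x => 𝒰.ι_glueMorphisms f _ x
  have hFs : ∀ x, (U x).ι ≫ F ≫ s = (U x).ι ≫ C.str := fun x => by
    rw [reassoc_of% (hF x), hf]
  refine ⟨F, 𝒰.hom_ext _ _ hFs, fun η => ?_⟩
  · have h1 := (U η.1).fromSpecStalkOfMem_ι η.1 (hU η.1)
    rw [← hψf η.1 η _ h1, ← hF, ← Category.assoc, h1]

/-- A morphism from the spectrum of a local ring of a curve to a proper scheme extends. -/
lemma Curve.exists_hom_of_stalk {P : Scheme.{u}} (s : P ⟶ Spec (.of k)) [IsProper s]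
    (c : Spec (.of k) ⟶ P) (hc : c ≫ s = 𝟙 _) (y : C.X)
    (φ : Spec (C.X.presheaf.stalk y) ⟶ P) (hφ : φ ≫ s = C.X.fromSpecStalk y ≫ C.str) :
    ∃ F : C.X ⟶ P, F ≫ s = C.str ∧ C.X.fromSpecStalk y ≫ F = φ := by
  classical
  -- On the components which do not pass through `y` the constant morphism `c` is used.
  let ψ : ∀ η : GenPt C, Spec (C.X.presheaf.stalk η.1) ⟶ P := fun η =>
    if h : η.1 ⤳ y then Spec.map (C.X.presheaf.stalkSpecializes h) ≫ φ
    else C.X.fromSpecStalk η.1 ≫ C.str ≫ c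
  obtain ⟨F, hF, hFη⟩ := C.exists_hom_of_generic s ψ (by
    intro η
    by_cases h : η.1 ⤳ y
    · simp only [ψ, dif_pos h, Category.assoc, hφ]
      rw [← Category.assoc, Scheme.SpecMap_stalkSpecializes_fromSpecStalk]
    · simp only [ψ, dif_neg h, Category.assoc, hc, Category.comp_id])
  refine ⟨F, hF, ?_⟩
  have hd : IsDominant (Spec.map (C.X.presheaf.stalkSpecializes (C.gen_specializes y))) := by
    constructor
    refine (PrimeSpectrum.denseRange_comap_iff_ker_le_nilRadical _).2 ?_
    intro a ha
    have : a = 0 := C.spec_injective (C.gen_specializes y)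
      (ha.trans (map_zero (C.spec (C.gen_specializes y))).symm)
    rw [this]
    exact zero_mem _
  have hr : IsReduced (Spec (C.X.presheaf.stalk y)) := by
    have : _root_.IsReduced (C.X.presheaf.stalk y) :=
      inferInstanceAs (_root_.IsReduced (C.stalk y))
    infer_instance
  refine ext_of_isDominant_of_isSeparated s (by rw [Category.assoc, hF, hφ])
    (Spec.map (C.X.presheaf.stalkSpecializes (C.gen_specializes y))) ?_
  rw [← Category.assoc, Scheme.SpecMap_stalkSpecializes_fromSpecStalk]
  exact (hFη ⟨_, C.isGeneric_gen y⟩).trans (dif_pos (C.gen_specializes y))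

end Extension

/-! ### Germs of functions on an affine chart -/

section ChartSections

/-- The functions on an affine chart. -/
def chartSec {R : CommRingCat.{u}} {X : Scheme.{u}} (j : Spec R ⟶ X) [IsOpenImmersion j] :
    R ⟶ Γ(X, j ''ᵁ ⊤) :=
  (Scheme.ΓSpecIso R).inv ≫ (j.appIso ⊤).inv

variable {R : CommRingCat.{u}} {X : Scheme.{u}} (j : Spec R ⟶ X) [IsOpenImmersion j]

lemma chartSec_germ_stalkMap (z : Spec R) (hz : j z ∈ j ''ᵁ ⊤) :
    chartSec j ≫ X.presheaf.germ (j ''ᵁ ⊤) (j z) hz ≫ j.stalkMap z =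
      (Scheme.ΓSpecIso R).inv ≫ (Spec R).presheaf.germ ⊤ z trivial := by
  rw [Scheme.Hom.germ_stalkMap, chartSec, Category.assoc, Scheme.Hom.appIso_inv_app_assoc]
  exact congr((Scheme.ΓSpecIso R).inv ≫ $(TopCat.Presheaf.germ_res' (Spec R).presheaf
    (eqToHom (j.preimage_image_eq ⊤)).op z hz))

lemma bijective_stalkMap (z : Spec R) : Function.Bijective (j.stalkMap z).hom :=
  (ConcreteCategory.isIso_iff_bijective (j.stalkMap z)).1 inferInstance

lemma chartSec_germ_stalkMap_of_fromSpecStalk {Y : Scheme.{u}} (F : Y ⟶ X) (y : Y)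
    (φ : R ⟶ Y.presheaf.stalk y) (h : Y.fromSpecStalk y ≫ F = Spec.map φ ≫ j)
    (hy : F y ∈ j ''ᵁ ⊤) :
    chartSec j ≫ X.presheaf.germ (j ''ᵁ ⊤) (F y) hy ≫ F.stalkMap y = φ := by
  rw [Scheme.Hom.germ_stalkMap, ← cancel_mono (Scheme.ΓSpecIso _).inv]
  have hle : (⊤ : (Spec (Y.presheaf.stalk y)).Opens) ≤
      (Y.fromSpecStalk y) ⁻¹ᵁ (F ⁻¹ᵁ (j ''ᵁ ⊤)) := by
    -- The points of the spectrum of the stalk are generalizations of `y`, so they lie in every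
    -- neighbourhood of `y`.
    intro z _
    have hz : Y.fromSpecStalk y z ∈ Set.range (Y.fromSpecStalk y) := ⟨z, rfl⟩
    rw [Scheme.range_fromSpecStalk] at hz
    have hz' : Y.fromSpecStalk y z ⤳ y := hz
    exact hz'.mem_open (F ⁻¹ᵁ (j ''ᵁ ⊤)).2 hy
  have e1 : Y.presheaf.germ (F ⁻¹ᵁ (j ''ᵁ ⊤)) y hy ≫ (Scheme.ΓSpecIso _).inv =
      (Y.fromSpecStalk y).appLE (F ⁻¹ᵁ (j ''ᵁ ⊤)) ⊤ hle := by
    refine Eq.trans ?_ congr($(Scheme.fromSpecStalk_app (X := Y) (U := F ⁻¹ᵁ (j ''ᵁ ⊤)) hy) ≫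
      (Spec (Y.presheaf.stalk y)).presheaf.map (homOfLE hle).op).symm
    rw [Category.assoc, Category.assoc, ← Functor.map_comp]
    have hid := (Spec (Y.presheaf.stalk y)).presheaf.map_id (.op ⊤)
    exact congrArg (_ ≫ ·) ((Category.comp_id _).symm.trans (congrArg (_ ≫ ·) hid.symm))
  have e2 : ∀ (G : Spec (Y.presheaf.stalk y) ⟶ X) (_ : G = Spec.map φ ≫ j)
      (hG : ⊤ ≤ G ⁻¹ᵁ (j ''ᵁ ⊤)), chartSec j ≫ G.appLE (j ''ᵁ ⊤) ⊤ hG =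
        φ ≫ (Scheme.ΓSpecIso _).inv := by
    rintro _ rfl hG
    have hj : (⊤ : (Spec R).Opens) ≤ j ⁻¹ᵁ (j ''ᵁ ⊤) := (j.preimage_image_eq ⊤).ge
    rw [← Scheme.Hom.appLE_comp_appLE (Spec.map φ) j _ ⊤ ⊤ hj le_top, chartSec, Category.assoc,
      Scheme.Hom.appIso_inv_appLE_assoc, Scheme.ΓSpecIso_inv_naturality]
    simp [Scheme.Hom.appLE]
    exact Category.comp_id _
  rw [Category.assoc, Category.assoc, e1]
  exact congr(chartSec j ≫ $(Scheme.Hom.comp_appLE (Y.fromSpecStalk y) F (j ''ᵁ ⊤) ⊤ hle)).symm.trans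
    (e2 _ h _)

end ChartSections

/-! ### The local ring at the origin, and local functions as morphisms to the projective line -/

section Origin
variable (k : Type u) [Field k]

/-- The origin of the affine line. -/
def affineOrigin : PrimeSpectrum (Polynomial k) :=
  ⟨Ideal.span {Polynomial.X}, (Ideal.span_singleton_prime Polynomial.X_ne_zero).2
    Polynomial.prime_X⟩

/-- The origin of the projective line. -/
def origin : (projCurve k).X := projChart k 0 (affineOrigin k)

/-- The domain of the affine coordinate. -/
def originChart : (projCurve k).X.Opens := projChart k 0 ''ᵁ ⊤

lemma origin_mem : origin k ∈ originChart k := ⟨_, trivial, rfl⟩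

/-- The germs of polynomial functions at points of the chart. -/
def polyGerm (x : (projCurve k).X) (hx : x ∈ originChart k) :
    Polynomial k →+* (projCurve k).stalk x :=
  (chartSec (projChart k 0) ≫ (projCurve k).X.presheaf.germ (originChart k) x hx).hom

open Classical in
/-- The germs of the affine coordinate, extended by zero. -/
def coord (x : (projCurve k).X) : (projCurve k).stalk x :=
  if hx : x ∈ originChart k then polyGerm k x hx Polynomial.X else 0

variable {k}

lemma coord_origin : coord k (origin k) = polyGerm k _ (origin_mem k) Polynomial.X :=
  dif_pos (origin_mem k)

lemma polyGerm_C (c : k) : polyGerm k _ (origin_mem k) (Polynomial.C c) = algebraMap k _ c := by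
  have h1 := chartSec_germ_stalkMap (projChart k 0) (affineOrigin k) (origin_mem k)
  have h2 : (projCurve k).toStalk (origin k) ≫ (projChart k 0).stalkMap (affineOrigin k) =
      CommRingCat.ofHom Polynomial.C ≫ (Scheme.ΓSpecIso (.of (Polynomial k))).inv ≫
        (Spec (.of (Polynomial k))).presheaf.germ ⊤ (affineOrigin k) trivial := by
    rw [reassoc_of% (Scheme.ΓSpecIso_inv_naturality (CommRingCat.ofHom (Polynomial.C (R := k))))]
    rw [← projChart_str 0]
    have e := (projChart k 0).germ_stalkMap ⊤ (affineOrigin k) trivial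
    simp only [Curve.toStalk]
    refine congr(_ ≫ _ ≫ $e).trans ?_
    rfl
  refine (bijective_stalkMap (projChart k 0) (affineOrigin k)).1 ?_
  exact congr($(h1).hom (Polynomial.C c)).trans congr($(h2).hom c).symm

lemma isLocalization_polyGerm :
    let _ : Algebra (Polynomial k) ((projCurve k).stalk (origin k)) :=
      (polyGerm k _ (origin_mem k)).toAlgebra
    IsLocalization.AtPrime ((projCurve k).stalk (origin k)) (affineOrigin k).asIdeal := by
  intro _
  let S := (Spec.structureSheaf (Polynomial k)).presheaf.stalk (affineOrigin k)
  let e : (projCurve k).stalk (origin k) ≃+* S :=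
    RingEquiv.ofBijective ((projChart k 0).stalkMap (affineOrigin k)).hom
      (bijective_stalkMap (projChart k 0) (affineOrigin k))
  have h1 := chartSec_germ_stalkMap (projChart k 0) (affineOrigin k) (origin_mem k)
  let e' : S ≃ₐ[Polynomial k] (projCurve k).stalk (origin k) :=
    AlgEquiv.ofRingEquiv (f := e.symm) fun f => by
      rw [RingEquiv.symm_apply_eq]
      exact congr($(h1).hom f).symm
  exact IsLocalization.isLocalization_of_algEquiv _ e'

lemma maximalIdeal_origin : IsLocalRing.maximalIdeal ((projCurve k).stalk (origin k)) =
    Ideal.span {coord k (origin k)} := by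
  let _ : Algebra (Polynomial k) ((projCurve k).stalk (origin k)) :=
    (polyGerm k _ (origin_mem k)).toAlgebra
  have := isLocalization_polyGerm (k := k)
  rw [← IsLocalization.AtPrime.map_eq_maximalIdeal (affineOrigin k).asIdeal
    ((projCurve k).stalk (origin k))]
  simp only [affineOrigin, Ideal.map_span, Set.image_singleton, coord_origin]
  rfl

lemma coord_origin_ne_zero : coord k (origin k) ≠ 0 := by
  let _ : Algebra (Polynomial k) ((projCurve k).stalk (origin k)) :=
    (polyGerm k _ (origin_mem k)).toAlgebra
  have := isLocalization_polyGerm (k := k)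
  have hinj := IsLocalization.injective (M := (affineOrigin k).asIdeal.primeCompl)
    ((projCurve k).stalk (origin k)) (Ideal.primeCompl_le_nonZeroDivisors _)
  rw [coord_origin]
  exact (map_ne_zero_iff _ hinj).2 Polynomial.X_ne_zero

lemma coord_origin_mem :
    coord k (origin k) ∈ IsLocalRing.maximalIdeal ((projCurve k).stalk (origin k)) := by
  rw [maximalIdeal_origin]
  exact Ideal.mem_span_singleton_self _

/-- The origin is a rational point: a germ `r/s` has the value `r(0)/s(0)` in `k`. -/
lemma exists_sub_const_mem (a : (projCurve k).stalk (origin k)) :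
    ∃ c : k, a - algebraMap k _ c ∈
      IsLocalRing.maximalIdeal ((projCurve k).stalk (origin k)) := by
  let _ : Algebra (Polynomial k) ((projCurve k).stalk (origin k)) :=
    (polyGerm k _ (origin_mem k)).toAlgebra
  have := isLocalization_polyGerm (k := k)
  obtain ⟨⟨r, s⟩, e⟩ := IsLocalization.surj (affineOrigin k).asIdeal.primeCompl a
  have hs : s.1.coeff 0 ≠ 0 := fun h => s.2 (Ideal.mem_span_singleton.2 (Polynomial.X_dvd_iff.2 h))
  refine ⟨r.coeff 0 / s.1.coeff 0, ?_⟩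
  have hu := IsLocalization.map_units ((projCurve k).stalk (origin k)) s
  rw [← Ideal.unit_mul_mem_iff_mem _ hu]
  have e2 : algebraMap (Polynomial k) ((projCurve k).stalk (origin k)) s *
      (a - algebraMap k _ (r.coeff 0 / s.1.coeff 0)) =
      algebraMap (Polynomial k) ((projCurve k).stalk (origin k))
        (r - s * Polynomial.C (r.coeff 0 / s.1.coeff 0)) := by
    rw [mul_sub, map_sub, map_mul, mul_comm, e]
    congr 2
    exact (polyGerm_C _).symm
  rw [e2]
  obtain ⟨q, hq⟩ : Polynomial.X ∣ r - s.1 * Polynomial.C (r.coeff 0 / s.1.coeff 0) := by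
    rw [Polynomial.X_dvd_iff]
    simp [mul_div_cancel₀ _ hs, Polynomial.mul_coeff_zero]
  rw [hq, map_mul, maximalIdeal_origin]
  refine Ideal.mul_mem_right _ _ ?_
  rw [coord_origin]
  exact Ideal.mem_span_singleton_self _

/-- A point in the closure of `x` is either `x`, or has `x` as the generic point of its component.
-/
lemma Curve.isClosed_singleton (C : Curve k) {x : C.X} (hx : ¬ IsGeneric C x) : IsClosed {x} := by
  refine isClosed_of_closure_subset fun y hy => ?_
  rcases C.eq_gen_or_eq (specializes_iff_mem_closure.2 hy) with h | h
  · exact (hx (h ▸ C.isGeneric_gen y)).elim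
  · exact h.symm

lemma isClosed_origin : IsClosed {origin k} := by
  refine (projCurve k).isClosed_singleton fun h => ?_
  have := (IsLocalRing.isField_iff_maximalIdeal_eq.1 h.isField_stalk)
  exact coord_origin_ne_zero ((Ideal.mem_bot).1 (this ▸ coord_origin_mem))

/-- A function in the maximal ideal of a point is, locally, a morphism to the projective line. -/
lemma Curve.exists_hom_projCurve (C : Curve k) (y : C.X) (a : C.stalk y)
    (ha : a ∈ IsLocalRing.maximalIdeal (C.stalk y)) :
    ∃ F : CurveHom C (projCurve k), F.f y = origin k ∧
      F.stalkMap y (coord k (F.f y)) = a := by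
  -- The map `t ↦ a` is a morphism from the spectrum of the stalk to the affine line; as `a`
  -- vanishes at `y`, the closed point goes to the origin. Properness of the projective line extends
  -- it, by the constant origin on the other components.
  let φ : CommRingCat.of (Polynomial k) ⟶ C.X.presheaf.stalk y :=
    CommRingCat.ofHom (Polynomial.aeval (R := k) (A := C.stalk y) a).toRingHom
  have hC : CommRingCat.ofHom (Polynomial.C (R := k)) ≫ φ = C.toStalk y := by
    ext c
    exact Polynomial.aeval_C (A := C.stalk y) a c
  obtain ⟨F, hF, hFy⟩ := C.exists_hom_of_stalk (projLineStr k)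
    (Spec.map (CommRingCat.ofHom (Polynomial.evalRingHom (0 : k))) ≫ projChart k 0) (by
      rw [Category.assoc, projChart_str, ← Spec.map_comp, ← CommRingCat.ofHom_comp,
        ← Spec.map_id]
      congr 1
      ext c
      exact Polynomial.eval_C) y (Spec.map φ ≫ projChart k 0) (by
      rw [Category.assoc, projChart_str, ← Spec.map_comp, hC, C.fromSpecStalk_str])
  have ho : F y = origin k := by
    have h1 : F y = projChart k 0 (Spec.map φ (IsLocalRing.closedPoint (C.stalk y))) :=
      (congrArg F (Scheme.fromSpecStalk_closedPoint (X := C.X) (x := y))).symm.trans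
        congr($hFy (IsLocalRing.closedPoint (C.stalk y)))
    have h2 : Spec.map φ (IsLocalRing.closedPoint (C.stalk y)) = affineOrigin k := by
      refine PrimeSpectrum.ext ?_
      have hm : (affineOrigin k).asIdeal.IsMaximal :=
        PrincipalIdealRing.isMaximal_of_irreducible Polynomial.irreducible_X
      refine (hm.eq_of_le (Ideal.IsPrime.ne_top' (I := Ideal.comap φ.hom
        (IsLocalRing.maximalIdeal (C.stalk y)))) ?_).symm
      refine (Ideal.span_singleton_le_iff_mem _).2 ?_
      change Polynomial.aeval (R := k) (A := C.stalk y) a Polynomial.X ∈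
        IsLocalRing.maximalIdeal (C.stalk y)
      rwa [Polynomial.aeval_X]
    rw [h1, h2]
    rfl
  refine ⟨⟨F, hF⟩, ho, ?_⟩
  have hy : F y ∈ originChart k := ho ▸ origin_mem k
  have h := chartSec_germ_stalkMap_of_fromSpecStalk (projChart k 0) F y φ hFy hy
  refine (congrArg (F.stalkMap y).hom (dif_pos hy)).trans ?_
  refine congr($(h).hom Polynomial.X).trans ?_
  exact Polynomial.aeval_X (A := C.stalk y) a

end Origin

/-! ### Leading coefficients with respect to a uniformizer -/

section Uniformizer
variable {k A : Type*} [Field k] [CommRing A] [IsLocalRing A] [Algebra k A]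

/-- With residue field `k`, the quotient `𝔪^j/𝔪^(j+1)` is spanned over `k` by `τ^j`. -/
lemma exists_sub_smul_pow_mem {τ : A} (hτ : IsLocalRing.maximalIdeal A = Ideal.span {τ})
    (hk : ∀ a : A, ∃ c : k, a - algebraMap k A c ∈ IsLocalRing.maximalIdeal A) (j : ℕ) {u : A}
    (hu : u ∈ IsLocalRing.maximalIdeal A ^ j) :
    ∃ d : k, u - d • τ ^ j ∈ IsLocalRing.maximalIdeal A ^ (j + 1) := by
  have hu' := hu
  rw [hτ, Ideal.span_singleton_pow, Ideal.mem_span_singleton] at hu'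
  obtain ⟨b, rfl⟩ := hu'
  obtain ⟨d, hd⟩ := hk b
  refine ⟨d, ?_⟩
  rw [pow_succ]
  have e : τ ^ j * b - d • τ ^ j = τ ^ j * (b - algebraMap k A d) := by
    rw [Algebra.smul_def]; ring
  rw [e]
  refine Ideal.mul_mem_mul (Ideal.pow_mem_pow ?_ j) hd
  rw [hτ]
  exact Ideal.mem_span_singleton_self τ

lemma eq_zero_of_smul_pow_mem [IsDomain A] {τ : A} (hτ : IsLocalRing.maximalIdeal A = Ideal.span {τ})
    (h0 : τ ≠ 0) {j : ℕ} {d : k} (h : d • τ ^ j ∈ IsLocalRing.maximalIdeal A ^ (j + 1)) :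
    d = 0 := by
  by_contra hd
  rw [hτ, Ideal.span_singleton_pow, Ideal.mem_span_singleton, pow_succ] at h
  obtain ⟨b, hb⟩ := h
  have hb' : algebraMap k A d = τ * b := by
    refine mul_left_cancel₀ (pow_ne_zero j h0) ?_
    rw [← mul_assoc, ← hb, Algebra.smul_def, mul_comm]
  have hu : IsUnit (algebraMap k A d) := (isUnit_iff_ne_zero.2 hd).map _
  rw [hb'] at hu
  have : τ ∈ IsLocalRing.maximalIdeal A := hτ ▸ Ideal.mem_span_singleton_self τ
  exact (IsLocalRing.mem_maximalIdeal τ).1 this (isUnit_of_mul_isUnit_left hu)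

end Uniformizer

/-! ### Endomorphisms of the representation act on `fil²` through scalars -/

section Scalars
variable {k : Type u} [Field k]

lemma Nilp.toH1_eq_iff [CharZero k] {p : MCrv k} (r s : Nilp p) :
    r.toH1 = s.toH1 ↔ ∀ x, (r x).1 - (s x).1 ∈ p.Y.ideal x := by
  have h : r.toH1 - s.toH1 = (r - s).toH1 := (map_sub (Nilp.toH1Lin p) r s).symm
  rw [← sub_eq_zero, h, Nilp.toH1_eq_zero_iff, Nilp.toRing_eq_zero_iff]
  rfl

open Classical in
/-- The divisor `n · y`. -/
def pointDiv (C : Curve k) (y : C.X) (n : ℕ) (h : n ≠ 0 → IsClosed {y}) : EffDiv C where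
  mult x := if x = y then n else 0
  finite := (Set.finite_singleton y).subset fun x hx => by
    by_contra hne
    exact hx (if_neg hne)
  closed x hx := by
    by_cases hxy : x = y
    · subst hxy
      exact h (by simpa using hx)
    · exact (hx (if_neg hxy)).elim

lemma pointDiv_mult_self (C : Curve k) (y : C.X) (n : ℕ) (h : n ≠ 0 → IsClosed {y}) :
    (pointDiv C y n h).mult y = n := if_pos rfl

lemma pointDiv_mult_of_ne (C : Curve k) {x y : C.X} (n : ℕ) (h : n ≠ 0 → IsClosed {y})
    (hxy : x ≠ y) : (pointDiv C y n h).mult x = 0 := if_neg hxy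

/-- The projective line with modulus `N · 0`. -/
abbrev projMod (k : Type u) [Field k] (N : ℕ) : MCrv k where
  C := projCurve k
  Y := pointDiv (projCurve k) (origin k) N fun _ => isClosed_origin
  Z := pointDiv (projCurve k) (origin k) 0 fun _ => isClosed_origin
  disj _ := Or.inr (ite_self 0)

lemma projMod_Z (N : ℕ) (x : (projMod k N).C.X) : (projMod k N).Z.mult x = 0 := ite_self 0

lemma projMod_mult_origin (N : ℕ) : (projMod k N).Y.mult (origin k) = N := if_pos rfl

lemma projMod_mult_of_ne (N : ℕ) {x : (projCurve k).X} (hx : x ≠ origin k) :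
    (projMod k N).Y.mult x = 0 := if_neg hx

lemma projMod_ideal_origin (N : ℕ) : (projMod k N).Y.ideal (origin k) =
    IsLocalRing.maximalIdeal ((projCurve k).stalk (origin k)) ^ N :=
  congrArg (IsLocalRing.maximalIdeal ((projCurve k).stalk (origin k)) ^ ·) (if_pos rfl)

lemma projMod_ideal_of_ne (N : ℕ) {x : (projCurve k).X} (hx : x ≠ origin k) :
    (projMod k N).Y.ideal x = ⊤ :=
  EffDiv.ideal_of_eq_zero _ _ (projMod_mult_of_ne N hx)

/-- The coordinate of the projective line, as a section at every point. -/
def coordNilp (k : Type u) [Field k] (N : ℕ) : Nilp (projMod k N) := fun x =>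
  ⟨coord k x, by
    by_cases hx : x = origin k
    · subst hx
      refine Ideal.pow_le_pow_right (n := 1) (min_le_right _ _) ?_
      rw [pow_one]
      exact coord_origin_mem
    · rw [EffDiv.ideal_red_of_eq_zero _ _ (projMod_mult_of_ne N hx)]
      trivial⟩

/-- A morphism to the projective line which takes the divisor to the origin. -/
def homProjMod (p : MCrv k) (N : ℕ) (F : CurveHom p.C (projCurve k))
    (h : ∀ x, p.Y.mult x ≠ 0 → F.f x = origin k ∧ p.Y.mult x ≤ N) : MCrv.Hom p (projMod k N) where
  toCurveHom := F
  hY x := by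
    by_cases hx : p.Y.mult x = 0
    · rw [EffDiv.ideal_of_eq_zero _ _ hx]
      exact le_top
    obtain ⟨ho, hN⟩ := h x hx
    have hm : (projMod k N).Y.mult (F.f x) = N := if_pos ho
    have hl : IsLocalHom (F.f.stalkMap x).hom := inferInstance
    have hl' := ((IsLocalRing.local_hom_TFAE (F.f.stalkMap x).hom).out 0 2).1 hl
    refine (Ideal.map_pow (F.stalkMap x) (IsLocalRing.maximalIdeal ((projCurve k).stalk (F.f x)))
      ((projMod k N).Y.mult (F.f x))).le.trans ?_
    rw [hm]
    exact (Ideal.pow_right_mono hl' N).trans (Ideal.pow_le_pow_right hN)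
  hZ x := by
    have : (projMod k N).Z.idealSub (F.f x) = ⊤ := by
      have h0 : (projMod k N).Z.mult (F.f x) - 1 = 0 := by rw [projMod_Z]
      exact (congrArg (IsLocalRing.maximalIdeal ((projCurve k).stalk (F.f x)) ^ ·) h0).trans
        ((pow_zero _).trans Ideal.one_eq_top)
    rw [this, Ideal.map_top]
    exact le_top
  hZred x hx := by
    rw [projMod_Z] at hx
    exact hx.false.elim

/-- The part of the modulus at one point. -/
abbrev MCrv.atPoint (p : MCrv k) (y : p.C.X) : MCrv k where
  C := p.C
  Y := pointDiv p.C y (p.Y.mult y) (p.Y.closed y)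
  Z := p.Z
  disj x := by
    by_cases hx : x = y
    · subst hx
      exact (p.disj x).imp (fun h => (pointDiv_mult_self _ _ _ _).trans h) id
    · exact Or.inl (pointDiv_mult_of_ne _ _ _ hx)

lemma MCrv.atPoint_mult_self (p : MCrv k) (y : p.C.X) : (p.atPoint y).Y.mult y = p.Y.mult y :=
  if_pos rfl

lemma MCrv.atPoint_mult_of_ne (p : MCrv k) {x y : p.C.X} (h : x ≠ y) :
    (p.atPoint y).Y.mult x = 0 := if_neg h

lemma MCrv.atPoint_ideal (p : MCrv k) (y : p.C.X) :
    (p.atPoint y).Y.ideal y = p.Y.ideal y :=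
  congrArg (IsLocalRing.maximalIdeal (p.C.stalk y) ^ ·) (if_pos rfl)

lemma MCrv.atPoint_ideal_of_ne (p : MCrv k) {x y : p.C.X} (h : x ≠ y) :
    (p.atPoint y).Y.ideal x = ⊤ :=
  EffDiv.ideal_of_eq_zero _ _ (p.atPoint_mult_of_ne h)

/-- The identity `(X, n_y y, Z) → (X, Y, Z)`. -/
def MCrv.fromAtPoint (p : MCrv k) (y : p.C.X) : MCrv.Hom (p.atPoint y) p where
  toCurveHom := CurveHom.id p.C
  hY x := by
    refine (CurveHom.map_id x (p.Y.ideal x)).le.trans ?_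
    by_cases hx : y = x
    · subst hx
      exact (p.atPoint_ideal y).ge
    · rw [p.atPoint_ideal_of_ne (Ne.symm hx)]
      exact le_top
  hZ x := (CurveHom.map_id x (p.Z.idealSub x)).ge
  hZred _ h := h

/-- Pull-back to `(X, n_y y, Z)` retains exactly the germ at `y`. Hence an element of `fil²` is
determined by these pull-backs, one point of `Y` at a time. -/
lemma pull_fromAtPoint_eq_iff [CharZero k] {p : MCrv k} (y : p.C.X) (r s : Nilp p) :
    pull (p.fromAtPoint y) r.toH1 = pull (p.fromAtPoint y) s.toH1 ↔
      (r y).1 - (s y).1 ∈ p.Y.ideal y := by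
  rw [pull_toH1, pull_toH1, Nilp.toH1_eq_iff]
  have e : ∀ (t : Nilp p) x, (t.pull (p.fromAtPoint y) x).1 = (t x).1 := fun t x =>
    CurveHom.stalkMap_id x (t x).1
  constructor
  · intro h
    have := h y
    rw [e, e] at this
    exact (p.atPoint_ideal y).le this
  · intro h x
    by_cases hx : y = x
    · subst hx
      rw [e, e]
      exact (p.atPoint_ideal y).ge h
    · exact (p.atPoint_ideal_of_ne (Ne.symm hx)).ge trivial

/-- The germ of `r` at `y` is the pull-back of the coordinate under some morphism `F` to the
projective line. Since `F` is uncontrolled at the other points of `Y`, the modulus has to be cut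
down to `y`. -/
lemma exists_pull_coord [CharZero k] {p : MCrv k} (y : p.C.X) (N : ℕ) (hN : p.Y.mult y ≤ N) (r : Nilp p)
    (hy : p.Y.mult y ≠ 0) : ∃ F : MCrv.Hom (p.atPoint y) (projMod k N),
      pull F (coordNilp k N).toH1 = pull (p.fromAtPoint y) r.toH1 := by
  have hr : (r y).1 ∈ IsLocalRing.maximalIdeal (p.C.stalk y) :=
    (EffDiv.ideal_red_of_pos p.Y y (Nat.pos_of_ne_zero hy)).le (r y).2
  obtain ⟨F, hF, hFr⟩ := p.C.exists_hom_projCurve y (r y).1 hr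
  have h : ∀ x, (p.atPoint y).Y.mult x ≠ 0 → F.f x = origin k ∧ (p.atPoint y).Y.mult x ≤ N := by
    intro x hx
    obtain rfl : y = x := by
      by_contra hne
      exact hx (p.atPoint_mult_of_ne (Ne.symm hne))
    exact ⟨hF, (p.atPoint_mult_self y).trans_le hN⟩
  refine ⟨homProjMod (p.atPoint y) N F h, ?_⟩
  rw [pull_toH1, pull_toH1, Nilp.toH1_eq_iff]
  intro x
  by_cases hx : y = x
  · subst hx
    have e1 : ((coordNilp k N).pull (homProjMod (p.atPoint y) N F h) y).1 = (r y).1 := hFr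
    have e2 : (r.pull (p.fromAtPoint y) y).1 = (r y).1 := CurveHom.stalkMap_id y (r y).1
    rw [e1, e2, sub_self]
    exact zero_mem _
  · exact (p.atPoint_ideal_of_ne (Ne.symm hx)).ge trivial

/-- Multiplication by two on the projective line. -/
lemma exists_double (N : ℕ) : ∃ μ : MCrv.Hom (projMod k N) (projMod k N),
    μ.f (origin k) = origin k ∧
      μ.stalkMap (origin k) (coord k (μ.f (origin k))) = (2 : k) • coord k (origin k) := by
  obtain ⟨F, hF, hF2⟩ := (projCurve k).exists_hom_projCurve (origin k)
    ((2 : k) • coord k (origin k)) (Submodule.smul_of_tower_mem _ _ coord_origin_mem)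
  refine ⟨homProjMod _ N F fun x hx => ?_, hF, hF2⟩
  obtain rfl : x = origin k := by
    by_contra hne
    exact hx (projMod_mult_of_ne N hne)
  exact ⟨hF, (projMod_mult_origin N).le⟩

/-- The map `μ^*` multiplies `τ^j` by `2^j`, so its eigenvectors with eigenvalue `2` are the
multiples of `τ` modulo `𝔪^N`. Successively for `j ≥ 2`, the coefficient `d` of `τ^j` satisfies
`(2^j - 2) d = 0` and therefore vanishes. -/
lemma exists_const_of_double [CharZero k] (N : ℕ) (μ : MCrv.Hom (projMod k N) (projMod k N))
    (hμ : μ.f (origin k) = origin k)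
    (hμ2 : μ.stalkMap (origin k) (coord k (μ.f (origin k))) = (2 : k) • coord k (origin k))
    (s : Nilp (projMod k N)) (hN : 2 ≤ N)
    (hs : (2 : k) • (s (origin k)).1 - (s.pull μ (origin k)).1 ∈
      IsLocalRing.maximalIdeal ((projCurve k).stalk (origin k)) ^ N) :
    ∃ c : k, (s (origin k)).1 - c • coord k (origin k) ∈
      IsLocalRing.maximalIdeal ((projCurve k).stalk (origin k)) ^ N := by
  let O := (projCurve k).stalk (origin k)
  let 𝔪 := IsLocalRing.maximalIdeal O
  let τ : O := coord k (origin k)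
  let σ := μ.stalkMap (origin k)
  have hσ : ∀ (j : ℕ) (a : (projCurve k).stalk (μ.f (origin k))),
      a ∈ IsLocalRing.maximalIdeal ((projCurve k).stalk (μ.f (origin k))) ^ j → σ a ∈ 𝔪 ^ j := by
    intro j a ha
    have hl : IsLocalHom (μ.f.stalkMap (origin k)).hom := inferInstance
    have hl' := ((IsLocalRing.local_hom_TFAE (μ.f.stalkMap (origin k)).hom).out 0 2).1 hl
    have := (Ideal.map_pow σ _ j).le.trans (Ideal.pow_right_mono hl' j)
    exact this (Ideal.mem_map_of_mem σ ha)
  have hs0 : (s (origin k)).1 ∈ 𝔪 ^ 1 := by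
    rw [pow_one]
    exact (EffDiv.ideal_red_of_pos (projMod k N).Y (origin k)
      (by rw [projMod_mult_origin]; omega)).le (s (origin k)).2
  obtain ⟨c, hc⟩ := exists_sub_smul_pow_mem (maximalIdeal_origin (k := k)) exists_sub_const_mem 1 hs0
  rw [pow_one] at hc
  refine ⟨c, Nat.le_induction (P := fun j _ => j ≤ N → (s (origin k)).1 - c • τ ∈ 𝔪 ^ j)
    (fun _ => hc) (fun j hj ih hjN => ?_) N hN le_rfl⟩
  obtain ⟨d, hd⟩ := exists_sub_smul_pow_mem (maximalIdeal_origin (k := k)) exists_sub_const_mem j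
    (ih (by omega))
  -- The equality `μ(0) = 0` does not identify the two stalks as types; stating the estimate for a
  -- variable point carries it over to `μ(0)`.
  have transfer : ∀ x, x = origin k → (s x).1 - c • coord k x - d • coord k x ^ j ∈
      IsLocalRing.maximalIdeal ((projCurve k).stalk x) ^ (j + 1) := by
    rintro _ rfl
    exact hd
  have h1 := hσ (j + 1) _ (transfer (μ.f (origin k)) hμ)
  have e : σ ((s (μ.f (origin k))).1 - c • coord k (μ.f (origin k)) -
      d • coord k (μ.f (origin k)) ^ j) =
      (s.pull μ (origin k)).1 - c • (2 : k) • τ - d • ((2 : k) • τ) ^ j := by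
    rw [map_sub, map_sub, map_smul, map_smul, map_pow, hμ2]
    rfl
  rw [e] at h1
  have hs' : (2 : k) • (s (origin k)).1 - (s.pull μ (origin k)).1 ∈ 𝔪 ^ (j + 1) :=
    Ideal.pow_le_pow_right hjN hs
  have h2 : ((2 : k) ^ j * d - 2 * d) • τ ^ j ∈ 𝔪 ^ (j + 1) := by
    have h3 : (2 : k) • ((s (origin k)).1 - c • τ - d • τ ^ j) ∈ 𝔪 ^ (j + 1) :=
      Submodule.smul_of_tower_mem _ (2 : k) hd
    have := sub_mem (sub_mem h3 hs') h1
    convert this using 1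
    rw [smul_pow]
    module
  have h3 := eq_zero_of_smul_pow_mem maximalIdeal_origin coord_origin_ne_zero h2
  have hd0 : d = 0 := by
    have h4 : ((2 : k) ^ j - 2) * d = 0 := by rw [← h3]; ring
    refine (mul_eq_zero.1 h4).resolve_left ?_
    intro h5
    have h6 : ((2 ^ j : ℕ) : k) = ((2 : ℕ) : k) := by push_cast; exact sub_eq_zero.1 h5
    have h7 : 2 ^ j = 2 := Nat.cast_injective h6
    have h8 : 2 ^ 2 ≤ 2 ^ j := Nat.pow_le_pow_right (by norm_num) hj
    omega
  rw [hd0, zero_smul, sub_zero] at hd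
  exact hd

/-- The endomorphism commutes with `μ^*`, and `μ^* t = 2 t`; so the image of the class of `t` is
again an eigenvector with eigenvalue `2`, that is, a multiple of `t`. -/
lemma exists_scalar_coord [NumberField k] (N : ℕ) (hN : 2 ≤ N) {E : Set (MCrv k)} (h1 : projMod k N ∈ E)
    (h2 : (projMod k N).redZ ∈ E) (h3 : (projMod k N).redZ.redY ∈ E) (a : EndT E) :
    ∃ c : k, a.1 ⟨_, h1⟩ (coordNilp k N).toH1 = c • (coordNilp k N).toH1 := by
  obtain ⟨s, hs⟩ := Nilp.exists_toH1
    (EndT.fil2_stable a (projMod k N) h1 h2 h3 (coordNilp k N).toH1_mem)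
  obtain ⟨μ, hμ, hμ2⟩ := exists_double (k := k) N
  have e1 : pull μ (coordNilp k N).toH1 = (coordNilp k N).toH1 + (coordNilp k N).toH1 := by
    refine (pull_toH1 μ _).trans (Eq.trans ?_ (map_add (Nilp.toH1Lin (projMod k N)) _ _))
    refine (Nilp.toH1_eq_iff _ _).2 fun x => ?_
    by_cases hx : x = origin k
    · subst hx
      refine (congrArg (· ∈ (projMod k N).Y.ideal (origin k)) ?_).mpr (zero_mem _)
      exact sub_eq_zero.2 (hμ2.trans (two_smul k _))
    · rw [projMod_ideal_of_ne N hx]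
      trivial
  have e2 : (s.pull μ).toH1 = (s + s).toH1 := by
    refine Eq.trans ?_ (map_add (Nilp.toH1Lin (projMod k N)) s s).symm
    rw [Nilp.toH1Lin_apply, ← pull_toH1, hs, ← a.2 ⟨_, h1⟩ ⟨_, h1⟩ μ, e1, map_add]
  have e3 := (Nilp.toH1_eq_iff _ _).1 e2 (origin k)
  obtain ⟨c, hc⟩ := exists_const_of_double N μ hμ hμ2 s hN (by
    rw [← projMod_ideal_origin, ← neg_mem_iff, neg_sub, two_smul]
    exact e3)
  refine ⟨c, hs.symm.trans (Eq.trans ?_ (map_smul (Nilp.toH1Lin (projMod k N)) c _))⟩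
  refine (Nilp.toH1_eq_iff _ _).2 fun x => ?_
  by_cases hx : x = origin k
  · subst hx
    rw [projMod_ideal_origin]
    exact hc
  · rw [projMod_ideal_of_ne N hx]
    trivial

/-- The test objects needed for `exists_scalar`. One `N` must dominate all multiplicities, so that a
single projective line, and thus a single scalar, serves all curves and points; `N ≥ 2` makes the
class of the coordinate nonzero. -/
lemma exists_finite_superset (E₀ : Set (MCrv k)) (hE₀ : E₀.Finite) :
    ∃ (E : Set (MCrv k)) (N : ℕ), E.Finite ∧ E₀ ⊆ E ∧ 2 ≤ N ∧ projMod k N ∈ E ∧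
      (projMod k N).redZ ∈ E ∧ (projMod k N).redZ.redY ∈ E ∧ ∀ p ∈ E₀, p.redZ ∈ E ∧
        p.redZ.redY ∈ E ∧ ∀ y, p.Y.mult y ≠ 0 → p.atPoint y ∈ E ∧ p.Y.mult y ≤ N := by
  let S : Set (Σ p : MCrv k, p.C.X) := ⋃ p ∈ E₀, Sigma.mk p '' {y | p.Y.mult y ≠ 0}
  have hS : S.Finite := hE₀.biUnion fun p _ => p.Y.finite.image _
  obtain ⟨N, hN⟩ := (hS.image fun q => q.1.Y.mult q.2).bddAbove
  let P := projMod k (max N 2)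
  refine ⟨E₀ ∪ MCrv.redZ '' E₀ ∪ (fun p => p.redZ.redY) '' E₀ ∪ (fun q => q.1.atPoint q.2) '' S ∪
    {P, P.redZ, P.redZ.redY}, max N 2, ?_, ?_, le_max_right _ _, ?_, ?_, ?_, ?_⟩
  · exact ((((hE₀.union (hE₀.image _)).union (hE₀.image _)).union (hS.image _)).union
      (Set.toFinite _))
  · intro p hp
    exact Or.inl (Or.inl (Or.inl (Or.inl hp)))
  · exact Or.inr (Or.inl rfl)
  · exact Or.inr (Or.inr (Or.inl rfl))
  · exact Or.inr (Or.inr (Or.inr rfl))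
  · intro p hp
    refine ⟨Or.inl (Or.inl (Or.inl (Or.inr ⟨p, hp, rfl⟩))), Or.inl (Or.inl (Or.inr ⟨p, hp, rfl⟩)),
      fun y hy => ?_⟩
    have hq : (⟨p, y⟩ : Σ p : MCrv k, p.C.X) ∈ S :=
      Set.mem_biUnion hp ⟨y, hy, rfl⟩
    exact ⟨Or.inl (Or.inr ⟨⟨p, y⟩, hq, rfl⟩), (hN ⟨_, hq, rfl⟩).trans (le_max_left _ _)⟩

/-- The endomorphisms of the representation act on `fil²` through scalars in `k`. -/
lemma exists_scalar [NumberField k] (E₀ : Set (MCrv k)) (hE₀ : E₀.Finite) :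
    ∃ (E : Set (MCrv k)) (_ : E.Finite) (h : E₀ ⊆ E), ∀ a : EndT E, ∃ c : k,
      ∀ (p : MCrv k) (hp : p ∈ E₀), ∀ x ∈ fil2 p, a.1 ⟨p, h hp⟩ x = c • x := by
  obtain ⟨E, N, hE, h, hN, h1, h2, h3, h4⟩ := exists_finite_superset E₀ hE₀
  refine ⟨E, hE, h, fun a => ?_⟩
  obtain ⟨c, hc⟩ := exists_scalar_coord N hN h1 h2 h3 a
  refine ⟨c, fun p hp x hx => ?_⟩
  obtain ⟨h5, h6, h7⟩ := h4 p hp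
  obtain ⟨s, hs⟩ := Nilp.exists_toH1 (EndT.fil2_stable a p (h hp) h5 h6 hx)
  obtain ⟨r, rfl⟩ := Nilp.exists_toH1 hx
  refine hs.symm.trans (Eq.trans ?_ (map_smul (Nilp.toH1Lin p) c r))
  refine (Nilp.toH1_eq_iff s (c • r)).2 fun y => ?_
  by_cases hy : p.Y.mult y = 0
  · rw [EffDiv.ideal_of_eq_zero _ _ hy]
    trivial
  obtain ⟨h8, h9⟩ := h7 y hy
  obtain ⟨F, hF⟩ := exists_pull_coord y N h9 r hy
  -- On `(X, n_y y, Z)` the class of `r` is pulled back from the coordinate `t`, where `a` is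
  -- multiplication by `c`. Naturality along both morphisms transports this to the germ at `y`.
  refine (pull_fromAtPoint_eq_iff y s (c • r)).1 ?_
  have e : (c • r : Nilp p).toH1 = c • r.toH1 := map_smul (Nilp.toH1Lin p) c r
  rw [hs, ← a.2 ⟨_, h8⟩ ⟨p, h hp⟩, ← hF, a.2 ⟨_, h8⟩ ⟨_, h1⟩, hc, map_smul, hF, e, map_smul]

end Scalars

/-! ### Unipotent objects as `k`-vector spaces -/

section NoriScalars
variable {k : Type u} [Field k] [NumberField k]

/-- The scalars as endomorphisms of the representation. -/
def EndT.scalar (E : Set (MCrv k)) : k →+* EndT E where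
  toFun c := ⟨fun p => (LinearMap.lsmul k (H1 p.1) c).restrictScalars ℚ,
    fun _ _ f x => (map_smul (pull f) c x).symm⟩
  map_one' := Subtype.ext (funext fun _ => LinearMap.ext fun x => one_smul k x)
  map_mul' c d := Subtype.ext (funext fun _ => LinearMap.ext fun x => mul_smul c d x)
  map_zero' := Subtype.ext (funext fun _ => LinearMap.ext fun x => zero_smul k x)
  map_add' c d := Subtype.ext (funext fun _ => LinearMap.ext fun x => add_smul c d x)

namespace NoriObj

/-- The action of the scalars on an object of Nori's category. -/
instance (A : NoriObj k) : Module k A.V :=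
  Module.compHom A.V ((A.act : EndT A.E →+* Module.End ℚ A.V).comp (EndT.scalar A.E))

lemma smul_eq_act (A : NoriObj k) (c : k) (v : A.V) : c • v = A.act (EndT.scalar A.E c) v := rfl

instance (A : NoriObj k) : IsScalarTower ℚ k A.V where
  smul_assoc q c v := by
    have : EndT.scalar A.E (q • c) = q • EndT.scalar A.E c :=
      Subtype.ext (funext fun _ => LinearMap.ext fun x => smul_assoc q c x)
    rw [smul_eq_act, this, map_smul]
    rfl

instance (A : NoriObj k) : Module.Finite k A.V := Module.Finite.of_restrictScalars_finite ℚ k A.V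

variable {A B : NoriObj k}

/-- The scalars of `k` are themselves endomorphisms of the representation, so every morphism of
Nori's category commutes with them. -/
lemma map_smul_of_mem_homs {φ : A.V →ₗ[ℚ] B.V} (h : φ ∈ homs A B) (c : k) (v : A.V) :
    φ (c • v) = c • φ v := by
  obtain ⟨E, -, hA, hB, h⟩ := h
  exact h (EndT.scalar E c) v

end NoriObj

lemma coordNilp_toH1_ne_zero (N : ℕ) (hN : 2 ≤ N) : (coordNilp k N).toH1 ≠ 0 := by
  intro h
  rw [Nilp.toH1_eq_zero_iff, Nilp.toRing_eq_zero_iff] at h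
  have h1 := h (origin k)
  rw [projMod_ideal_origin] at h1
  have h2 := Ideal.pow_le_pow_right hN h1
  refine one_ne_zero (α := k) (eq_zero_of_smul_pow_mem (maximalIdeal_origin (k := k)) coord_origin_ne_zero
    (j := 1) ?_)
  rw [one_smul, pow_one]
  exact h2

/-- The vertices needed to define the scalar of an endomorphism. -/
abbrev baseVertices (k : Type u) [Field k] : Set (MCrv k) :=
  {projMod k 2, (projMod k 2).redZ, (projMod k 2).redZ.redY}

lemma projMod_mem_baseVertices (k : Type u) [Field k] : projMod k 2 ∈ baseVertices k := Or.inl rfl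

/-- `a` acts on the coordinate of the projective line as `c`. -/
def ActsAs {E : Set (MCrv k)} (hE : baseVertices k ⊆ E) (a : EndT E) (c : k) : Prop :=
  a.1 ⟨_, hE (projMod_mem_baseVertices k)⟩ (coordNilp k 2).toH1 = c • (coordNilp k 2).toH1

lemma exists_actsAs {E : Set (MCrv k)} (hE : baseVertices k ⊆ E) (a : EndT E) :
    ∃ c, ActsAs hE a c :=
  exists_scalar_coord 2 le_rfl (hE (Or.inl rfl)) (hE (Or.inr (Or.inl rfl)))
    (hE (Or.inr (Or.inr rfl))) a

/-- On the components of `w` an endomorphism acts as a scalar `c'`. Including `projMod k 2` among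
the vertices forces `c'` to be the scalar read off from the coordinate, whatever generator is
considered. -/
lemma NoriObj.exists_act_eq_smul_of_generator (A : NoriObj k) {v : A.V}
    (hv : ∃ (E : Set (MCrv k)) (_ : E.Finite) (hA : A.E ⊆ E) (n : ℕ)
    (p : Fin n → E) (W : Submodule ℚ (∀ i, H1 (p i).1))
    (hW : ∀ a : EndT E, ∀ w ∈ W, (fun i => a.1 (p i) (w i)) ∈ W) (π : W →ₗ[ℚ] A.V)
    (_ : ∀ (a : EndT E) (w : W),
      π ⟨fun i => a.1 (p i) (w.1 i), hW a w.1 w.2⟩ = A.act (EndT.res hA a) (π w))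
    (w : W) (_ : ∀ i, w.1 i ∈ ModulusCurve.fil2 (p i).1), v = π w) :
    ∃ (E : Set (MCrv k)) (_ : E.Finite) (hA : A.E ⊆ E) (hE : baseVertices k ⊆ E),
      ∀ (a : EndT E) (c : k), ActsAs hE a c → A.act (EndT.res hA a) v = c • v := by
  obtain ⟨E₁, hE₁, hA, n, p, W, hW, π, hπ, w, hw, rfl⟩ := hv
  have hE₀ : (insert (projMod k 2) (Set.range fun i => (p i).1)).Finite :=
    (Set.finite_range _).insert _
  obtain ⟨E₂, hE₂, h₂, hsc⟩ := exists_scalar _ hE₀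
  refine ⟨E₁ ∪ E₂ ∪ baseVertices k, (hE₁.union hE₂).union (Set.toFinite _),
    hA.trans fun _ h => Or.inl (Or.inl h), fun _ h => Or.inr h, fun a c hc => ?_⟩
  let a₁ : EndT E₁ := EndT.res (fun _ h => Or.inl (Or.inl h)) a
  let a₂ : EndT E₂ := EndT.res (fun _ h => Or.inl (Or.inr h)) a
  obtain ⟨c', hc'⟩ := hsc a₂
  have hcc : c' = c := by
    have h1 := (hc' (projMod k 2) (Or.inl rfl) _ (coordNilp k 2).toH1_mem).symm.trans hc
    rw [← sub_eq_zero, ← sub_smul] at h1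
    exact sub_eq_zero.1 ((smul_eq_zero.1 h1).resolve_right (coordNilp_toH1_ne_zero 2 le_rfl))
  subst hcc
  refine (hπ a₁ w).symm.trans (Eq.trans ?_ (hπ (EndT.scalar E₁ c') w))
  refine congrArg π (Subtype.ext (funext fun i => ?_))
  exact hc' (p i).1 (Or.inr ⟨i, rfl⟩) (w.1 i) (hw i)

/-- On a unipotent object the endomorphisms of the representation act through scalars. -/
lemma NoriObj.exists_act_eq_smul (A : NoriObj k) (hA : A.fil2 = ⊤) :
    ∃ (E : Set (MCrv k)) (_ : E.Finite) (hA : A.E ⊆ E) (hE : baseVertices k ⊆ E),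
      ∀ (a : EndT E) (c : k), ActsAs hE a c → ∀ v, A.act (EndT.res hA a) v = c • v := by
  -- A basis chosen among the generators is finite, so the union of the finite subquivers attached
  -- to its members is still finite.
  obtain ⟨b, hb, hspan, hli⟩ := exists_linearIndependent ℚ
    {v | ∃ (E : Set (MCrv k)) (_ : E.Finite) (hA : A.E ⊆ E) (n : ℕ)
    (p : Fin n → E) (W : Submodule ℚ (∀ i, H1 (p i).1))
    (hW : ∀ a : EndT E, ∀ w ∈ W, (fun i => a.1 (p i) (w i)) ∈ W) (π : W →ₗ[ℚ] A.V)
    (_ : ∀ (a : EndT E) (w : W),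
      π ⟨fun i => a.1 (p i) (w.1 i), hW a w.1 w.2⟩ = A.act (EndT.res hA a) (π w))
    (w : W) (_ : ∀ i, w.1 i ∈ ModulusCurve.fil2 (p i).1), v = π w}
  have hbfin : b.Finite := hli.setFinite
  have htop : Submodule.span ℚ b = ⊤ := hspan.trans hA
  choose E hE hAE hbE hact using fun v : b => A.exists_act_eq_smul_of_generator (hb v.2)
  have := hbfin.to_subtype
  refine ⟨(⋃ v, E v) ∪ A.E ∪ baseVertices k,
    ((Set.finite_iUnion hE).union A.finite_E).union (Set.toFinite _), fun _ h => Or.inl (Or.inr h),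
    fun _ h => Or.inr h, fun a c hc v => ?_⟩
  have hv : v ∈ Submodule.span ℚ b := htop ▸ Submodule.mem_top
  induction hv using Submodule.span_induction with
  | mem v hv =>
    exact hact ⟨v, hv⟩ (EndT.res (fun _ h => Or.inl (Or.inl (Set.mem_iUnion.2 ⟨_, h⟩))) a) c hc
  | zero => rw [map_zero, smul_zero]
  | add x y _ _ hx hy => rw [map_add, hx, hy, smul_add]
  | smul q x _ hx => rw [map_smul, hx, smul_comm]

/-- Over a large enough finite subquiver, an endomorphism acts on `A` and on `B` by one and the same
scalar, with which a `k`-linear map commutes. -/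
lemma NoriObj.mem_homs_of_linear {A B : NoriObj k} (hA : A.fil2 = ⊤) (hB : B.fil2 = ⊤)
    (φ : A.V →ₗ[k] B.V) : φ.restrictScalars ℚ ∈ homs A B := by
  obtain ⟨E₁, hE₁, hA₁, hb₁, h₁⟩ := A.exists_act_eq_smul hA
  obtain ⟨E₂, hE₂, hB₂, hb₂, h₂⟩ := B.exists_act_eq_smul hB
  refine ⟨E₁ ∪ E₂, hE₁.union hE₂, hA₁.trans Set.subset_union_left,
    hB₂.trans Set.subset_union_right, fun a v => ?_⟩
  obtain ⟨c, hc⟩ := exists_actsAs (hb₁.trans Set.subset_union_left) a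
  have e1 := h₁ (EndT.res Set.subset_union_left a) c hc v
  have e2 := h₂ (EndT.res Set.subset_union_right a) c hc (φ v)
  exact (congrArg φ e1).trans ((map_smul φ c v).trans e2.symm)

/-- The morphisms of unipotent objects are the `k`-linear maps. -/
def ECMMuni.homEquiv (A B : ECMMuni k) : (A ⟶ B) ≃+ (A.obj.V →ₗ[k] B.obj.V) where
  toFun φ := { toFun := φ.hom.1, map_add' := map_add φ.hom.1,
               map_smul' := NoriObj.map_smul_of_mem_homs φ.hom.2 }
  invFun φ := ObjectProperty.homMk
    (⟨φ.restrictScalars ℚ, NoriObj.mem_homs_of_linear A.property B.property φ⟩ : A.obj ⟶ B.obj)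
  left_inv _ := rfl
  right_inv _ := rfl
  map_add' _ _ := rfl

end NoriScalars

/-! ### The Lie algebra of a vector group -/

section LieVector
variable {k : Type u} [Field k] (V : Type u) [AddCommGroup V] [Module k V]

lemma eps_tmul_mem_lie (v : V) :
    (DualNumber.eps ⊗ₜ[k] v : DualNumber k ⊗[k] V) ∈ lie (vectorGroup (k := k) V) := by
  have h : (TrivSqZeroExt.fstHom k k k).toLinearMap.rTensor V
      (DualNumber.eps ⊗ₜ[k] v : DualNumber k ⊗[k] V) = 0 := by
    rw [LinearMap.rTensor_tmul]
    exact TensorProduct.zero_tmul _ _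
  exact h

lemma exists_eq_tmul_add_eps_tmul (x : DualNumber k ⊗[k] V) :
    ∃ v w : V, x = 1 ⊗ₜ v + DualNumber.eps ⊗ₜ w := by
  induction x with
  | zero => exact ⟨0, 0, by simp⟩
  | add x y hx hy =>
    obtain ⟨v, w, rfl⟩ := hx
    obtain ⟨v', w', rfl⟩ := hy
    exact ⟨v + v', w + w', by rw [TensorProduct.tmul_add, TensorProduct.tmul_add]; abel⟩
  | tmul a v =>
    refine ⟨a.fst • v, a.snd • v, ?_⟩
    rw [← TensorProduct.smul_tmul, ← TensorProduct.smul_tmul, ← TensorProduct.add_tmul]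
    congr 1
    ext <;> simp

/-- The Lie algebra of a vector group. -/
def lieVector : V ≃+ lie (vectorGroup (k := k) V) :=
  AddEquiv.ofBijective
    ({ toFun := fun v => ⟨_, eps_tmul_mem_lie V v⟩
       map_zero' := Subtype.ext (TensorProduct.tmul_zero _ _)
       map_add' := fun v w => Subtype.ext (TensorProduct.tmul_add _ v w) } :
      V →+ lie (vectorGroup (k := k) V)) (by
    constructor
    · intro v w h
      have h1 : (DualNumber.eps ⊗ₜ[k] v : DualNumber k ⊗[k] V) = DualNumber.eps ⊗ₜ w :=
        congrArg Subtype.val h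
      have h2 := congrArg (fun x => TensorProduct.lid k V
        ((TrivSqZeroExt.sndHom k k).rTensor V x)) h1
      simpa using h2
    · rintro ⟨x, hx⟩
      obtain ⟨v, w, rfl⟩ := exists_eq_tmul_add_eps_tmul V x
      have h1 : (TrivSqZeroExt.fstHom k k k).toLinearMap.rTensor V
        (1 ⊗ₜ v + DualNumber.eps ⊗ₜ w : DualNumber k ⊗[k] V) = 0 := hx
      have h2 := congrArg (TensorProduct.lid k V) h1
      have hv : v = 0 := by simpa using h2
      subst hv
      have e : (DualNumber.eps ⊗ₜ w : DualNumber k ⊗[k] V) = 1 ⊗ₜ 0 + DualNumber.eps ⊗ₜ w := by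
        rw [TensorProduct.tmul_zero, zero_add]
      exact ⟨w, Subtype.ext e⟩)

/-- The Lie algebra of a vector group up to isogeny. -/
def ratLieVector [Module ℚ V] : V ≃ₗ[ℚ] ℚ ⊗[ℤ] lie (vectorGroup (k := k) V) :=
  ((lieVector (k := k) V).trans (ratTensorEquiv (lieVector (k := k) V).symm)).toLinearEquiv
    fun q v => map_rat_smul ((lieVector (k := k) V).trans
      (ratTensorEquiv (lieVector (k := k) V).symm)) q v

end LieVector

/-! ### Construction of the functor -/

section Construction
variable {k : Type u} [Field k] [NumberField k]

lemma vectorGroupMap_add {k : Type u} [Field k] {V W : Type u} [AddCommGroup V] [Module k V] [AddCommGroup W]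
    [Module k W] (f g : V →ₗ[k] W) :
    vectorGroupMap (f + g) = vectorGroupMap f + vectorGroupMap g := by
  ext R x
  exact congr($(LinearMap.lTensor_add R f g) x)

lemma ECMMuni.homEquiv_id (A : ECMMuni k) :
    ECMMuni.homEquiv A A (𝟙 A) = LinearMap.id := rfl

lemma ECMMuni.homEquiv_comp {A B D : ECMMuni k} (φ : A ⟶ B) (ψ : B ⟶ D) :
    ECMMuni.homEquiv A D (φ ≫ ψ) = ECMMuni.homEquiv B D ψ ∘ₗ ECMMuni.homEquiv A B φ := rfl

variable (k) in
/-- The vector group of the underlying space of a unipotent object. -/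
def spaceGroup : ECMMuni k ⥤ GroupFunctor k where
  obj A := vectorGroup (k := k) A.obj.V
  map φ := vectorGroupMap (ECMMuni.homEquiv _ _ φ)
  map_id A := by rw [ECMMuni.homEquiv_id, vectorGroupMap_id]
  map_comp φ ψ := by rw [ECMMuni.homEquiv_comp, vectorGroupMap_comp]

variable (k) in
/-- The functor which takes a unipotent object to the vector group of its underlying space. -/
def vectorLM : ECMMuni k ⥤ Muni k :=
  ObjectProperty.lift _ (spaceGroup k ⋙ RatCat.incl _) fun A => isUnipotent_vectorGroup A.obj.V

instance : (vectorLM k).Additive where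
  map_add {A B φ ψ} := by
    refine ObjectProperty.hom_ext _ ?_
    change (1 : ℚ) ⊗ₜ[ℤ] vectorGroupMap (ECMMuni.homEquiv _ _ (φ + ψ)) =
      (1 : ℚ) ⊗ₜ[ℤ] vectorGroupMap (ECMMuni.homEquiv _ _ φ) +
      (1 : ℚ) ⊗ₜ[ℤ] vectorGroupMap (ECMMuni.homEquiv _ _ ψ)
    rw [map_add, vectorGroupMap_add, TensorProduct.tmul_add]

/-- The space `fil²` as the space of nilpotent functions. -/
def fil2NilEquiv (p : MCrv k) : (fil2Obj p).obj.V ≃ₗ[k] NilSpace p where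
  __ := (fil2Equiv p).symm.toAddEquiv
  map_smul' c x := (fil2Equiv p).symm.map_smul c x

lemma fil2NilEquiv_toFil2 {p : MCrv k} (r : Nilp p) :
    fil2NilEquiv p r.toFil2 = ⟨Nilp.toRing p r, r.toRing_mem⟩ :=
  (fil2Equiv p).symm_apply_eq.2 (fil2Equiv_toRing r).symm

lemma exists_toFil2 {p : MCrv k} (x : (fil2Obj p).obj.V) : ∃ r : Nilp p, r.toFil2 = x := by
  obtain ⟨x, hx⟩ := (x : fil2 p)
  obtain ⟨r, rfl⟩ := Nilp.exists_toH1 hx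
  exact ⟨r, rfl⟩

lemma fil2NilEquiv_natural {p q : MCrv k} (f : MCrv.Hom p q) :
    (fil2NilEquiv p).toLinearMap ∘ₗ ECMMuni.homEquiv _ _ (fil2Map f) =
      nilPull f ∘ₗ (fil2NilEquiv q).toLinearMap := by
  refine LinearMap.ext fun x => ?_
  obtain ⟨r, rfl⟩ := exists_toFil2 x
  have e : ECMMuni.homEquiv _ _ (fil2Map f) r.toFil2 = (r.pull f).toFil2 :=
    Subtype.ext (pull_toH1 f r)
  refine (congrArg (fil2NilEquiv p) e).trans ((fil2NilEquiv_toFil2 _).trans ?_)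
  exact (congrArg (nilPull f) (fil2NilEquiv_toFil2 r)).symm

/-- The isomorphism of the vector group of `fil²` with `J(X,Y)_uni`. -/
def vectorJuniIso (p : MCrv k) : vectorGroup (k := k) (fil2Obj p).obj.V ≅ juni p :=
  vectorGroupCongr (fil2NilEquiv p) ≪≫ juniIso p

lemma vectorJuniIso_natural {p q : MCrv k} (f : MCrv.Hom p q) :
    vectorGroupMap (ECMMuni.homEquiv _ _ (fil2Map f)) ≫ (vectorJuniIso p).hom =
      (vectorJuniIso q).hom ≫ juniMap f := by
  have h1 : vectorGroupMap (ECMMuni.homEquiv _ _ (fil2Map f)) ≫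
      vectorGroupMap (fil2NilEquiv p).toLinearMap =
        vectorGroupMap (fil2NilEquiv q).toLinearMap ≫ vectorGroupMap (nilPull f) := by
    rw [vectorGroupMap_comp, vectorGroupMap_comp, fil2NilEquiv_natural]
  change vectorGroupMap _ ≫ vectorGroupMap (fil2NilEquiv p).toLinearMap ≫ (juniIso p).hom =
    (vectorGroupMap (fil2NilEquiv q).toLinearMap ≫ (juniIso q).hom) ≫ juniMap f
  rw [← Category.assoc, h1, Category.assoc, juniIso_natural, Category.assoc]

lemma lieMap_vectorJuniIso {p : MCrv k} (r : Nilp p) :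
    lieMap (vectorJuniIso p).hom (lieVector _ r.toFil2) = r.toLie := by
  refine Subtype.ext (Eq.trans ?_ (juniIso_eps p r))
  change ((juniIso p).hom.app (.of k (DualNumber k))).hom
    ((fil2NilEquiv p).toLinearMap.lTensor (DualNumber k) (DualNumber.eps ⊗ₜ r.toFil2)) = _
  exact congrArg (fun n => ((juniIso p).hom.app (.of k (DualNumber k))).hom
    (DualNumber.eps ⊗ₜ[k] n)) (fil2NilEquiv_toFil2 r)

lemma lieRat_map_incl {k : Type u} [Field k] {G H : GroupFunctor k} (φ : G ⟶ H) (x : lie G) :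
    ((lieRat k).map ((RatCat.incl _).map φ)).hom ((1 : ℚ) ⊗ₜ[ℤ] x) = (1 : ℚ) ⊗ₜ[ℤ] lieMap φ x :=
  (RatCat.mapRat_tmul (lieFunctor k) 1 1 φ x).trans (by rw [one_mul]; rfl)

/-- The de Rham realization of `vectorLM`. -/
def vectorLMRealization : ObjectProperty.ι _ ⋙ NoriObj.forgetful k ≅
    vectorLM k ⋙ ObjectProperty.ι _ ⋙ lieRat k :=
  NatIso.ofComponents (fun A => (ratLieVector (k := k) A.obj.V).toModuleIso) fun {A B} φ => by
    refine ModuleCat.hom_ext (LinearMap.ext fun v => ?_)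
    exact (lieRat_map_incl (vectorGroupMap (ECMMuni.homEquiv _ _ φ)) (lieVector _ v)).symm

/-- Here `α` is `fil² ≅ N` followed by the exponential, and `β` is `v ↦ 1 ⊗ ε v`. Their
compatibility is the identity `exp(ε r) = 1 + ε r`. -/
lemma isLM_vectorLM : IsLM (vectorLM k) where
  additive := inferInstance
  exists_iso := by
    refine ⟨fun p => (RatCat.incl _).mapIso (vectorJuniIso p), vectorLMRealization, ?_, ?_⟩
    · intro p q f
      refine ((RatCat.incl (GroupFunctor k)).map_comp _ _).symm.trans
        (Eq.trans ?_ ((RatCat.incl (GroupFunctor k)).map_comp _ _))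
      exact congrArg (RatCat.incl (GroupFunctor k)).map (vectorJuniIso_natural f)
    · intro p r
      exact (lieRat_map_incl (vectorJuniIso p).hom (lieVector _ r.toFil2)).trans
        (congrArg (fun x => (1 : ℚ) ⊗ₜ[ℤ] x) (lieMap_vectorJuniIso r))

end Construction

/-! ### Expansions in powers of a uniformizer -/

section Expansion
variable {k A : Type*} [Field k] [CommRing A] [IsLocalRing A] [Algebra k A]

lemma exists_sub_sum_smul_pow_mem {τ : A} (hτ : IsLocalRing.maximalIdeal A = Ideal.span {τ})
    (hk : ∀ a : A, ∃ c : k, a - algebraMap k A c ∈ IsLocalRing.maximalIdeal A) {u : A}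
    (hu : u ∈ IsLocalRing.maximalIdeal A) (d : ℕ) :
    ∃ c : Fin d → k, u - ∑ i, c i • τ ^ (i.1 + 1) ∈ IsLocalRing.maximalIdeal A ^ (d + 1) := by
  induction d with
  | zero => exact ⟨0, by simpa using hu⟩
  | succ d ih =>
    obtain ⟨c, hc⟩ := ih
    obtain ⟨e, he⟩ := exists_sub_smul_pow_mem hτ hk (d + 1) hc
    refine ⟨Fin.snoc c e, ?_⟩
    simpa [Fin.sum_univ_castSucc, sub_sub] using he

lemma eq_zero_of_sum_smul_pow_mem [IsDomain A] {τ : A}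
    (hτ : IsLocalRing.maximalIdeal A = Ideal.span {τ}) (h0 : τ ≠ 0) (d : ℕ) (c : Fin d → k)
    (h : ∑ i, c i • τ ^ (i.1 + 1) ∈ IsLocalRing.maximalIdeal A ^ (d + 1)) : c = 0 := by
  induction d with
  | zero => exact Subsingleton.elim _ _
  | succ d ih =>
    have hm : τ ∈ IsLocalRing.maximalIdeal A := hτ ▸ Ideal.mem_span_singleton_self τ
    rw [Fin.sum_univ_castSucc] at h
    have h1 : c (Fin.last d) • τ ^ (d + 1) ∈ IsLocalRing.maximalIdeal A ^ (d + 1) :=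
      Submodule.smul_of_tower_mem _ _ (Ideal.pow_mem_pow hm _)
    have h2 := ih (fun i => c i.castSucc)
      ((Ideal.add_mem_iff_left _ h1).1 (Ideal.pow_le_pow_right (Nat.le_succ _) h))
    have h3 : ∀ i : Fin d, c i.castSucc = 0 := fun i => congrFun h2 i
    simp only [h3, zero_smul, Finset.sum_const_zero, zero_add] at h
    have h4 := eq_zero_of_smul_pow_mem hτ h0 h
    funext i
    exact Fin.lastCases h4 h3 i

end Expansion

/-! ### Unipotent objects of every dimension -/

section Dimension
variable {k : Type u} [Field k]

/-- The powers `t, …, t^d` form a basis of `𝔪/𝔪^(d+1)`; the modulus is `d + 1` because the constants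
do not belong to `fil²`. -/
lemma finrank_fil2_projMod [NumberField k] (d : ℕ) :
    Module.finrank k (fil2Obj (projMod k (d + 1))).obj.V = d := by
  let p := projMod k (d + 1)
  let P : (Fin d → k) →ₗ[k] Nilp p := Fintype.linearCombination k fun i x =>
    ⟨coord k x ^ (i.1 + 1), Ideal.pow_mem_of_mem _ (coordNilp k (d + 1) x).2 _ (Nat.succ_pos _)⟩
  have hP : ∀ c x, (P c x).1 = ∑ i, c i • coord k x ^ (i.1 + 1) := fun c x => by
    simp [P, Fintype.linearCombination_apply, Finset.sum_apply]
  let Q : (Fin d → k) →ₗ[k] (fil2Obj p).obj.V :=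
    { toFun := fun c => (P c).toFil2
      map_add' := fun c e => Subtype.ext (map_add (Nilp.toH1Lin p ∘ₗ P) c e)
      map_smul' := fun a c => Subtype.ext (map_smul (Nilp.toH1Lin p ∘ₗ P) a c) }
  have hQ : Function.Bijective Q := by
    constructor
    · refine (injective_iff_map_eq_zero Q).2 fun c hc => ?_
      have h1 : (P c).toH1 = 0 := congrArg Subtype.val hc
      rw [Nilp.toH1_eq_zero_iff, Nilp.toRing_eq_zero_iff] at h1
      have h2 := h1 (origin k)
      rw [hP, projMod_ideal_origin] at h2
      exact eq_zero_of_sum_smul_pow_mem (maximalIdeal_origin (k := k)) coord_origin_ne_zero d c h2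
    · intro x
      obtain ⟨r, rfl⟩ := exists_toFil2 x
      have hr : (r (origin k)).1 ∈ IsLocalRing.maximalIdeal ((projCurve k).stalk (origin k)) :=
        (EffDiv.ideal_red_of_pos p.Y (origin k)
          (by rw [projMod_mult_origin]; omega)).le (r (origin k)).2
      obtain ⟨c, hc⟩ := exists_sub_sum_smul_pow_mem (maximalIdeal_origin (k := k))
        exists_sub_const_mem hr d
      refine ⟨c, Subtype.ext (Eq.symm ((Nilp.toH1_eq_iff r (P c)).2 fun x => ?_))⟩
      by_cases hx : x = origin k
      · subst hx
        rw [hP, projMod_ideal_origin]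
        exact hc
      · rw [projMod_ideal_of_ne _ hx]
        trivial
  rw [← (LinearEquiv.ofBijective Q hQ).finrank_eq, Module.finrank_fin_fun]

end Dimension

/-! ### Every functor with the required properties is an equivalence -/

section Equivalence
variable {k : Type u} [Field k] [NumberField k]

/-- The realization `β` is only `ℚ`-linear, but the dimension over `ℚ` is `[k : ℚ]` times the
dimension over `k`. -/
lemma finrank_eq_of_ratLinearEquiv {V W : Type*} [AddCommGroup V] [Module k V] [Module ℚ V]
    [IsScalarTower ℚ k V] [AddCommGroup W] [Module k W] [Module ℚ W] [IsScalarTower ℚ k W]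
    (e : V ≃ₗ[ℚ] W) : Module.finrank k V = Module.finrank k W := by
  have h : Module.finrank ℚ k * Module.finrank k V = Module.finrank ℚ k * Module.finrank k W := by
    rw [Module.finrank_mul_finrank, Module.finrank_mul_finrank, e.finrank_eq]
  exact Nat.eq_of_mul_eq_mul_left Module.finrank_pos h

/-- `L(A)` is the vector group of some space, whose dimension is read off from the Lie algebra
through `β`. The isomorphism is not claimed to be natural. -/
lemma exists_iso_vectorGroup_obj {L : ECMMuni k ⥤ Muni k}
    (β : ObjectProperty.ι _ ⋙ NoriObj.forgetful k ≅ L ⋙ ObjectProperty.ι _ ⋙ lieRat k)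
    (A : ECMMuni k) :
    Nonempty ((L.obj A).obj ≅ (RatCat.incl _).obj (vectorGroup (k := k) A.obj.V)) := by
  obtain ⟨V, ⟨e⟩⟩ := Muni.exists_iso_vectorGroup (L.obj A)
  let _ : Module ℚ V := Module.compHom V (algebraMap ℚ k)
  have : IsScalarTower ℚ k V := IsScalarTower.of_algebraMap_smul fun _ _ => rfl
  let i : A.obj.V ≃ₗ[ℚ] ℚ ⊗[ℤ] lie (vectorGroup (k := k) V) :=
    (β.app A ≪≫ (lieRat k).mapIso e).toLinearEquiv
  have h := finrank_eq_of_ratLinearEquiv (k := k) (i.trans (ratLieVector (k := k) V).symm)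
  exact ⟨e ≪≫ (RatCat.incl _).mapIso (vectorGroupCongr (LinearEquiv.ofFinrankEq _ _ h.symm))⟩

/-- Through `β`, the composite of `L` with the realization is the forgetful functor, which is
faithful. -/
lemma faithful_of_realization {L : ECMMuni k ⥤ Muni k}
    (β : ObjectProperty.ι _ ⋙ NoriObj.forgetful k ≅ L ⋙ ObjectProperty.ι _ ⋙ lieRat k) :
    L.Faithful where
  map_injective {A B} φ ψ h := by
    have h1 := β.hom.naturality φ
    have h2 := β.hom.naturality ψ
    have h3 : (L ⋙ ObjectProperty.ι _ ⋙ lieRat k).map φ =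
        (L ⋙ ObjectProperty.ι _ ⋙ lieRat k).map ψ :=
      congrArg (ObjectProperty.ι _ ⋙ lieRat k).map h
    rw [h3, ← h2] at h1
    have h4 := congrArg (· ≫ β.inv.app B) h1
    simp only [Category.assoc, Iso.hom_inv_id_app, Category.comp_id] at h4
    exact ObjectProperty.hom_ext _ (Subtype.ext (congrArg ModuleCat.Hom.hom h4))

/-- A dimension count. After identifying source and target with vector groups, `L` on `Hom(A, B)`
becomes an additive, hence `ℚ`-linear, injective endomorphism of `Hom_k(A, B)`. This space is finite
dimensional over `ℚ`, as `k` is a number field, so the endomorphism is surjective. -/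
lemma full_of_realization {L : ECMMuni k ⥤ Muni k} [L.Additive]
    (β : ObjectProperty.ι _ ⋙ NoriObj.forgetful k ≅ L ⋙ ObjectProperty.ι _ ⋙ lieRat k) :
    L.Full where
  map_surjective {A B} g := by
    obtain ⟨a⟩ := exists_iso_vectorGroup_obj β A
    obtain ⟨b⟩ := exists_iso_vectorGroup_obj β B
    have := faithful_of_realization β
    let T : (A.obj.V →ₗ[k] B.obj.V) →+ (A.obj.V →ₗ[k] B.obj.V) :=
      { toFun := fun f => (ratHomEquivLinear (k := k) A.obj.V B.obj.V).symm
          (a.inv ≫ (L.map ((ECMMuni.homEquiv A B).symm f)).hom ≫ b.hom)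
        map_zero' := by
          rw [map_zero, L.map_zero]
          exact (congrArg _ (by simp)).trans (map_zero _)
        map_add' := fun f f' => by
          rw [map_add, L.map_add]
          refine (congrArg _ ?_).trans (map_add _ _ _)
          rw [← Preadditive.comp_add, ← Preadditive.add_comp]
          rfl }
    have hT : Function.Injective T := by
      intro f f' h
      have h1 := (ratHomEquivLinear (k := k) A.obj.V B.obj.V).symm.injective h
      rw [cancel_epi, cancel_mono] at h1
      exact (ECMMuni.homEquiv A B).symm.injective
        (L.map_injective (ObjectProperty.hom_ext _ h1))
    have : Module.Finite ℚ (A.obj.V →ₗ[k] B.obj.V) := Module.Finite.trans k _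
    have hs : Function.Surjective T :=
      (LinearMap.injective_iff_surjective (f := T.toRatLinearMap)).1 hT
    obtain ⟨f, hf⟩ := hs (ratHomEquivLinear (k := k) A.obj.V B.obj.V |>.symm
      (a.inv ≫ g.hom ≫ b.hom))
    have h1 := (ratHomEquivLinear (k := k) A.obj.V B.obj.V).symm.injective hf
    rw [cancel_epi, cancel_mono] at h1
    exact ⟨_, ObjectProperty.hom_ext _ h1⟩

/-- A vector group is determined by its dimension, and the objects `fil²` of projective lines with
modulus attain all dimensions. -/
lemma essSurj_of_realization {L : ECMMuni k ⥤ Muni k}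
    (β : ObjectProperty.ι _ ⋙ NoriObj.forgetful k ≅ L ⋙ ObjectProperty.ι _ ⋙ lieRat k) :
    L.EssSurj where
  mem_essImage G := by
    obtain ⟨V, ⟨e⟩⟩ := Muni.exists_iso_vectorGroup G
    let A := fil2Obj (projMod k (Module.finrank k V + 1))
    obtain ⟨a⟩ := exists_iso_vectorGroup_obj β A
    have h : Module.finrank k A.obj.V = Module.finrank k V := finrank_fil2_projMod _
    let i : (L.obj A).obj ≅ G.obj :=
      a ≪≫ (RatCat.incl _).mapIso (vectorGroupCongr (LinearEquiv.ofFinrankEq _ _ h)) ≪≫ e.symm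
    exact ⟨A, ⟨(ObjectProperty.fullyFaithfulι _).preimageIso i⟩⟩

lemma IsLM.isEquivalence {L : ECMMuni k ⥤ Muni k} (h : IsLM L) : L.IsEquivalence := by
  have := h.additive
  obtain ⟨-, β, -⟩ := h.exists_iso
  exact { faithful := faithful_of_realization β
          full := full_of_realization β
          essSurj := essSurj_of_realization β }

end Equivalence
end ModulusCurve

end

theorem mainTheorem4 (k : Type u) [Field k] [NumberField k] :
    (∃ L : ModulusCurve.ECMMuni k ⥤ ModulusCurve.Muni k, ModulusCurve.IsLM L) ∧
    (∀ L : ModulusCurve.ECMMuni k ⥤ ModulusCurve.Muni k,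
      ModulusCurve.IsLM L → L.IsEquivalence) ∧
    ((∀ V : FGModuleCat.{u} k,
        ModulusCurve.IsUnipotent ((ModulusCurve.vectorGroupFunctor k).obj V).of) ∧
      (ModulusCurve.vectorGroupFunctor k).Full ∧
      (ModulusCurve.vectorGroupFunctor k).Faithful ∧
      ∀ G : ModulusCurve.Muni k, ∃ V : FGModuleCat.{u} k,
        Nonempty (G.obj ≅ (ModulusCurve.vectorGroupFunctor k).obj V)) := by
  exact ⟨⟨ModulusCurve.vectorLM k, ModulusCurve.isLM_vectorLM⟩, fun _ h => h.isEquivalence,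
    fun V => ModulusCurve.isUnipotent_vectorGroup V, ModulusCurve.vectorGroupFunctor_full,
    ModulusCurve.vectorGroupFunctor_faithful, ModulusCurve.Muni.exists_iso_vectorGroup⟩
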